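/- Let $(M,g)$ be a smooth Riemannian manifold of dimension $n$ with Levi-Civita connection $\nabla$, and let $\omega$ be a smooth $(p,q)$ double form on $M$ ($p,q\ge 0$), that is, a smooth covariant tensor field of rank $p+q$ which is alternating in its first $p$ and in its last $q$ arguments. With $(e_i)$ an orthonormal basis of the tangent space, $Y=(Y_1,Y_2,\dots)$ and $Z=(Z_1,\dots,Z_q)$, put $$D\omega(Y_0,\dots,Y_p;Z)=\sum_{i=0}^p(-1)^i(\nabla_{Y_i}\omega)(Y_0,\dots,\widehat{Y_i},\dots,Y_p;Z),\qquad \delta\omega(Y_1,\dots,Y_{p-1};Z)=-\sum_i(\nabla_{e_i}\omega)(e_i,Y_1,\dots,Y_{p-1};Z)$$ (with $\delta\omega=0$ if $p=0$), and $\tilde D\omega=(D\omega^t)^t$, $\tilde\delta\omega=(\delta\omega^t)^t$, where $\omega^t(Z;Y)=\omega(Y;Z)$. Put $\Delta=D\delta+\delta D$, $\tilde\Delta=\tilde D\tilde\delta+\tilde\delta\tilde D$ and $\nabla^*\nabla\omega=-\sum_i\nabla^2_{e_i,e_i}\omega$. Let $R(X,Y,Z,W)=g(R(X,Y)Z,W)$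 with $R(X,Y)=\nabla_Y\nabla_X-\nabla_X\nabla_Y+\nabla_{[X,Y]}$ be the curvature tensor. It defines at each point $x$ the curvature operator $E\mapsto\sum_{i<j}E(e_i,e_j)R(\cdot,\cdot,e_i,e_j)$ on the space of $2$-forms on $T_xM$, in which the $e^i\wedge e^j$ ($i<j$) are orthonormal. For a $2$-form $E$ let $\rho(E)$ be the skew endomorphism of $T_xM$ with $g(\rho(E)v,w)=E(v,w)$ and let $(\rho(E))_d$ be its extension by derivations to $(p,q)$ double forms (acting on both factors). Then at each point there is an orthonormal basis $(E_\alpha)$ of $2$-forms which are eigenvectors of the curvature operator, with eigenvalues $\lambda_\alpha$. For any choice of such bases let $$\mathrm{Ric}_L(\omega)=-\sum_\alpha\lambda_\alpha\,(\rho(E_\alpha))_d\bigl((\rho(E_\alpha))_d\,\omega\bigr),\qquad \Delta_L\omega=\nabla^*\nabla\omega+\tfrac12\mathrm{Ric}_L(\omega)$$ ($\Delta_L$ is the Lichnerowicz Laplacian). Then: 1. $\Delta_L\omega=\tfrac12(\Delta\omega+\tilde\Delta\omega)=\tfrac12\bigl(D\delta+\delta D+\tilde D\tilde\delta+\tilde\delta\tilde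 D\bigr)\omega.$ 2. If $M$ is compact (without boundary), then all the following integrals converge and $$\langle\Delta_L\omega,\omega\rangle_{L^2}=\tfrac12\bigl(\|D\omega\|^2+\|\delta\omega\|^2+\|\tilde D\omega\|^2+\|\tilde\delta\omega\|^2\bigr),$$ where $\langle\omega,\eta\rangle_{L^2}=\int_M\langle\omega,\eta\rangle\,dvol_g$ is taken with respect to the Riemannian volume measure and the pointwise inner product for which the double forms $e^{i_1}\wedge\dots\wedge e^{i_p}\otimes e^{j_1}\wedge\dots\wedge e^{j_q}$ ($i_1<\dots<i_p$, $j_1<\dots<j_q$) are orthonormal, and $\|\cdot\|$ is the corresponding norm. 3. If $M$ is compact (without boundary), then $\Delta_L\omega=0$ if and only if $D\omega=\delta\omega=\tilde D\omega=\tilde\delta\omega=0$. -/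

import Mathlib

open Bundle
open scoped Manifold ContDiff Topology

noncomputable section

namespace DoubleForms

section Algebra

variable {V : Type*} [NormedAddCommGroup V] [InnerProductSpace ℝ V]

/-- The `k`-th vector of a fixed orthonormal basis `(e_k)` of a Euclidean space. -/
def onb (V : Type*) [NormedAddCommGroup V] [InnerProductSpace ℝ V] [FiniteDimensional ℝ V]
    (k : Fin (Module.finrank ℝ V)) : V :=
  stdOrthonormalBasis ℝ V k

variable [FiniteDimensional ℝ V]

/-- The inner product of `(p,q)` double forms for which
`e^{i_1} ∧ ... ∧ e^{i_p} ⊗ e^{j_1} ∧ ... ∧ e^{j_q}`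
(`i_1 < ... < i_p`, `j_1 < ... < j_q`) is an orthonormal basis:
the sum over increasing multi-indices is written as the sum over all multi-indices
divided by `p! q!`. -/
def formInner {p q : ℕ} (φ η : (Fin p → V) → (Fin q → V) → ℝ) : ℝ :=
  ((p.factorial : ℝ) * (q.factorial : ℝ))⁻¹ *
    ∑ I : Fin p → Fin (Module.finrank ℝ V), ∑ J : Fin q → Fin (Module.finrank ℝ V),
      φ (fun a => onb V (I a)) (fun b => onb V (J b)) *
        η (fun a => onb V (I a)) (fun b => onb V (J b))

/-- The inner product of 2-forms for which the `e^i ∧ e^j`, `i < j`, are orthonormal. -/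
def twoFormInner (E F : V [⋀^Fin 2]→ₗ[ℝ] ℝ) : ℝ :=
  (1 / 2 : ℝ) * ∑ i, ∑ j, E ![onb V i, onb V j] * F ![onb V i, onb V j]

/-- The skew operator `ρ(E) : V → V` of a 2-form `E`, determined by `⟨ρ(E) v, w⟩ = E(v, w)`.
It is the operator of the bilinear form `ρ(E)`, where
`ρ(e^i ∧ e^j) = e^i ⊗ e^j - e^j ⊗ e^i`. -/
def rho (E : V [⋀^Fin 2]→ₗ[ℝ] ℝ) (v : V) : V :=
  ∑ k, E ![v, onb V k] • onb V k

/-- `(ρ(E))_d`: the extension of `ρ(E)` by derivations to `(p,q)` double forms (on both factors).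
On a covector `θ` it is `θ ∘ ρ(E)*`, with the adjoint `ρ(E)* = -ρ(E)`. -/
def rhoD {p q : ℕ} (E : V [⋀^Fin 2]→ₗ[ℝ] ℝ) (φ : (Fin p → V) → (Fin q → V) → ℝ) :
    (Fin p → V) → (Fin q → V) → ℝ :=
  fun Y Z =>
    (∑ i, φ (Function.update Y i (-rho E (Y i))) Z) +
      ∑ j, φ Y (Function.update Z j (-rho E (Z j)))

end Algebra

section Manifold

variable {n : ℕ} {M : Type*} [TopologicalSpace M] [ChartedSpace (EuclideanSpace ℝ (Fin n)) M]

/-- An instance of finite dimension for the tangent spaces. -/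
instance finiteDimensionalTangent (x : M) : FiniteDimensional ℝ (TangentSpace (𝓡 n) x) :=
  inferInstanceAs (FiniteDimensional ℝ (EuclideanSpace ℝ (Fin n)))

/-- A (not necessarily smooth) vector field. -/
abbrev VField (n : ℕ) (M : Type*) [TopologicalSpace M]
    [ChartedSpace (EuclideanSpace ℝ (Fin n)) M] : Type _ :=
  ∀ x : M, TangentSpace (𝓡 n) x

/-- A field of functions of `p + q` tangent vectors. All operators below are defined on such
fields; they are applied only to double forms and to what the operators make of them. -/
abbrev TensorField (n : ℕ) (M : Type*) [TopologicalSpace M]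
    [ChartedSpace (EuclideanSpace ℝ (Fin n)) M] (p q : ℕ) : Type _ :=
  ∀ x : M, (Fin p → TangentSpace (𝓡 n) x) → (Fin q → TangentSpace (𝓡 n) x) → ℝ

/-- Transposition `φ^t` of a double form. -/
def transpose {p q : ℕ} (φ : TensorField n M p q) : TensorField n M q p := fun x Z Y => φ x Y Z

variable [IsManifold (𝓡 n) ∞ M]

/-- A smooth `(p,q)` double form on `M`: at each point a multilinear form in `p + q` tangent
vectors that is alternating in the first `p` and in the last `q`, depending smoothly on
the point. -/
structure DoubleForm (n : ℕ) (M : Type*) [TopologicalSpace M]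
    [ChartedSpace (EuclideanSpace ℝ (Fin n)) M] [IsManifold (𝓡 n) ∞ M] (p q : ℕ) where
  /-- the value at a point -/
  form : ∀ x : M, (TangentSpace (𝓡 n) x) [⋀^Fin p]→ₗ[ℝ] ((TangentSpace (𝓡 n) x) [⋀^Fin q]→ₗ[ℝ] ℝ)
  /-- plugging in vector fields that are smooth at `x` gives a function that is smooth at `x` -/
  smooth : ∀ (x : M) (Y : Fin p → VField n M) (Z : Fin q → VField n M),
    (∀ i, ContMDiffAt (𝓡 n) (𝓡 n).tangent ∞
      (fun y => (⟨y, Y i y⟩ : TangentBundle (𝓡 n) M)) x) →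
    (∀ j, ContMDiffAt (𝓡 n) (𝓡 n).tangent ∞
      (fun y => (⟨y, Z j y⟩ : TangentBundle (𝓡 n) M)) x) →
    ContMDiffAt (𝓡 n) 𝓘(ℝ, ℝ) ∞ (fun y => form y (fun i => Y i y) (fun j => Z j y)) x

/-- The underlying field. -/
def DoubleForm.toField {p q : ℕ} (φ : DoubleForm n M p q) : TensorField n M p q :=
  fun x Y Z => φ.form x Y Z

/-- The extension of a tangent vector `v` at `x` to a vector field, smooth near `x`
(with constant components in the preferred chart at `x`). -/
def extendVec {x : M} (v : TangentSpace (𝓡 n) x) : VField n M :=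
  FiberBundle.extend (EuclideanSpace ℝ (Fin n)) v

variable [RiemannianBundle (fun x : M => TangentSpace (𝓡 n) x)]

/-- The function `g(X, Y)`. -/
def metric (X Y : VField n M) (x : M) : ℝ := inner ℝ (X x) (Y x)

/-- The right-hand side of the Koszul formula for `2 g(∇_X Y, Z)` at the point `x`. -/
def koszul (X Y Z : VField n M) (x : M) : ℝ :=
  mvfderiv (𝓡 n) (metric Y Z) x (X x) + mvfderiv (𝓡 n) (metric Z X) x (Y x)
    - mvfderiv (𝓡 n) (metric X Y) x (Z x)
    + inner ℝ (VectorField.mlieBracket (𝓡 n) X Y x) (Z x)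
    - inner ℝ (VectorField.mlieBracket (𝓡 n) Y Z x) (X x)
    + inner ℝ (VectorField.mlieBracket (𝓡 n) Z X x) (Y x)

/-- The orthonormal basis `(e_k)` of `T_x M`. -/
def frame (x : M) (k : Fin (Module.finrank ℝ (TangentSpace (𝓡 n) x))) : TangentSpace (𝓡 n) x :=
  onb (TangentSpace (𝓡 n) x) k

/-- The Levi-Civita connection: `leviCivita Y x v = ∇_v Y` at `x`, the tangent vector
whose inner products with the `e_k` are given by the Koszul formula. -/
def leviCivita (Y : VField n M) (x : M) (v : TangentSpace (𝓡 n) x) : TangentSpace (𝓡 n) x :=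
  ∑ k, ((1 / 2 : ℝ) * koszul (extendVec v) Y (extendVec (frame x k)) x) • frame x k

/-- The covariant derivative of a double form, `nabla φ x v = ∇_v φ` at `x`. -/
def nabla {p q : ℕ} (φ : TensorField n M p q) (x : M) (v : TangentSpace (𝓡 n) x) :
    (Fin p → TangentSpace (𝓡 n) x) → (Fin q → TangentSpace (𝓡 n) x) → ℝ :=
  fun Y Z =>
    mvfderiv (𝓡 n) (fun y => φ y (fun i => extendVec (Y i) y) (fun j => extendVec (Z j) y)) x v
      - (∑ i, φ x (Function.update Y i (leviCivita (extendVec (Y i)) x v)) Z)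
      - ∑ j, φ x Y (Function.update Z j (leviCivita (extendVec (Z j)) x v))

/-- The second covariant derivative `∇²_{u,v} φ = ∇_u (∇_V φ) - ∇_{∇_u V} φ`. -/
def nabla2 {p q : ℕ} (φ : TensorField n M p q) (x : M) (u v : TangentSpace (𝓡 n) x) :
    (Fin p → TangentSpace (𝓡 n) x) → (Fin q → TangentSpace (𝓡 n) x) → ℝ :=
  fun Y Z =>
    nabla (fun y => nabla φ y (extendVec v y)) x u Y Z - nabla φ x (leviCivita (extendVec v) x u) Y Z

/-- The connection Laplacian `∇*∇ φ = - ∑ ∇²_{e_k,e_k} φ`. -/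
def connectionLaplacian {p q : ℕ} (φ : TensorField n M p q) : TensorField n M p q :=
  fun x Y Z => -∑ k, nabla2 φ x (frame x k) (frame x k) Y Z

/-- `Dφ(Y_0,...,Y_p; Z) = ∑ (-1)^i ∇_{Y_i} φ(Y_0,..,Ŷ_i,..,Y_p; Z)`. -/
def extD {p q : ℕ} (φ : TensorField n M p q) : TensorField n M (p + 1) q :=
  fun x Y Z => ∑ i : Fin (p + 1), (-1 : ℝ) ^ (i : ℕ) * nabla φ x (Y i) (i.removeNth Y) Z

/-- `δφ(Y_1,...,Y_{p-1}; Z) = - ∑ (∇_{e_k} φ)(e_k,Y_1,...,Y_{p-1}; Z)`, and `δφ = 0` if `p = 0`. -/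
def codiff {p q : ℕ} (φ : TensorField n M p q) : TensorField n M (p - 1) q :=
  match p, φ with
  | 0, _ => 0
  | p + 1, φ => fun x (Y : Fin p → TangentSpace (𝓡 n) x) Z =>
      -∑ k, nabla φ x (frame x k)
        (Fin.cons (α := fun _ => TangentSpace (𝓡 n) x) (frame x k) Y) Z

/-- `D̃φ = (D(φ^t))^t`. -/
def extDTilde {p q : ℕ} (φ : TensorField n M p q) : TensorField n M p (q + 1) :=
  transpose (extD (transpose φ))

/-- `δ̃φ = (δ(φ^t))^t`. -/
def codiffTilde {p q : ℕ} (φ : TensorField n M p q) : TensorField n M p (q - 1) :=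
  transpose (codiff (transpose φ))

/-- `Δφ = Dδφ + δDφ`; for `p = 0` the first term is absent, as `δφ = 0`. -/
def hodgeLaplacian {p q : ℕ} (φ : TensorField n M p q) : TensorField n M p q :=
  match p, φ with
  | 0, φ => codiff (extD φ)
  | m + 1, φ =>
      let φ₁ : TensorField n M m q := codiff φ
      let φ₂ : TensorField n M (m + 1) q := codiff (extD φ)
      extD φ₁ + φ₂

/-- `Δ̃φ = D̃δ̃φ + δ̃D̃φ`; for `q = 0` the first term is absent, as `δ̃φ = 0`. -/
def hodgeLaplacianTilde {p q : ℕ} (φ : TensorField n M p q) : TensorField n M p q :=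
  match q, φ with
  | 0, φ => codiffTilde (extDTilde φ)
  | m + 1, φ =>
      let φ₁ : TensorField n M p m := codiffTilde φ
      let φ₂ : TensorField n M p (m + 1) := codiffTilde (extDTilde φ)
      extDTilde φ₁ + φ₂

/-- The curvature transformation `R(u,v)w = ∇_V ∇_U W - ∇_U ∇_V W + ∇_{[U,V]} W`. -/
def curvature (x : M) (u v w : TangentSpace (𝓡 n) x) : TangentSpace (𝓡 n) x :=
  leviCivita (fun y => leviCivita (extendVec w) y (extendVec u y)) x v
    - leviCivita (fun y => leviCivita (extendVec w) y (extendVec v y)) x u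
    + leviCivita (extendVec w) x (VectorField.mlieBracket (𝓡 n) (extendVec u) (extendVec v) x)

/-- The curvature tensor as a `(2,2)` double form, `R(u,v,w,z) = g(R(u,v)w, z)`
(so `R(u,v,u,v)` is the sectional curvature if `u`, `v` are orthonormal). -/
def curvature4 (x : M) (u v w z : TangentSpace (𝓡 n) x) : ℝ :=
  inner ℝ (curvature x u v w) z

/-- 2-forms on `T_x M`. -/
abbrev TwoForm (n : ℕ) {M : Type*} [TopologicalSpace M]
    [ChartedSpace (EuclideanSpace ℝ (Fin n)) M] (x : M) : Type _ :=
  (TangentSpace (𝓡 n) x) [⋀^Fin 2]→ₗ[ℝ] ℝ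

/-- An orthonormal basis `(E_α)` of the 2-forms at `x` consisting of eigenvectors of the curvature
operator `E ↦ ∑_{i<j} E(e_i,e_j) R(·,·,e_i,e_j)`, with the eigenvalues `λ_α`. -/
structure CurvatureEigenbasis (n : ℕ) {M : Type*} [TopologicalSpace M]
    [ChartedSpace (EuclideanSpace ℝ (Fin n)) M] [IsManifold (𝓡 n) ∞ M]
    [RiemannianBundle (fun x : M => TangentSpace (𝓡 n) x)] (x : M) where
  /-- the basis `(E_α)` -/
  basis : Module.Basis (Fin (Module.finrank ℝ (TwoForm n x))) ℝ (TwoForm n x)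
  /-- the eigenvalues `λ_α` -/
  eigenvalue : Fin (Module.finrank ℝ (TwoForm n x)) → ℝ
  orthonormal : ∀ α β, twoFormInner (basis α) (basis β) = if α = β then 1 else 0
  eigen : ∀ α (u v : TangentSpace (𝓡 n) x),
    (1 / 2 : ℝ) * ∑ i, ∑ j,
      basis α ![frame x i, frame x j] * curvature4 x u v (frame x i) (frame x j) =
    eigenvalue α * basis α ![u, v]

/-- The Lichnerowicz curvature term `Ric_L(φ) = - ∑ λ_α (ρ(E_α))_d ((ρ(E_α))_d φ)`. -/
def ricL {p q : ℕ} (B : ∀ x : M, CurvatureEigenbasis n x) (φ : TensorField n M p q) : TensorField n M p q :=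
  fun x Y Z => -∑ α, (B x).eigenvalue α *
    rhoD ((B x).basis α) (rhoD ((B x).basis α) (φ x)) Y Z

/-- The Lichnerowicz Laplacian `Δ_L φ = ∇*∇φ + (1/2) Ric_L(φ)`. -/
def lichnerowiczLaplacian {p q : ℕ} (B : ∀ x : M, CurvatureEigenbasis n x) (φ : TensorField n M p q) :
    TensorField n M p q :=
  connectionLaplacian φ + (1 / 2 : ℝ) • ricL B φ

/-- `√det(g_ij)` in the preferred chart at `x₀`, as a function on the target of the chart. -/
def chartDensity (x₀ : M) (u : EuclideanSpace ℝ (Fin n)) : ℝ :=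
  √(Matrix.det (Matrix.of fun i j : Fin n =>
    (inner ℝ
      (mfderiv (𝓡 n) (𝓡 n) (extChartAt (𝓡 n) x₀).symm u (EuclideanSpace.single i (1 : ℝ)))
      (mfderiv (𝓡 n) (𝓡 n) (extChartAt (𝓡 n) x₀).symm u (EuclideanSpace.single j (1 : ℝ))) : ℝ)))

/-- The Riemannian volume of the domain of the preferred chart at `x₀`, extended by zero to `M`:
the image of `√det(g_ij) du` under the inverse of the chart. -/
def chartVolume [MeasurableSpace M] (x₀ : M) : MeasureTheory.Measure M :=
  ((MeasureTheory.volume.restrict (extChartAt (𝓡 n) x₀).target).withDensity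
    fun u => ENNReal.ofReal (chartDensity x₀ u)).map (extChartAt (𝓡 n) x₀).symm

/-- The Riemannian volume measure of `M`: the least measure that dominates the volume measures of
the chart domains (so, in the second countable case, the one that restricts to each of them). -/
def riemannianVolume (n : ℕ) (M : Type*) [TopologicalSpace M]
    [ChartedSpace (EuclideanSpace ℝ (Fin n)) M] [IsManifold (𝓡 n) ∞ M]
    [RiemannianBundle (fun x : M => TangentSpace (𝓡 n) x)] [MeasurableSpace M] :
    MeasureTheory.Measure M :=
  ⨆ x₀ : M, chartVolume (n := n) x₀

/-- The pointwise inner product `x ↦ ⟨φ, η⟩(x)`. -/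
def pointInner {p q : ℕ} (φ η : TensorField n M p q) (x : M) : ℝ :=
  formInner (φ x) (η x)

/-- The `L²` inner product `∫_M ⟨φ, η⟩ dvol`. -/
def l2Inner [MeasurableSpace M] {p q : ℕ} (φ η : TensorField n M p q) : ℝ :=
  ∫ x, pointInner φ η x ∂(riemannianVolume n M)

/-- `⟨φ, η⟩` is integrable over `M`, so that the `L²` inner product is meaningful. -/
def L2Defined [MeasurableSpace M] {p q : ℕ} (φ η : TensorField n M p q) : Prop :=
  MeasureTheory.Integrable (pointInner φ η) (riemannianVolume n M)

end Manifold

end DoubleForms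

end

noncomputable section

/-! Pointwise identity. Δ treats ω as a form in its first p arguments only. Since D and δ are an
alternation and a trace of ∇, and ∇ commutes with traces, Dδ + δD is ∇*∇ plus, for each of the first
p slots, a traced commutator of second covariant derivatives. By the Ricci identity
(`ricci_identity`) such a commutator is the curvature acting as a derivation on all p + q slots. The
symmetries of R make the curvature operator symmetric, and an orthonormal eigenbasis gives R(u,v) =
∑ λ_α E_α(u,v) ρ(E_α) (`curvature_eq_sum_rho`). After the trace, the commutators become the part of
-∑ λ_α ρ(E_α)_d ρ(E_α)_d ω in which the outer derivation hits the first factor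
(`hodgeLaplacian_eq`); the transposed operator gives the part in which it hits the second. Hence Δ +
Δ̃ = 2∇*∇ + Ric_L, and half of this is Δ_L (`lichnerowiczLaplacian_eq`).

Integral identity. ⟨Dα,β⟩ - ⟨α,δβ⟩ is the divergence of the field dual to v ↦ ⟨α, β(v,·)⟩
(`exists_divergence_adjoint`), so D and δ are adjoint once divergences integrate to zero
(`integral_divergence_eq_zero`). A partition of unity reduces that to one chart. There, with the
volume density ρ, ρ div X = ∑ ∂_j(ρ X^j) because ∂_a ρ = ρ div ∂_a (`smoothFn_density`), and the
integral of a derivative of a compactly supported function vanishes. The global measure is a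
supremum of chart measures; the change of variables formula shows that it restricts to each of them
(`restrict_riemannianVolume`).

Kernel. The L² identity writes ⟨Δ_L ω, ω⟩ as half a sum of four squared norms. A vanishing norm
forces the form to vanish, as the integrand is continuous and the measure is positive on nonempty
open sets.

The calculus is developed for tensor fields with arguments indexed by any finite type. Gradients,
contractions, products and relabellings then stay in one class, and D and δ are built from them
(`flat_extD`, `flat_codiff`). -/

namespace DoubleForms

set_option linter.unusedSectionVars false

/-! ### Germs of smooth functions and vector fields; tensoriality -/

section Calculus

variable {n : ℕ} {M : Type*} [TopologicalSpace M] [ChartedSpace (EuclideanSpace ℝ (Fin n)) M]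

/-- The function `f` is smooth in a neighbourhood of `x`. -/
def SmoothFn (n : ℕ) {M : Type*} [TopologicalSpace M]
    [ChartedSpace (EuclideanSpace ℝ (Fin n)) M] (f : M → ℝ) (x : M) : Prop :=
  ∀ᶠ y in 𝓝 x, ContMDiffAt (𝓡 n) 𝓘(ℝ, ℝ) ∞ f y

/-- The vector field `Y` is smooth in a neighbourhood of `x`. -/
def SmoothField [IsManifold (𝓡 n) ∞ M] (Y : VField n M) (x : M) : Prop :=
  ∀ᶠ y in 𝓝 x, ContMDiffAt (𝓡 n) (𝓡 n).tangent ∞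
    (fun z => (⟨z, Y z⟩ : TangentBundle (𝓡 n) M)) y

/-- The derivative `v(f)`. -/
def dfn (n : ℕ) {M : Type*} [TopologicalSpace M]
    [ChartedSpace (EuclideanSpace ℝ (Fin n)) M] (f : M → ℝ) (x : M)
    (v : TangentSpace (𝓡 n) x) : ℝ := mvfderiv (𝓡 n) f x v

namespace SmoothFn

variable {f g : M → ℝ} {x : M}

/-- This stability is why smoothness is required on a whole neighbourhood: smoothness of order ∞ at
a single point only provides C^k neighbourhoods that may shrink with k. -/
theorem eventually (h : SmoothFn n f x) : ∀ᶠ y in 𝓝 x, SmoothFn n f y :=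
  eventually_eventually_nhds.2 h

theorem contMDiffAt (h : SmoothFn n f x) : ContMDiffAt (𝓡 n) 𝓘(ℝ, ℝ) ∞ f x := h.self_of_nhds

theorem mdiff (h : SmoothFn n f x) : MDifferentiableAt (𝓡 n) 𝓘(ℝ, ℝ) f x :=
  h.contMDiffAt.mdifferentiableAt (by simp)

theorem congr (h : SmoothFn n f x) (e : ∀ᶠ y in 𝓝 x, g y = f y) : SmoothFn n g x := by
  filter_upwards [h, eventually_eventually_nhds.2 e] with y hy hey
  exact hy.congr_of_eventuallyEq hey

theorem const (c : ℝ) : SmoothFn n (fun _ : M => c) x :=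
  Filter.Eventually.of_forall fun _ => contMDiffAt_const

theorem add (hf : SmoothFn n f x) (hg : SmoothFn n g x) : SmoothFn n (fun y => f y + g y) x := by
  filter_upwards [hf, hg] with y h1 h2 using h1.add h2

theorem sub (hf : SmoothFn n f x) (hg : SmoothFn n g x) : SmoothFn n (fun y => f y - g y) x := by
  filter_upwards [hf, hg] with y h1 h2 using h1.sub h2

theorem mul (hf : SmoothFn n f x) (hg : SmoothFn n g x) : SmoothFn n (fun y => f y * g y) x := by
  filter_upwards [hf, hg] with y h1 h2 using h1.mul h2

theorem sum {κ : Type*} {s : Finset κ} {f : κ → M → ℝ} (h : ∀ i ∈ s, SmoothFn n (f i) x) :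
    SmoothFn n (fun y => ∑ i ∈ s, f i y) x := by
  classical
  induction s using Finset.induction_on with
  | empty => simpa using SmoothFn.const 0
  | insert a s ha ih =>
    simp only [Finset.sum_insert ha]
    exact (h a (by simp)).add (ih fun i hi => h i (by simp [hi]))

theorem comp_contDiffAt {φ : ℝ → ℝ} (hf : SmoothFn n f x)
    (hφ : ∀ᶠ t in 𝓝 (f x), ContDiffAt ℝ ∞ φ t) : SmoothFn n (fun y => φ (f y)) x := by
  filter_upwards [hf, hf.contMDiffAt.continuousAt.eventually hφ] with y h1 h2
  exact h2.contMDiffAt.comp y h1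

theorem inv (hf : SmoothFn n f x) (h0 : f x ≠ 0) : SmoothFn n (fun y => (f y)⁻¹) x :=
  hf.comp_contDiffAt (φ := fun t => t⁻¹) <| by
    filter_upwards [isOpen_ne.mem_nhds h0] with t ht using contDiffAt_inv ℝ ht

theorem sqrt (hf : SmoothFn n f x) (h0 : f x ≠ 0) : SmoothFn n (fun y => √(f y)) x :=
  hf.comp_contDiffAt (φ := fun t => √t) <| by
    filter_upwards [isOpen_ne.mem_nhds h0] with t ht using Real.contDiffAt_sqrt ht

end SmoothFn

namespace SmoothField

variable [IsManifold (𝓡 n) ∞ M] {X Y : VField n M} {f : M → ℝ} {x : M}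

theorem eventually (h : SmoothField Y x) : ∀ᶠ y in 𝓝 x, SmoothField Y y :=
  eventually_eventually_nhds.2 h

theorem contMDiffAt (h : SmoothField Y x) : ContMDiffAt (𝓡 n) (𝓡 n).tangent ∞
    (fun z => (⟨z, Y z⟩ : TangentBundle (𝓡 n) M)) x := h.self_of_nhds

theorem mdiff (h : SmoothField Y x) : MDifferentiableAt (𝓡 n) (𝓡 n).tangent
    (fun z => (⟨z, Y z⟩ : TangentBundle (𝓡 n) M)) x :=
  h.contMDiffAt.mdifferentiableAt (by simp)

theorem congr (h : SmoothField Y x) (e : ∀ᶠ y in 𝓝 x, X y = Y y) : SmoothField X x := by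
  filter_upwards [h, eventually_eventually_nhds.2 e] with y hy hey
  refine hy.congr_of_eventuallyEq ?_
  filter_upwards [hey] with z hz
  rw [hz]

theorem add (hX : SmoothField X x) (hY : SmoothField Y x) : SmoothField (fun y => X y + Y y) x := by
  filter_upwards [hX, hY] with y h1 h2 using h1.add_section h2

theorem sub (hX : SmoothField X x) (hY : SmoothField Y x) : SmoothField (fun y => X y - Y y) x := by
  filter_upwards [hX, hY] with y h1 h2 using h1.sub_section h2

theorem smul (hf : SmoothFn n f x) (hY : SmoothField Y x) :
    SmoothField (fun y => f y • Y y) x := by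
  filter_upwards [hf, hY] with y h1 h2 using h1.smul_section h2

theorem const_smul (c : ℝ) (hY : SmoothField Y x) : SmoothField (fun y => c • Y y) x :=
  smul (SmoothFn.const c) hY

theorem zero : SmoothField (fun y => (0 : TangentSpace (𝓡 n) y)) x :=
  Filter.Eventually.of_forall fun y => contMDiff_zeroSection ℝ (TangentSpace (𝓡 n)) y

theorem sum {κ : Type*} {s : Finset κ} {Y : κ → VField n M} (h : ∀ i ∈ s, SmoothField (Y i) x) :
    SmoothField (fun y => ∑ i ∈ s, Y i y) x := by
  classical
  induction s using Finset.induction_on with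
  | empty => simpa using SmoothField.zero
  | insert a s ha ih =>
    simp only [Finset.sum_insert ha]
    exact (h a (by simp)).add (ih fun i hi => h i (by simp [hi]))

theorem deriv (hf : SmoothFn n f x) (hX : SmoothField X x) :
    SmoothFn n (fun y => dfn n f y (X y)) x := by
  filter_upwards [hf, hX] with y h1 h2
  -- The differential of `f` is smooth as a section of the bundle of homomorphisms; applying it to
  -- `X` gives a smooth map into the tangent bundle of ℝ, whose fibre component is the wanted
  -- function.
  have h3 := h1.mfderiv_const (m := ∞) (by simp)
  have := ContMDiffAt.clm_apply_of_inCoordinates (b₁ := id) (b₂ := f) (v := X) h3 h2 h1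
  rw [contMDiffAt_totalSpace] at this
  simpa using! this.2

theorem bracket (hX : SmoothField X x) (hY : SmoothField Y x) :
    SmoothField (VectorField.mlieBracket (𝓡 n) X Y) x := by
  filter_upwards [hX, hY] with y h1 h2
  have : IsManifold (𝓡 n) (∞ + 1) M := ‹IsManifold (𝓡 n) ∞ M›
  have : IsManifold (𝓡 n) (minSmoothness ℝ 2) M := by
    rw [minSmoothness_of_isRCLikeNormedField]; infer_instance
  exact ContMDiffAt.mlieBracket_vectorField (m := ⊤) (n := ⊤) h1 h2 (by simp)

theorem extendVec (x : M) (v : TangentSpace (𝓡 n) x) : SmoothField (extendVec v) x := by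
  obtain ⟨s, hs, h⟩ := FiberBundle.exists_contMDiffOn_extend (k := ∞) (𝓡 n)
    (EuclideanSpace ℝ (Fin n)) v
  filter_upwards [eventually_mem_nhds_iff.2 hs] with y hy
  exact h.contMDiffAt hy

end SmoothField

theorem extendVec_self [IsManifold (𝓡 n) ∞ M] {x : M} (v : TangentSpace (𝓡 n) x) :
    extendVec v x = v := FiberBundle.extend_apply_self ..

/-- Near every point there is a smooth frame, with coefficients depending smoothly on the field. -/
theorem exists_smooth_frame [IsManifold (𝓡 n) ∞ M] (x : M) :
    ∃ (s : Fin n → VField n M) (c : Fin n → ∀ y : M, TangentSpace (𝓡 n) y →ₗ[ℝ] ℝ),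
      (∀ i, SmoothField (s i) x) ∧
      (∀ i (Y : VField n M), SmoothField Y x → SmoothFn n (fun y => c i y (Y y)) x) ∧
      (∀ᶠ y in 𝓝 x, ∀ v : TangentSpace (𝓡 n) y, v = ∑ i, c i y v • s i y) ∧
      (∀ᶠ y in 𝓝 x, LinearIndependent ℝ (fun i => s i y)) := by
  let t := trivializationAt (EuclideanSpace ℝ (Fin n)) (TangentSpace (𝓡 n) : M → Type _) x
  let b := (EuclideanSpace.basisFun (Fin n) ℝ).toBasis
  have hx : t.baseSet ∈ 𝓝 x :=
    t.open_baseSet.mem_nhds (FiberBundle.mem_baseSet_trivializationAt' x)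
  refine ⟨t.localFrame b, t.localFrameCoeff (𝓡 n) b, fun i => ?_, fun i Y hY => ?_, ?_, ?_⟩
  · filter_upwards [hx] with y hy using contMDiffAt_localFrame_of_mem ∞ _ b i hy
  · filter_upwards [hx, hY] with y hy h using contMDiffAt_localFrameCoeff b hy h i
  · classical
    filter_upwards [hx] with y hy v
    -- The expansion in the frame concerns sections, so `v` is extended by zero away from `y`; no
    -- smoothness is needed for a pointwise identity.
    simpa using t.eq_sum_localFrameCoeff_smul (I := 𝓡 n) (b := b) (s := Function.update 0 y v) hy
  · filter_upwards [hx] with y hy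
    exact (t.isLocalFrameOn_localFrame_baseSet (𝓡 n) 1 b).linearIndependent hy

/-- An operation on vector fields smooth near `x` that is linear over the functions smooth near `x`
depends only on the value of the field at `x`. -/
theorem eq_of_tensorial [IsManifold (𝓡 n) ∞ M] {x : M} {Φ : VField n M → ℝ}
    (hadd : ∀ X Y, SmoothField X x → SmoothField Y x → Φ (fun y => X y + Y y) = Φ X + Φ Y)
    (hsmul : ∀ f X, SmoothFn n f x → SmoothField X x → Φ (fun y => f y • X y) = f x * Φ X)
    {X Y : VField n M} (hX : SmoothField X x) (hY : SmoothField Y x) (h : X x = Y x) :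
    Φ X = Φ Y := by
  classical
  have hlocal : ∀ {X Y : VField n M}, SmoothField X x → SmoothField Y x →
      (∀ᶠ y in 𝓝 x, X y = Y y) → Φ X = Φ Y := by
    intro X Y hX hY hXY
    -- This indicator replaces a bump function: it is 1 near `x`, hence smooth there, its behaviour
    -- elsewhere is irrelevant, and `ψ X = ψ Y` holds on all of `M`.
    let ψ : M → ℝ := fun y => if X y = Y y then 1 else 0
    have hψ : SmoothFn n ψ x := (SmoothFn.const 1).congr (by
      filter_upwards [hXY] with y hy
      simp [ψ, hy])
    have hψx : ψ x = 1 := by simp [ψ, hXY.self_of_nhds]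
    have e : (fun y => ψ y • X y) = fun y => ψ y • Y y := by
      funext y
      by_cases hy : X y = Y y <;> simp [ψ, hy]
    have h1 := hsmul ψ X hψ hX
    rw [e, hsmul ψ Y hψ hY, hψx] at h1
    linarith
  obtain ⟨s, c, hs, hc, hexp, -⟩ := exists_smooth_frame (n := n) x
  have hsum : ∀ (S : Finset (Fin n)) (f : Fin n → M → ℝ), (∀ i, SmoothFn n (f i) x) →
      Φ (fun y => ∑ i ∈ S, f i y • s i y) = ∑ i ∈ S, f i x * Φ (s i) := by
    intro S f hf
    induction S using Finset.induction_on with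
    | empty =>
      have := hsmul (fun _ => 0) (fun _ => 0) (SmoothFn.const 0) SmoothField.zero
      simpa using this
    | insert a S ha ih =>
      simp only [Finset.sum_insert ha]
      rw [hadd _ _ ((hs a).smul (hf a)) (SmoothField.sum fun i _ => (hs i).smul (hf i)), ih,
        hsmul _ _ (hf a) (hs a)]
  have key : ∀ {X : VField n M}, SmoothField X x → Φ X = ∑ i, c i x (X x) * Φ (s i) := by
    intro X hX
    rw [← hsum Finset.univ (fun i y => c i y (X y)) fun i => hc i X hX]
    exact hlocal hX (SmoothField.sum fun i _ => (hs i).smul (hc i X hX))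
      (hexp.mono fun y hy => hy (X y))
  rw [key hX, key hY, h]

end Calculus

/-! ### Derivatives of functions and Lie brackets -/

section Bracket

variable {n : ℕ} {M : Type*} [TopologicalSpace M] [ChartedSpace (EuclideanSpace ℝ (Fin n)) M]
  {x : M} {f g : M → ℝ} {X Y Z : VField n M}

theorem dfn_map_add (f : M → ℝ) (x : M) (v w : TangentSpace (𝓡 n) x) :
    dfn n f x (v + w) = dfn n f x v + dfn n f x w := map_add _ _ _

theorem dfn_map_smul (f : M → ℝ) (x : M) (c : ℝ) (v : TangentSpace (𝓡 n) x) :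
    dfn n f x (c • v) = c * dfn n f x v := by simp [dfn]

@[simp]
theorem dfn_map_zero (f : M → ℝ) (x : M) : dfn n f x 0 = 0 := map_zero _

theorem dfn_add (hf : SmoothFn n f x) (hg : SmoothFn n g x) (v : TangentSpace (𝓡 n) x) :
    dfn n (fun y => f y + g y) x v = dfn n f x v + dfn n g x v := by
  simp [dfn, mvfderiv_fun_add hf.mdiff hg.mdiff]

theorem dfn_sub (hf : SmoothFn n f x) (hg : SmoothFn n g x) (v : TangentSpace (𝓡 n) x) :
    dfn n (fun y => f y - g y) x v = dfn n f x v - dfn n g x v := by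
  simp [dfn, mvfderiv_fun_sub hf.mdiff hg.mdiff]

theorem dfn_mul (hf : SmoothFn n f x) (hg : SmoothFn n g x) (v : TangentSpace (𝓡 n) x) :
    dfn n (fun y => f y * g y) x v = dfn n f x v * g x + f x * dfn n g x v := by
  simp [dfn, mvfderiv_fun_mul hf.mdiff hg.mdiff]; ring

theorem dfn_const (c : ℝ) (v : TangentSpace (𝓡 n) x) : dfn n (fun _ : M => c) x v = 0 := by
  simp [dfn, mvfderiv_const]

theorem dfn_const_mul (c : ℝ) (hg : SmoothFn n g x) (v : TangentSpace (𝓡 n) x) :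
    dfn n (fun y => c * g y) x v = c * dfn n g x v := by
  rw [dfn_mul (SmoothFn.const c) hg, dfn_const]; ring

theorem dfn_sum {κ : Type*} {s : Finset κ} {f : κ → M → ℝ} (h : ∀ i ∈ s, SmoothFn n (f i) x)
    (v : TangentSpace (𝓡 n) x) :
    dfn n (fun y => ∑ i ∈ s, f i y) x v = ∑ i ∈ s, dfn n (f i) x v := by
  classical
  induction s using Finset.induction_on with
  | empty => simpa using dfn_const (n := n) (x := x) 0 v
  | insert a s ha ih =>
    simp only [Finset.sum_insert ha]
    rw [dfn_add (h a (by simp)) (SmoothFn.sum fun i hi => h i (by simp [hi])),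
      ih fun i hi => h i (by simp [hi])]

theorem dfn_congr (e : ∀ᶠ y in 𝓝 x, f y = g y) (v : TangentSpace (𝓡 n) x) :
    dfn n f x v = dfn n g x v := by
  have e' : f =ᶠ[𝓝 x] g := e
  simp only [dfn, mvfderiv]
  rw [e'.mfderiv_eq, e.self_of_nhds]

theorem bracket_swap (X Y : VField n M) (x : M) :
    VectorField.mlieBracket (𝓡 n) X Y x = - VectorField.mlieBracket (𝓡 n) Y X x :=
  VectorField.mlieBracket_swap_apply

theorem bracket_congr {X' Y' : VField n M} (hX : ∀ᶠ y in 𝓝 x, X' y = X y)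
    (hY : ∀ᶠ y in 𝓝 x, Y' y = Y y) :
    VectorField.mlieBracket (𝓡 n) X' Y' x = VectorField.mlieBracket (𝓡 n) X Y x :=
  Filter.EventuallyEq.mlieBracket_vectorField_eq hX hY

variable [IsManifold (𝓡 n) ∞ M]

theorem bracket_add_right (X : VField n M) (hY : SmoothField Y x) (hZ : SmoothField Z x) :
    VectorField.mlieBracket (𝓡 n) X (fun y => Y y + Z y) x =
      VectorField.mlieBracket (𝓡 n) X Y x + VectorField.mlieBracket (𝓡 n) X Z x :=
  VectorField.mlieBracket_add_right hY.mdiff hZ.mdiff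

theorem bracket_add_left (X : VField n M) (hY : SmoothField Y x) (hZ : SmoothField Z x) :
    VectorField.mlieBracket (𝓡 n) (fun y => Y y + Z y) X x =
      VectorField.mlieBracket (𝓡 n) Y X x + VectorField.mlieBracket (𝓡 n) Z X x :=
  VectorField.mlieBracket_add_left hY.mdiff hZ.mdiff

theorem bracket_smul_right (X : VField n M) (hf : SmoothFn n f x) (hY : SmoothField Y x) :
    VectorField.mlieBracket (𝓡 n) X (fun y => f y • Y y) x =
      dfn n f x (X x) • Y x + f x • VectorField.mlieBracket (𝓡 n) X Y x :=
  VectorField.mlieBracket_smul_right hf.mdiff hY.mdiff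

theorem bracket_smul_left (X : VField n M) (hf : SmoothFn n f x) (hY : SmoothField Y x) :
    VectorField.mlieBracket (𝓡 n) (fun y => f y • Y y) X x =
      -dfn n f x (X x) • Y x + f x • VectorField.mlieBracket (𝓡 n) Y X x := by
  have := VectorField.mlieBracket_smul_left (W := X) hf.mdiff hY.mdiff
  simpa using! this

theorem jacobi (hX : SmoothField X x) (hY : SmoothField Y x) (hZ : SmoothField Z x) :
    VectorField.mlieBracket (𝓡 n) X (VectorField.mlieBracket (𝓡 n) Y Z) x =
      VectorField.mlieBracket (𝓡 n) (VectorField.mlieBracket (𝓡 n) X Y) Z x +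
        VectorField.mlieBracket (𝓡 n) Y (VectorField.mlieBracket (𝓡 n) X Z) x := by
  have : IsManifold (𝓡 n) (minSmoothness ℝ 3) M := by
    rw [minSmoothness_of_isRCLikeNormedField]; infer_instance
  have h : ∀ {W : VField n M}, SmoothField W x → ContMDiffAt (𝓡 n) (𝓡 n).tangent
      (minSmoothness ℝ 2) (fun z => (⟨z, W z⟩ : TangentBundle (𝓡 n) M)) x := fun hW => by
    rw [minSmoothness_of_isRCLikeNormedField]
    exact hW.contMDiffAt.of_le (by exact WithTop.coe_le_coe.2 le_top)
  exact VectorField.leibniz_identity_mlieBracket_apply (h hX) (h hY) (h hZ)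

/-- The Lie bracket acts on functions as the commutator of derivations. -/
theorem dfn_bracket (hX : SmoothField X x) (hY : SmoothField Y x) (hf : SmoothFn n f x) :
    dfn n f x (VectorField.mlieBracket (𝓡 n) X Y x) =
      dfn n (fun y => dfn n f y (Y y)) x (X x) - dfn n (fun y => dfn n f y (X y)) x (Y x) := by
  -- The identity will be read off as the coefficient of a nonzero vector, which dimension zero does
  -- not have.
  obtain h0 | h0 := subsingleton_or_nontrivial (TangentSpace (𝓡 n) x)
  · simp [Subsingleton.elim (VectorField.mlieBracket (𝓡 n) X Y x) 0, Subsingleton.elim (X x) 0,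
      Subsingleton.elim (Y x) 0]
  obtain ⟨w, hw⟩ := exists_ne (0 : TangentSpace (𝓡 n) x)
  have hW : SmoothField (extendVec w) x := SmoothField.extendVec x w
  set W : VField n M := extendVec w with hWdef
  -- Expanding [X, [Y, fW]] by the Leibniz rule makes X(Yf) the coefficient of W. The Jacobi
  -- identity for X, Y and fW, minus f times that for X, Y and W, then compares [X,Y]f with the
  -- commutator of the derivations.
  have key : ∀ {X Y : VField n M}, SmoothField X x → SmoothField Y x →
      VectorField.mlieBracket (𝓡 n) X
        (VectorField.mlieBracket (𝓡 n) Y (fun y => f y • W y)) x =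
      dfn n (fun y => dfn n f y (Y y)) x (X x) • W x +
        dfn n f x (Y x) • VectorField.mlieBracket (𝓡 n) X W x +
        (dfn n f x (X x) • VectorField.mlieBracket (𝓡 n) Y W x +
          f x • VectorField.mlieBracket (𝓡 n) X (VectorField.mlieBracket (𝓡 n) Y W) x) := by
    intro X Y hX hY
    rw [bracket_congr (X := X) (Y := fun y => dfn n f y (Y y) • W y +
        f y • VectorField.mlieBracket (𝓡 n) Y W y) (by simp) (by
          filter_upwards [hf.eventually, hW.eventually] with y h1 h2
          exact bracket_smul_right Y h1 h2),
      bracket_add_right _ (hW.smul (hY.deriv hf)) ((hY.bracket hW).smul hf),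
      bracket_smul_right _ (hY.deriv hf) hW, bracket_smul_right _ hf (hY.bracket hW)]
  have h1 := jacobi hX hY (hW.smul hf)
  rw [key hX hY, key hY hX, bracket_smul_right _ hf hW, jacobi hX hY hW] at h1
  have h2 : (dfn n f x (VectorField.mlieBracket (𝓡 n) X Y x) -
      (dfn n (fun y => dfn n f y (Y y)) x (X x) - dfn n (fun y => dfn n f y (X y)) x (Y x))) • W x
      = 0 := by
    linear_combination (norm := module) -h1
  rw [smul_eq_zero, hWdef, extendVec_self] at h2
  linarith [h2.resolve_right hw]

end Bracket

/-! ### Orthonormal frames, the Koszul formula and the Levi-Civita connection -/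

section LeviCivita

variable {n : ℕ} {M : Type*} [TopologicalSpace M] [ChartedSpace (EuclideanSpace ℝ (Fin n)) M]

theorem orthonormalBasis_sum_inner {V : Type*} [NormedAddCommGroup V] [InnerProductSpace ℝ V]
    {ι : Type*} [Fintype ι] (b : OrthonormalBasis ι ℝ V) (v : V) :
    ∑ i, (inner ℝ v (b i) : ℝ) • b i = v := by
  simpa [real_inner_comm] using b.sum_repr' v

theorem finrank_tangent (x : M) : Module.finrank ℝ (TangentSpace (𝓡 n) x) = n := by
  have : Module.finrank ℝ (TangentSpace (𝓡 n) x) = Module.finrank ℝ (EuclideanSpace ℝ (Fin n)) :=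
    rfl
  simpa using this

variable [RiemannianBundle (fun x : M => TangentSpace (𝓡 n) x)]

/-- The orthonormal basis `frame x`. -/
def frameBasis (x : M) : OrthonormalBasis (Fin (Module.finrank ℝ (TangentSpace (𝓡 n) x))) ℝ
    (TangentSpace (𝓡 n) x) :=
  stdOrthonormalBasis ℝ (TangentSpace (𝓡 n) x)

theorem frameBasis_apply (x : M) (k) : frameBasis (n := n) x k = frame x k := rfl

theorem metric_comm (X Y : VField n M) : metric X Y = metric Y X := by
  funext y; exact real_inner_comm _ _

theorem koszul_eq (X Y Z : VField n M) (x : M) :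
    koszul X Y Z x = dfn n (metric Y Z) x (X x) + dfn n (metric Z X) x (Y x)
    - dfn n (metric X Y) x (Z x)
    + inner ℝ (VectorField.mlieBracket (𝓡 n) X Y x) (Z x)
    - inner ℝ (VectorField.mlieBracket (𝓡 n) Y Z x) (X x)
    + inner ℝ (VectorField.mlieBracket (𝓡 n) Z X x) (Y x) := rfl

theorem koszul_congr {x : M} {X Y Z X' Y' Z' : VField n M} (hX : ∀ᶠ y in 𝓝 x, X' y = X y)
    (hY : ∀ᶠ y in 𝓝 x, Y' y = Y y) (hZ : ∀ᶠ y in 𝓝 x, Z' y = Z y) :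
    koszul X' Y' Z' x = koszul X Y Z x := by
  have hm : ∀ {A A' B B' : VField n M}, (∀ᶠ y in 𝓝 x, A' y = A y) → (∀ᶠ y in 𝓝 x, B' y = B y) →
      ∀ᶠ y in 𝓝 x, metric A' B' y = metric A B y := by
    intro A A' B B' hA hB
    filter_upwards [hA, hB] with y h1 h2
    rw [metric, metric, h1, h2]
  rw [koszul_eq, koszul_eq, dfn_congr (hm hY hZ), dfn_congr (hm hZ hX), dfn_congr (hm hX hY),
    bracket_congr hX hY, bracket_congr hY hZ, bracket_congr hZ hX, hX.self_of_nhds,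
    hY.self_of_nhds, hZ.self_of_nhds]

variable [IsManifold (𝓡 n) ∞ M]

/-- A tangent vector is determined by its inner products with smooth vector fields. -/
theorem eq_of_inner_field {x : M} {v w : TangentSpace (𝓡 n) x}
    (h : ∀ Z : VField n M, SmoothField Z x → inner ℝ v (Z x) = (inner ℝ w (Z x) : ℝ)) : v = w := by
  refine ext_inner_right ℝ fun z => ?_
  simpa [extendVec_self] using h (extendVec z) (SmoothField.extendVec x z)

theorem leviCivita_congr {x : M} {Y Y' : VField n M} (hY : ∀ᶠ y in 𝓝 x, Y' y = Y y)
    (v : TangentSpace (𝓡 n) x) : leviCivita Y' x v = leviCivita Y x v := by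
  refine Finset.sum_congr rfl fun k _ => ?_
  rw [koszul_congr (Filter.Eventually.of_forall fun _ => rfl) hY
    (Filter.Eventually.of_forall fun _ => rfl)]

variable [IsContMDiffRiemannianBundle (𝓡 n) ∞ (EuclideanSpace ℝ (Fin n))
      (fun x : M => TangentSpace (𝓡 n) x)] {x : M} {f : M → ℝ} {X Y Z : VField n M}

theorem SmoothField.metric (hX : SmoothField X x) (hY : SmoothField Y x) :
    SmoothFn n (metric X Y) x := by
  filter_upwards [hX, hY] with y h1 h2 using h1.inner_bundle h2

theorem SmoothField.inner (hX : SmoothField X x) (hY : SmoothField Y x) :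
    SmoothFn n (fun y => (inner ℝ (X y) (Y y) : ℝ)) x := hX.metric hY

/-- Near every point there is a smooth orthonormal frame. -/
theorem exists_orthonormal_frame (x : M) : ∃ E : Fin n → VField n M,
    (∀ i, SmoothField (E i) x) ∧
    ∀ᶠ y in 𝓝 x, ∃ b : OrthonormalBasis (Fin n) ℝ (TangentSpace (𝓡 n) y), ∀ i, b i = E i y := by
  obtain ⟨s, -, hs, -, -, hli⟩ := exists_smooth_frame (n := n) x
  have hgs : ∀ i, SmoothField (fun y => InnerProductSpace.gramSchmidt ℝ (fun i => s i y) i) x := by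
    intro i
    -- The Gram–Schmidt recursion uses only earlier vectors, and its denominators are smooth and
    -- nonzero at `x`, so smoothness propagates along the index.
    induction i using WellFoundedLT.induction with
    | _ i ih =>
    have hne : ∀ j, InnerProductSpace.gramSchmidt ℝ (fun i => s i x) j ≠ 0 := fun j =>
      InnerProductSpace.gramSchmidt_ne_zero j hli.self_of_nhds
    simp only [InnerProductSpace.gramSchmidt_def _ _ i, Submodule.starProjection_singleton]
    refine (hs i).sub (SmoothField.sum fun j hj => ?_)
    have hj := ih j (by simpa using hj)
    refine SmoothField.smul (SmoothFn.mul (hj.inner (hs i)) ?_) hj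
    simp only [← real_inner_self_eq_norm_sq]
    refine SmoothFn.inv (hj.inner hj) ?_
    simpa using hne j
  refine ⟨fun i y => InnerProductSpace.gramSchmidtNormed ℝ (fun i => s i y) i, fun i => ?_, ?_⟩
  · simp only [InnerProductSpace.gramSchmidtNormed]
    refine SmoothField.smul ?_ (hgs i)
    simp only [norm_eq_sqrt_real_inner]
    have h0 : (inner ℝ (InnerProductSpace.gramSchmidt ℝ (fun i => s i x) i)
        (InnerProductSpace.gramSchmidt ℝ (fun i => s i x) i) : ℝ) ≠ 0 := by
      simpa using InnerProductSpace.gramSchmidt_ne_zero i hli.self_of_nhds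
    refine SmoothFn.inv (SmoothFn.sqrt ((hgs i).inner (hgs i)) h0) ?_
    exact (Real.sqrt_ne_zero real_inner_self_nonneg).2 h0
  · filter_upwards [hli] with y hy
    have ho := InnerProductSpace.gramSchmidtNormed_orthonormal (𝕜 := ℝ) hy
    refine ⟨OrthonormalBasis.mk ho (ge_of_eq ?_), fun i => by simp⟩
    exact ho.linearIndependent.span_eq_top_of_card_eq_finrank' (by simp [finrank_tangent])

theorem dfn_metric_smul_left (hf : SmoothFn n f x) (hX : SmoothField X x) (hY : SmoothField Y x)
    (v : TangentSpace (𝓡 n) x) :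
    dfn n (metric (fun y => f y • X y) Y) x v =
      dfn n f x v * inner ℝ (X x) (Y x) + f x * dfn n (metric X Y) x v := by
  have : metric (fun y => f y • X y) Y = fun y => f y * metric X Y y := by
    funext y; simp [metric, inner_smul_left]
  rw [this, dfn_mul hf (hX.metric hY)]
  rfl

theorem dfn_metric_add_left (hX : SmoothField X x) (hZ : SmoothField Z x) (hY : SmoothField Y x)
    (v : TangentSpace (𝓡 n) x) :
    dfn n (metric (fun y => X y + Z y) Y) x v =
      dfn n (metric X Y) x v + dfn n (metric Z Y) x v := by
  have : metric (fun y => X y + Z y) Y = fun y => metric X Y y + metric Z Y y := by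
    funext y; simp [metric, inner_add_left]
  rw [this, dfn_add (hX.metric hY) (hZ.metric hY)]

theorem koszul_add_left (hY : SmoothField Y x) (hZ : SmoothField Z x) {X X' : VField n M}
    (hX : SmoothField X x) (hX' : SmoothField X' x) :
    koszul (fun y => X y + X' y) Y Z x = koszul X Y Z x + koszul X' Y Z x := by
  simp only [koszul_eq, metric_comm Z _]
  rw [dfn_metric_add_left hX hX' hY, dfn_metric_add_left hX hX' hZ, bracket_add_left _ hX hX',
    bracket_add_right _ hX hX']
  simp only [inner_add_left, inner_add_right, dfn_map_add]
  ring

/-- The derivatives of `f` produced by the metric terms cancel those produced by the brackets, so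
the expression is linear over functions here. The third argument behaves likewise. -/
theorem koszul_smul_left (hY : SmoothField Y x) (hZ : SmoothField Z x) (hf : SmoothFn n f x)
    (hX : SmoothField X x) : koszul (fun y => f y • X y) Y Z x = f x * koszul X Y Z x := by
  simp only [koszul_eq, metric_comm Z _]
  rw [dfn_metric_smul_left hf hX hY, dfn_metric_smul_left hf hX hZ, bracket_smul_left _ hf hX,
    bracket_smul_right _ hf hX]
  simp only [inner_add_left, real_inner_smul_left, inner_smul_right, dfn_map_smul]
  ring

theorem koszul_add_right (hX : SmoothField X x) (hY : SmoothField Y x) {Z Z' : VField n M}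
    (hZ : SmoothField Z x) (hZ' : SmoothField Z' x) :
    koszul X Y (fun y => Z y + Z' y) x = koszul X Y Z x + koszul X Y Z' x := by
  simp only [koszul_eq, metric_comm Y _]
  rw [dfn_metric_add_left hZ hZ' hY, dfn_metric_add_left hZ hZ' hX, bracket_add_left _ hZ hZ',
    bracket_add_right _ hZ hZ']
  simp only [inner_add_left, inner_add_right, dfn_map_add]
  ring

theorem koszul_smul_right (hX : SmoothField X x) (hY : SmoothField Y x) (hf : SmoothFn n f x)
    (hZ : SmoothField Z x) : koszul X Y (fun y => f y • Z y) x = f x * koszul X Y Z x := by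
  simp only [koszul_eq, metric_comm Y _]
  rw [dfn_metric_smul_left hf hZ hY, dfn_metric_smul_left hf hZ hX, bracket_smul_left _ hf hZ,
    bracket_smul_right _ hf hZ]
  simp only [inner_add_left, real_inner_smul_left, inner_smul_right, dfn_map_smul]
  rw [real_inner_comm (Y x) (Z x), real_inner_comm (X x) (Z x)]
  ring

theorem koszul_add_middle (hX : SmoothField X x) (hZ : SmoothField Z x) {Y Y' : VField n M}
    (hY : SmoothField Y x) (hY' : SmoothField Y' x) :
    koszul X (fun y => Y y + Y' y) Z x = koszul X Y Z x + koszul X Y' Z x := by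
  simp only [koszul_eq, metric_comm X _]
  rw [dfn_metric_add_left hY hY' hZ, dfn_metric_add_left hY hY' hX, bracket_add_left _ hY hY',
    bracket_add_right _ hY hY']
  simp only [inner_add_left, inner_add_right, dfn_map_add]
  ring

/-- In the middle argument the terms with Z(f) cancel, while those with X(f) add up. The factor 2 is
the one in 2g(∇_X Y, Z), so this is the Leibniz rule of ∇. -/
theorem koszul_smul_middle (hX : SmoothField X x) (hZ : SmoothField Z x) (hf : SmoothFn n f x)
    (hY : SmoothField Y x) : koszul X (fun y => f y • Y y) Z x =
      f x * koszul X Y Z x + 2 * dfn n f x (X x) * inner ℝ (Y x) (Z x) := by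
  simp only [koszul_eq, metric_comm X _]
  rw [dfn_metric_smul_left hf hY hZ, dfn_metric_smul_left hf hY hX, bracket_smul_left _ hf hY,
    bracket_smul_right _ hf hY]
  simp only [inner_add_left, real_inner_smul_left, inner_smul_right, dfn_map_smul]
  ring

theorem koszul_sum_right (hX : SmoothField X x) (hY : SmoothField Y x) {κ : Type*} (s : Finset κ)
    {Z : κ → VField n M} (hZ : ∀ i, SmoothField (Z i) x) :
    koszul X Y (fun y => ∑ i ∈ s, Z i y) x = ∑ i ∈ s, koszul X Y (Z i) x := by
  classical
  induction s using Finset.induction_on with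
  | empty =>
    simpa using koszul_smul_right hX hY (SmoothFn.const 0) hX
  | insert a s ha ih =>
    simp only [Finset.sum_insert ha]
    rw [koszul_add_right hX hY (hZ a) (SmoothField.sum fun i _ => hZ i), ih]

theorem koszul_congr_left (hY : SmoothField Y x) (hZ : SmoothField Z x) {X X' : VField n M}
    (hX : SmoothField X x) (hX' : SmoothField X' x) (h : X x = X' x) :
    koszul X Y Z x = koszul X' Y Z x :=
  eq_of_tensorial (Φ := fun X => koszul X Y Z x) (fun _ _ hX hX' => koszul_add_left hY hZ hX hX')
    (fun _ _ hf hX => koszul_smul_left hY hZ hf hX) hX hX' h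

theorem koszul_congr_right (hX : SmoothField X x) (hY : SmoothField Y x) {Z Z' : VField n M}
    (hZ : SmoothField Z x) (hZ' : SmoothField Z' x) (h : Z x = Z' x) :
    koszul X Y Z x = koszul X Y Z' x :=
  eq_of_tensorial (Φ := fun Z => koszul X Y Z x) (fun _ _ hZ hZ' => koszul_add_right hX hY hZ hZ')
    (fun _ _ hf hZ => koszul_smul_right hX hY hf hZ) hZ hZ' h

/-- The Koszul formula. -/
theorem inner_leviCivita (hX : SmoothField X x) (hY : SmoothField Y x) (hZ : SmoothField Z x) :
    inner ℝ (leviCivita Y x (X x)) (Z x) = (1 / 2 : ℝ) * koszul X Y Z x := by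
  have hX' := SmoothField.extendVec x (X x)
  have he := fun k => SmoothField.extendVec x (frame (n := n) x k)
  -- The connection is defined through particular extensions of `v` and of the basis vectors.
  -- Tensoriality in the outer arguments permits replacing `X` and `Z` by combinations of these with
  -- constant coefficients.
  have h1 : koszul X Y Z x = koszul (extendVec (X x)) Y
      (fun y => ∑ k, (inner ℝ (Z x) (frame (n := n) x k) : ℝ) • extendVec (frame x k) y) x := by
    rw [koszul_congr_left hY hZ hX hX' (extendVec_self _).symm]
    refine koszul_congr_right hX' hY hZ (SmoothField.sum fun k _ => (he k).const_smul _) ?_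
    simpa [extendVec_self, frameBasis_apply] using
      (orthonormalBasis_sum_inner (frameBasis (n := n) x) (Z x)).symm
  rw [h1, koszul_sum_right hX' hY _ (fun k => (he k).const_smul _), leviCivita, sum_inner,
    Finset.mul_sum]
  refine Finset.sum_congr rfl fun k _ => ?_
  rw [koszul_smul_right hX' hY (SmoothFn.const _) (he k), real_inner_smul_left,
    real_inner_comm (Z x)]
  ring

theorem leviCivita_add (hX : SmoothField X x) (hY : SmoothField Y x) (v : TangentSpace (𝓡 n) x) :
    leviCivita (fun y => X y + Y y) x v = leviCivita X x v + leviCivita Y x v := by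
  have hv := SmoothField.extendVec x v
  refine eq_of_inner_field fun Z hZ => ?_
  rw [← extendVec_self v, inner_add_left, inner_leviCivita hv (hX.add hY) hZ,
    inner_leviCivita hv hX hZ, inner_leviCivita hv hY hZ, koszul_add_middle hv hZ hX hY]
  ring

theorem leviCivita_smul (hf : SmoothFn n f x) (hY : SmoothField Y x) (v : TangentSpace (𝓡 n) x) :
    leviCivita (fun y => f y • Y y) x v = dfn n f x v • Y x + f x • leviCivita Y x v := by
  have hv := SmoothField.extendVec x v
  refine eq_of_inner_field fun Z hZ => ?_
  have h := inner_leviCivita hv (hY.smul hf) hZ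
  have h' := inner_leviCivita hv hY hZ
  rw [extendVec_self] at h h'
  rw [inner_add_left, real_inner_smul_left, real_inner_smul_left, h, h',
    koszul_smul_middle hv hZ hf hY, extendVec_self]
  ring

theorem leviCivita_map_add (hY : SmoothField Y x) (v w : TangentSpace (𝓡 n) x) :
    leviCivita Y x (v + w) = leviCivita Y x v + leviCivita Y x w := by
  have hv := SmoothField.extendVec x v
  have hw := SmoothField.extendVec x w
  refine eq_of_inner_field fun Z hZ => ?_
  have h := inner_leviCivita (hv.add hw) hY hZ
  have h1 := inner_leviCivita hv hY hZ
  have h2 := inner_leviCivita hw hY hZ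
  simp only [extendVec_self] at h h1 h2
  rw [inner_add_left, h, h1, h2, koszul_add_left hY hZ hv hw]
  ring

theorem leviCivita_map_smul (hY : SmoothField Y x) (c : ℝ) (v : TangentSpace (𝓡 n) x) :
    leviCivita Y x (c • v) = c • leviCivita Y x v := by
  have hv := SmoothField.extendVec x v
  refine eq_of_inner_field fun Z hZ => ?_
  have h := inner_leviCivita (hv.const_smul c) hY hZ
  have h1 := inner_leviCivita hv hY hZ
  simp only [extendVec_self] at h h1
  rw [real_inner_smul_left, h, h1, koszul_smul_left hY hZ (SmoothFn.const c) hv]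
  ring

/-- The covariant derivative `v ↦ ∇_v Y` as a linear map. -/
def leviCivitaHom (hY : SmoothField Y x) : TangentSpace (𝓡 n) x →ₗ[ℝ] TangentSpace (𝓡 n) x where
  toFun := leviCivita Y x
  map_add' := leviCivita_map_add hY
  map_smul' := leviCivita_map_smul hY

theorem leviCivita_sum {κ : Type*} (s : Finset κ) {Y : κ → VField n M}
    (hY : ∀ i, SmoothField (Y i) x) (v : TangentSpace (𝓡 n) x) :
    leviCivita (fun y => ∑ i ∈ s, Y i y) x v = ∑ i ∈ s, leviCivita (Y i) x v := by
  classical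
  induction s using Finset.induction_on with
  | empty =>
    have := leviCivita_smul (SmoothFn.const 0) (SmoothField.extendVec x v) v
    simpa [dfn_const] using this
  | insert a s ha ih =>
    simp only [Finset.sum_insert ha]
    rw [leviCivita_add (hY a) (SmoothField.sum fun i _ => hY i), ih]

theorem leviCivita_sub (hX : SmoothField X x) (hY : SmoothField Y x) (v : TangentSpace (𝓡 n) x) :
    leviCivita (fun y => X y - Y y) x v = leviCivita X x v - leviCivita Y x v := by
  have h := leviCivita_add hX (hY.const_smul (-1)) v
  have h2 := leviCivita_smul (SmoothFn.const (-1)) hY v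
  rw [h2, dfn_const] at h
  simpa [← sub_eq_add_neg] using h

/-- `∇` is compatible with the metric. -/
theorem dfn_inner (hX : SmoothField X x) (hY : SmoothField Y x) (v : TangentSpace (𝓡 n) x) :
    dfn n (fun y => (inner ℝ (X y) (Y y) : ℝ)) x v =
      inner ℝ (leviCivita X x v) (Y x) + inner ℝ (X x) (leviCivita Y x v) := by
  have hv := SmoothField.extendVec x v
  have h1 := inner_leviCivita hv hX hY
  have h2 := inner_leviCivita hv hY hX
  rw [extendVec_self] at h1 h2
  -- In the sum of the Koszul expressions for (v, X, Y) and (v, Y, X) everything cancels by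
  -- antisymmetry of the bracket, except twice v⟨X, Y⟩.
  rw [h1, real_inner_comm, h2, koszul_eq, koszul_eq, bracket_swap Y X,
    bracket_swap Y (extendVec v), bracket_swap X (extendVec v), metric_comm Y X,
    metric_comm X (extendVec v), metric_comm Y (extendVec v)]
  simp only [inner_neg_left, extendVec_self]
  change dfn n (metric X Y) x v = _
  ring

/-- `∇` is torsion-free. -/
theorem leviCivita_sub_swap (hX : SmoothField X x) (hY : SmoothField Y x) :
    leviCivita Y x (X x) - leviCivita X x (Y x) = VectorField.mlieBracket (𝓡 n) X Y x := by
  refine eq_of_inner_field fun Z hZ => ?_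
  rw [inner_sub_left, inner_leviCivita hX hY hZ, inner_leviCivita hY hX hZ, koszul_eq, koszul_eq,
    bracket_swap Y X, bracket_swap X Z, bracket_swap Z Y, metric_comm Y X, metric_comm Z X,
    metric_comm Z Y]
  simp only [inner_neg_left]
  ring

theorem SmoothField.koszul (hX : SmoothField X x) (hY : SmoothField Y x) (hZ : SmoothField Z x) :
    SmoothFn n (koszul X Y Z) x :=
  (((((hX.deriv (hY.metric hZ)).add (hY.deriv (hZ.metric hX))).sub (hZ.deriv (hX.metric hY))).add
    ((hX.bracket hY).inner hZ)).sub ((hY.bracket hZ).inner hX)).add ((hZ.bracket hX).inner hY)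

/-- The bases `frame y` are chosen point by point and need not vary smoothly. In a smooth local
orthonormal frame the coefficients are Koszul expressions, which are smooth. -/
theorem SmoothField.leviCivita (hX : SmoothField X x) (hY : SmoothField Y x) :
    SmoothField (fun y => leviCivita Y y (X y)) x := by
  obtain ⟨E, hE, hb⟩ := exists_orthonormal_frame (n := n) x
  refine (SmoothField.sum (s := Finset.univ) fun i _ => (hE i).smul
    ((SmoothFn.const (1 / 2)).mul (hX.koszul hY (hE i)))).congr ?_
  filter_upwards [hb, hX.eventually, hY.eventually,
    Filter.eventually_all.2 fun i => (hE i).eventually] with y ⟨b, hb⟩ h1 h2 h3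
  rw [← orthonormalBasis_sum_inner b (DoubleForms.leviCivita Y y (X y))]
  refine Finset.sum_congr rfl fun i _ => ?_
  rw [hb, inner_leviCivita h1 h2 (h3 i)]

end LeviCivita

/-! ### Multilinear functions of vectors -/

section Multilinear

variable {V : Type*} [AddCommGroup V] [Module ℝ V] {ι : Type*} [DecidableEq ι]

/-- `F` is linear in each of its arguments. -/
structure IsMultilin (F : (ι → V) → ℝ) : Prop where
  add : ∀ (m : ι → V) (i : ι) (u v : V), F (Function.update m i (u + v)) =
    F (Function.update m i u) + F (Function.update m i v)
  smul : ∀ (m : ι → V) (i : ι) (c : ℝ) (v : V), F (Function.update m i (c • v)) =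
    c * F (Function.update m i v)

namespace IsMultilin

variable {F : (ι → V) → ℝ} (hF : IsMultilin F)
include hF

theorem neg (m : ι → V) (i : ι) (v : V) :
    F (Function.update m i (-v)) = -F (Function.update m i v) := by
  rw [← neg_one_smul ℝ v, hF.smul]; ring

theorem sub (m : ι → V) (i : ι) (u v : V) : F (Function.update m i (u - v)) =
    F (Function.update m i u) - F (Function.update m i v) := by
  rw [sub_eq_add_neg, hF.add, ← neg_one_smul ℝ v, hF.smul]; ring

theorem zero (m : ι → V) (i : ι) : F (Function.update m i 0) = 0 := by
  simpa using hF.smul m i 0 0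

theorem sum {κ : Type*} (s : Finset κ) (m : ι → V) (i : ι) (u : κ → V) :
    F (Function.update m i (∑ k ∈ s, u k)) = ∑ k ∈ s, F (Function.update m i (u k)) := by
  classical
  induction s using Finset.induction_on with
  | empty => simpa using hF.zero m i
  | insert a s ha ih => rw [Finset.sum_insert ha, Finset.sum_insert ha, hF.add, ih]

end IsMultilin

end Multilinear

/-! ### Covariant derivatives of tensor fields and the Ricci identity -/

section Tensor

variable {n : ℕ} {M : Type*} [TopologicalSpace M] [ChartedSpace (EuclideanSpace ℝ (Fin n)) M]
  [IsManifold (𝓡 n) ∞ M] {ι : Type*} [Fintype ι] [DecidableEq ι]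

/-- A field of functions of tangent vectors indexed by `ι`. -/
abbrev TField (n : ℕ) (M : Type*) [TopologicalSpace M]
    [ChartedSpace (EuclideanSpace ℝ (Fin n)) M] (ι : Type*) : Type _ :=
  ∀ x : M, (ι → TangentSpace (𝓡 n) x) → ℝ

/-- `T` is a smooth covariant tensor field with arguments indexed by `ι`. -/
structure IsTensor (T : TField n M ι) : Prop where
  multilin : ∀ x, IsMultilin (T x)
  smooth : ∀ (x : M) (W : ι → VField n M), (∀ i, SmoothField (W i) x) →
    SmoothFn n (fun y => T y (fun i => W i y)) x

theorem update_eval (W : ι → VField n M) (i : ι) (X : VField n M) (y : M) :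
    (fun j => Function.update W i X j y) = Function.update (fun j => W j y) i (X y) := by
  funext j
  by_cases h : j = i
  · subst h; simp
  · simp [h]

theorem smoothField_update {x : M} {W : ι → VField n M} (hW : ∀ i, SmoothField (W i) x) (i : ι)
    {X : VField n M} (hX : SmoothField X x) (j : ι) : SmoothField (Function.update W i X j) x := by
  by_cases h : j = i
  · subst h; simpa using hX
  · simpa [h] using hW j

theorem IsTensor.smooth_update {T : TField n M ι} (hT : IsTensor T) {x : M} {W : ι → VField n M}
    (hW : ∀ i, SmoothField (W i) x) (i : ι) {X : VField n M} (hX : SmoothField X x) :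
    SmoothFn n (fun y => T y (Function.update (fun j => W j y) i (X y))) x := by
  simpa only [update_eval] using hT.smooth x _ (smoothField_update hW i hX)

variable [RiemannianBundle (fun x : M => TangentSpace (𝓡 n) x)]

/-- The covariant derivative of `T` along `v`, computed with the extensions `W` of the arguments. -/
def covDField (T : TField n M ι) (x : M) (v : TangentSpace (𝓡 n) x) (W : ι → VField n M) : ℝ :=
  dfn n (fun y => T y (fun i => W i y)) x v
    - ∑ i, T x (Function.update (fun j => W j x) i (leviCivita (W i) x v))

/-- The covariant derivative of `T` along `v`. -/
def covD (T : TField n M ι) (x : M) (v : TangentSpace (𝓡 n) x) (W : ι → TangentSpace (𝓡 n) x) : ℝ :=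
  covDField T x v (fun i => extendVec (W i))

/-- `∇T` as a tensor field; the new argument has the index `none`. -/
def gradT (T : TField n M ι) : TField n M (Option ι) :=
  fun x W => covD T x (W none) (fun i => W (some i))

/-- The family `W` with the additional argument `v`. -/
def optCons {V : Type*} (v : V) (W : ι → V) : Option ι → V := fun o => o.elim v W

variable [IsContMDiffRiemannianBundle (𝓡 n) ∞ (EuclideanSpace ℝ (Fin n))
      (fun x : M => TangentSpace (𝓡 n) x)] {x : M} {T : TField n M ι}

/-- Separates what depends on the field in slot `i`: two terms contain a derivative of it, the
remaining ones only its value at `x`. Linearity over functions in that slot is then visible. -/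
theorem covDField_update (T : TField n M ι) (v : TangentSpace (𝓡 n) x) (W : ι → VField n M) (i : ι)
    (X : VField n M) : covDField T x v (Function.update W i X) =
      dfn n (fun y => T y (Function.update (fun j => W j y) i (X y))) x v
      - T x (Function.update (fun j => W j x) i (leviCivita X x v))
      - ∑ j ∈ Finset.univ.erase i, T x (Function.update
          (Function.update (fun j => W j x) j (leviCivita (W j) x v)) i (X x)) := by
  rw [covDField, ← Finset.add_sum_erase _ _ (Finset.mem_univ i)]
  simp only [update_eval, Function.update_self, Function.update_idem]
  rw [← sub_sub]
  congr 1
  refine Finset.sum_congr rfl fun j hj => ?_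
  have hj : j ≠ i := Finset.ne_of_mem_erase hj
  rw [Function.update_of_ne hj, Function.update_comm hj]

theorem covDField_update_add (hT : IsTensor T) (v : TangentSpace (𝓡 n) x) {W : ι → VField n M}
    (hW : ∀ i, SmoothField (W i) x) (i : ι) {X Y : VField n M} (hX : SmoothField X x)
    (hY : SmoothField Y x) : covDField T x v (Function.update W i (fun y => X y + Y y)) =
      covDField T x v (Function.update W i X) + covDField T x v (Function.update W i Y) := by
  simp only [covDField_update, (hT.multilin _).add, leviCivita_add hX hY]
  rw [dfn_add (hT.smooth_update hW i hX) (hT.smooth_update hW i hY), Finset.sum_add_distrib]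
  ring

/-- The term with df from differentiating the function cancels the term with df from ∇(fX). -/
theorem covDField_update_smul (hT : IsTensor T) (v : TangentSpace (𝓡 n) x) {W : ι → VField n M}
    (hW : ∀ i, SmoothField (W i) x) (i : ι) {f : M → ℝ} (hf : SmoothFn n f x) {X : VField n M}
    (hX : SmoothField X x) : covDField T x v (Function.update W i (fun y => f y • X y)) =
      f x * covDField T x v (Function.update W i X) := by
  simp only [covDField_update, (hT.multilin _).add, (hT.multilin _).smul, leviCivita_smul hf hX]
  rw [dfn_mul hf (hT.smooth_update hW i hX), ← Finset.mul_sum]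
  ring

theorem covDField_congr_slot (hT : IsTensor T) (v : TangentSpace (𝓡 n) x) {W : ι → VField n M}
    (hW : ∀ i, SmoothField (W i) x) (i : ι) {X Y : VField n M} (hX : SmoothField X x)
    (hY : SmoothField Y x) (h : X x = Y x) :
    covDField T x v (Function.update W i X) = covDField T x v (Function.update W i Y) :=
  eq_of_tensorial (Φ := fun X => covDField T x v (Function.update W i X))
    (fun _ _ hX hY => covDField_update_add hT v hW i hX hY)
    (fun _ _ hf hX => covDField_update_smul hT v hW i hf hX) hX hY h

/-- The covariant derivative of a tensor field does not depend on the extension of the arguments. -/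
theorem covDField_eq (hT : IsTensor T) (v : TangentSpace (𝓡 n) x) {W W' : ι → VField n M}
    (hW : ∀ i, SmoothField (W i) x) (hW' : ∀ i, SmoothField (W' i) x)
    (h : ∀ i, W i x = W' i x) : covDField T x v W = covDField T x v W' := by
  -- Tensoriality concerns one slot at a time, so the fields are exchanged one by one along a finite
  -- set of slots.
  have key : ∀ s : Finset ι, covDField T x v (s.piecewise W W') = covDField T x v W' := by
    intro s
    induction s using Finset.induction_on with
    | empty => simp
    | insert a s ha ih =>
      have hs : ∀ i, SmoothField (s.piecewise W W' i) x := fun i => by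
        by_cases hi : i ∈ s
        · simpa [hi] using hW i
        · simpa [hi] using hW' i
      rw [Finset.piecewise_insert, covDField_congr_slot hT v hs a (hW a) (hs a) (by simp [ha, h]),
        Function.update_eq_self, ih]
  simpa using key Finset.univ

theorem covD_eq (hT : IsTensor T) (v : TangentSpace (𝓡 n) x) {W : ι → VField n M}
    (hW : ∀ i, SmoothField (W i) x) : covD T x v (fun i => W i x) = covDField T x v W :=
  covDField_eq hT v (fun _ => SmoothField.extendVec _ _) hW fun _ => extendVec_self _

theorem covD_eq_of_eq (hT : IsTensor T) (v : TangentSpace (𝓡 n) x) {W : ι → VField n M}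
    (hW : ∀ i, SmoothField (W i) x) {w : ι → TangentSpace (𝓡 n) x} (h : ∀ i, W i x = w i) :
    covD T x v w = covDField T x v W := by
  rw [← covD_eq hT v hW, funext h]

theorem covD_map_add (hT : IsTensor T) (v w : TangentSpace (𝓡 n) x)
    (W : ι → TangentSpace (𝓡 n) x) : covD T x (v + w) W = covD T x v W + covD T x w W := by
  simp only [covD, covDField, dfn_map_add, leviCivita_map_add (SmoothField.extendVec _ _),
    (hT.multilin x).add, Finset.sum_add_distrib]
  ring

theorem covD_map_smul (hT : IsTensor T) (c : ℝ) (v : TangentSpace (𝓡 n) x)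
    (W : ι → TangentSpace (𝓡 n) x) : covD T x (c • v) W = c * covD T x v W := by
  simp only [covD, covDField, dfn_map_smul, leviCivita_map_smul (SmoothField.extendVec _ _),
    (hT.multilin x).smul, ← Finset.mul_sum]
  ring

theorem isMultilin_covD (hT : IsTensor T) (v : TangentSpace (𝓡 n) x) :
    IsMultilin (covD T x v) := by
  have he : ∀ m : ι → TangentSpace (𝓡 n) x, ∀ i, SmoothField (extendVec (m i)) x := fun m i =>
    SmoothField.extendVec _ _
  -- The chosen extension of a sum need not be the sum of the extensions everywhere, but only values
  -- at `x` matter, so any smooth field with the right value may be put in slot `i`.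
  have h : ∀ (m : ι → TangentSpace (𝓡 n) x) i (X : VField n M), SmoothField X x →
      covD T x v (Function.update m i (X x)) =
      covDField T x v (Function.update (fun i => extendVec (m i)) i X) := by
    intro m i X hX
    refine covD_eq_of_eq hT v (smoothField_update (he m) i hX) fun j => ?_
    by_cases hj : j = i
    · subst hj; simp
    · simp [hj, extendVec_self]
  have hx := fun u : TangentSpace (𝓡 n) x => SmoothField.extendVec x u
  refine ⟨fun m i u w => ?_, fun m i c u => ?_⟩
  · have h1 := h m i _ ((hx u).add (hx w))
    rw [covDField_update_add hT v (he m) i (hx u) (hx w), ← h m i _ (hx u),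
      ← h m i _ (hx w)] at h1
    simpa only [extendVec_self] using h1
  · have h1 := h m i _ ((hx u).const_smul c)
    rw [covDField_update_smul hT v (he m) i (SmoothFn.const c) (hx u), ← h m i _ (hx u)] at h1
    simpa only [extendVec_self] using h1

theorem IsTensor.smooth_covDField (hT : IsTensor T) {V : VField n M} (hV : SmoothField V x)
    {W : ι → VField n M} (hW : ∀ i, SmoothField (W i) x) :
    SmoothFn n (fun y => covDField T y (V y) W) x :=
  (hV.deriv (hT.smooth x W hW)).sub
    (SmoothFn.sum fun i _ => hT.smooth_update hW i (hV.leviCivita (hW i)))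

theorem update_none_comp_some {V : Type*} (m : Option ι → V) (v : V) :
    (fun i => Function.update m none v (some i)) = fun i => m (some i) := by
  funext i; simp

theorem update_some_comp_some {V : Type*} (m : Option ι → V) (i : ι) (v : V) :
    (fun j => Function.update m (some i) v (some j)) =
      Function.update (fun j => m (some j)) i v := by
  funext j
  by_cases h : j = i
  · subst h; simp
  · simp [h]

theorem IsTensor.gradT (hT : IsTensor T) : IsTensor (gradT T) where
  multilin x := by
    refine ⟨fun m i u v => ?_, fun m i c u => ?_⟩
    · cases i with
      | none => simp only [DoubleForms.gradT, update_none_comp_some, Function.update_self,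
          covD_map_add hT]
      | some i => simp only [DoubleForms.gradT, update_some_comp_some, (isMultilin_covD hT _).add,
          Function.update_of_ne (Option.some_ne_none i).symm]
    · cases i with
      | none => simp only [DoubleForms.gradT, update_none_comp_some, Function.update_self,
          covD_map_smul hT]
      | some i => simp only [DoubleForms.gradT, update_some_comp_some, (isMultilin_covD hT _).smul,
          Function.update_of_ne (Option.some_ne_none i).symm]
  smooth x W hW := by
    refine (hT.smooth_covDField (hW none) fun i => hW (some i)).congr ?_
    filter_upwards [Filter.eventually_all.2 fun i => (hW (some i)).eventually] with y hy
    exact covD_eq hT _ hy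

/-- The Ricci identity. -/
theorem ricci_identity (hT : IsTensor T) (u v : TangentSpace (𝓡 n) x)
    (w : ι → TangentSpace (𝓡 n) x) :
    covD (gradT T) x u (optCons v w) - covD (gradT T) x v (optCons u w) =
      ∑ i, T x (Function.update w i (curvature x u v (w i))) := by
  let W : ι → VField n M := fun i => extendVec (w i)
  have hW : ∀ i, SmoothField (W i) x := fun i => SmoothField.extendVec _ _
  have hWx : (fun i => W i x) = w := funext fun i => extendVec_self _
  let f : M → ℝ := fun y => T y (fun i => W i y)
  have hf : SmoothFn n f x := hT.smooth x W hW
  -- Complete expansion of the second derivative. Under antisymmetrisation in `u`, `v` the first sum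
  -- drops out at once, and the double sum by exchanging its indices. The second derivative of `f`
  -- gives [U,V]f, the term along ∇_u V gives the derivative along [U,V], and the iterated
  -- connections give the curvature.
  have key : ∀ u v : TangentSpace (𝓡 n) x, covD (gradT T) x u (optCons v w) =
      dfn n (fun y => dfn n f y (extendVec v y)) x u
      - ∑ i, (dfn n (fun y => T y (Function.update (fun j => W j y) i
          (leviCivita (W i) y (extendVec v y)))) x u +
        dfn n (fun y => T y (Function.update (fun j => W j y) i
          (leviCivita (W i) y (extendVec u y)))) x v)
      - covD T x (leviCivita (extendVec v) x u) w
      + ∑ i, T x (Function.update w i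
          (leviCivita (fun y => leviCivita (W i) y (extendVec u y)) x v))
      + ∑ i, ∑ j ∈ Finset.univ.erase i, T x (Function.update
          (Function.update w j (leviCivita (W j) x v)) i (leviCivita (W i) x u)) := by
    intro u v
    have hu := SmoothField.extendVec x u
    have hv := SmoothField.extendVec x v
    have h1 : covD (gradT T) x u (optCons v w) =
        dfn n (fun y => covDField T y (extendVec v y) W) x u
        - (covD T x (leviCivita (extendVec v) x u) w +
          ∑ i, covD T x v (Function.update w i (leviCivita (W i) x u))) := by
      rw [covD, covDField, Fintype.sum_option]
      congr 1
      · refine dfn_congr ?_ u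
        filter_upwards [Filter.eventually_all.2 fun i => (hW i).eventually] with y hy
        exact covD_eq hT _ hy
      · simp only [gradT, update_none_comp_some, update_some_comp_some, Function.update_self,
          Function.update_of_ne (Option.some_ne_none _).symm, optCons, Option.elim, extendVec_self]
        rfl
    have h2 : ∀ i, covD T x v (Function.update w i (leviCivita (W i) x u)) =
        covDField T x v (Function.update W i (fun y => leviCivita (W i) y (extendVec u y))) := by
      intro i
      refine covD_eq_of_eq hT v (smoothField_update hW i (hu.leviCivita (hW i))) fun j => ?_
      by_cases hj : j = i
      · subst hj; simp [extendVec_self]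
      · simp [hj, W, extendVec_self]
    have h3 : ∀ i, SmoothFn n (fun y => T y (Function.update (fun j => W j y) i
        (leviCivita (W i) y (extendVec v y)))) x := fun i =>
      hT.smooth_update hW i (hv.leviCivita (hW i))
    rw [h1]
    simp only [h2, covDField_update, hWx, extendVec_self]
    simp only [covDField]
    rw [dfn_sub (hv.deriv hf) (SmoothFn.sum fun i _ => h3 i), dfn_sum fun i _ => h3 i]
    simp only [Finset.sum_sub_distrib, Finset.sum_add_distrib]
    ring
  have hu := SmoothField.extendVec x u
  have hv := SmoothField.extendVec x v
  have hsym : (∑ i, ∑ j ∈ Finset.univ.erase i, T x (Function.update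
        (Function.update w j (leviCivita (W j) x v)) i (leviCivita (W i) x u))) =
      ∑ i, ∑ j ∈ Finset.univ.erase i, T x (Function.update
        (Function.update w j (leviCivita (W j) x u)) i (leviCivita (W i) x v)) := by
    rw [Finset.sum_comm' (t' := Finset.univ) (s' := fun j => Finset.univ.erase j)
      (by simp [eq_comm])]
    refine Finset.sum_congr rfl fun j _ => Finset.sum_congr rfl fun i hi => ?_
    rw [Function.update_comm (Finset.ne_of_mem_erase hi)]
  have hbr := dfn_bracket hu hv hf
  have htor := leviCivita_sub_swap hu hv
  simp only [extendVec_self] at hbr htor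
  -- Absence of torsion turns ∇_u V - ∇_v U into [U,V]. The [U,V]f obtained here cancels the
  -- commutator of derivations, and the rest supplies the ∇_{[U,V]} term of the curvature.
  have hcov : covD T x (leviCivita (extendVec v) x u) w - covD T x (leviCivita (extendVec u) x v) w
      = dfn n f x (VectorField.mlieBracket (𝓡 n) (extendVec u) (extendVec v) x)
        - ∑ i, T x (Function.update w i (leviCivita (W i) x
            (VectorField.mlieBracket (𝓡 n) (extendVec u) (extendVec v) x))) := by
    have h1 := covD_map_add hT (leviCivita (extendVec v) x u - leviCivita (extendVec u) x v)
      (leviCivita (extendVec u) x v) w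
    rw [sub_add_cancel, htor] at h1
    rw [h1, add_sub_cancel_right, covD, covDField]
    simp only [extendVec_self]
    rfl
  rw [key u v, key v u, hsym]
  simp only [curvature, (hT.multilin x).add, (hT.multilin x).sub, Finset.sum_add_distrib,
    Finset.sum_sub_distrib]
  simp only [W] at *
  linarith

end Tensor

/-! ### Full contractions and orthonormal bases -/

section Contraction

variable {V : Type*} [NormedAddCommGroup V] [InnerProductSpace ℝ V] {ι κ ν ν' : Type*}
  [DecidableEq ι] [Fintype ι] [DecidableEq κ] [Fintype κ] [Fintype ν] [Fintype ν']

/-- The multilinear map given by `F`. -/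
def IsMultilin.toMultilinearMap {V : Type*} [AddCommGroup V] [Module ℝ V] {F : (ι → V) → ℝ}
    (hF : IsMultilin F) : MultilinearMap ℝ (fun _ : ι => V) ℝ :=
  have hadd := hF.add
  have hsmul := hF.smul
  { toFun := F
    map_update_add' := by
      intro inst m i u v
      convert hadd m i u v
    map_update_smul' := by
      intro inst m i c u
      rw [smul_eq_mul]
      convert hsmul m i c u }

theorem IsMultilin.map_basis_sum {V : Type*} [AddCommGroup V] [Module ℝ V] {F : (ι → V) → ℝ}
    (hF : IsMultilin F) (c : ι → ν → ℝ) (b : ν → V) :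
    F (fun i => ∑ j, c i j • b j) = ∑ J : ι → ν, (∏ i, c i (J i)) * F (fun i => b (J i)) := by
  have h := hF.toMultilinearMap.map_sum (fun i j => c i j • b j)
  refine h.trans (Finset.sum_congr rfl fun J _ => ?_)
  exact hF.toMultilinearMap.map_smul_univ (fun i => c i (J i)) (fun i => b (J i))

/-- The full contraction of the paired arguments with respect to a basis. -/
def pairSum (F : (κ ⊕ κ → V) → ℝ) (b : ν → V) : ℝ :=
  ∑ I : κ → ν, F (Sum.elim (fun k => b (I k)) (fun k => b (I k)))

/-- After expanding one basis in the other, each index of the first basis occurs in exactly one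
pair. Orthogonality of the transition matrix makes its sum a Kronecker delta, which identifies the
two new indices of that pair. -/
theorem pairSum_eq {F : (κ ⊕ κ → V) → ℝ} (hF : IsMultilin F) (b : OrthonormalBasis ν ℝ V)
    (b' : OrthonormalBasis ν' ℝ V) : pairSum F b' = pairSum F b := by
  classical
  let c : ν' → ν → ℝ := fun i j => inner ℝ (b' i) (b j)
  have hc : ∀ i, b' i = ∑ j, c i j • b j := fun i => (orthonormalBasis_sum_inner b (b' i)).symm
  have hcc : ∀ j k, ∑ i, c i j * c i k = if j = k then 1 else 0 := by
    intro j k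
    have := b'.sum_inner_mul_inner (b j) (b k)
    rw [orthonormal_iff_ite.1 b.orthonormal j k] at this
    rw [← this]
    exact Finset.sum_congr rfl fun i _ => by rw [real_inner_comm (b' i) (b j)]
  have h1 : ∀ I : κ → ν', F (Sum.elim (fun k => b' (I k)) (fun k => b' (I k))) =
      ∑ J : κ → ν, ∑ K : κ → ν, (∏ k, c (I k) (J k) * c (I k) (K k)) *
        F (Sum.elim (fun k => b (J k)) (fun k => b (K k))) := by
    intro I
    have : (Sum.elim (fun k => b' (I k)) (fun k => b' (I k)) : κ ⊕ κ → V) =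
        fun s => ∑ j, c (Sum.elim I I s) j • b j := by
      funext s
      rcases s with k | k <;> simp [hc]
    rw [this, hF.map_basis_sum, ← (Equiv.sumArrowEquivProdArrow κ κ ν).symm.sum_comp,
      Fintype.sum_prod_type]
    refine Finset.sum_congr rfl fun J _ => Finset.sum_congr rfl fun K _ => ?_
    rw [Fintype.prod_sum_type, Finset.prod_mul_distrib]
    congr 2
    funext s
    rcases s with k | k <;> rfl
  simp only [pairSum, h1]
  rw [Finset.sum_comm]
  refine Finset.sum_congr rfl fun J _ => ?_
  rw [Finset.sum_comm]
  simp only [← Finset.sum_mul]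
  have h2 : ∀ K : κ → ν, (∑ I : κ → ν', ∏ k, c (I k) (J k) * c (I k) (K k)) =
      if J = K then 1 else 0 := by
    intro K
    have h := Finset.prod_univ_sum (fun _ : κ => (Finset.univ : Finset ν'))
      (fun k i => c i (J k) * c i (K k))
    rw [Fintype.piFinset_univ] at h
    rw [← h]
    simp only [hcc]
    by_cases hJK : J = K
    · simp [hJK]
    · obtain ⟨k, hk⟩ := Function.ne_iff.1 hJK
      rw [if_neg hJK]
      exact Finset.prod_eq_zero (Finset.mem_univ k) (if_neg hk)
  simp only [h2, ite_mul, one_mul, zero_mul, Finset.sum_ite_eq, Finset.mem_univ, if_true]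

/-- An infinitesimal rotation of an orthonormal basis does not change a full contraction. -/
theorem pairSum_skew {F : (κ ⊕ κ → V) → ℝ} (hF : IsMultilin F) (b : OrthonormalBasis ν ℝ V)
    (a : ν → V) (ha : ∀ i j, (inner ℝ (a i) (b j) : ℝ) = -inner ℝ (a j) (b i)) :
    ∑ I : κ → ν, ∑ s : κ ⊕ κ, F (Function.update
      (Sum.elim (fun k => b (I k)) (fun k => b (I k))) s (a (Sum.elim I I s))) = 0 := by
  classical
  rw [Finset.sum_comm, Fintype.sum_sum_type, ← Finset.sum_add_distrib]
  refine Finset.sum_eq_zero fun k _ => ?_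
  have hexp : ∀ (I : κ → ν) (s : κ ⊕ κ), F (Function.update
      (Sum.elim (fun k => b (I k)) (fun k => b (I k))) s (a (Sum.elim I I s))) =
      ∑ j, inner ℝ (a (Sum.elim I I s)) (b j) * F (Function.update
      (Sum.elim (fun k => b (I k)) (fun k => b (I k))) s (b j)) := by
    intro I s
    conv_lhs => rw [← orthonormalBasis_sum_inner b (a (Sum.elim I I s))]
    rw [hF.sum]
    simp only [hF.smul]
  simp only [hexp]
  simp only [Sum.elim_inl, Sum.elim_inr]
  rw [← Fintype.sum_prod_type', ← Fintype.sum_prod_type']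
  rw [add_comm, ← eq_neg_iff_add_eq_zero, ← Finset.sum_neg_distrib]
  -- The involution exchanges the summation index with the index of pair `k`. It matches each term
  -- in which the right copy is varied with the term in which the left copy is varied, and skewness
  -- of `a` gives opposite signs.
  let e : (κ → ν) × ν → (κ → ν) × ν := fun p => (Function.update p.1 k p.2, p.1 k)
  have he : Function.Involutive e := fun p => by simp [e]
  rw [← Equiv.sum_comp he.toPerm]
  refine Finset.sum_congr rfl fun p _ => ?_
  obtain ⟨I, j⟩ := p
  have h1 : (Function.update (Sum.elim (fun l => b (Function.update I k j l))
      (fun l => b (Function.update I k j l))) (Sum.inr k) (b (I k)) : κ ⊕ κ → V) =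
      Function.update (Sum.elim (fun l => b (I l)) (fun l => b (I l))) (Sum.inl k) (b j) := by
    funext s
    rcases s with l | l <;> by_cases hl : l = k
    all_goals simp [hl]
  simp only [Function.Involutive.coe_toPerm, e, Function.update_self]
  rw [h1, ha j (I k)]
  ring

end Contraction

/-! ### Contractions, products and relabellings of tensor fields -/

section Tensor

variable {n : ℕ} {M : Type*} [TopologicalSpace M] [ChartedSpace (EuclideanSpace ℝ (Fin n)) M]
  [IsManifold (𝓡 n) ∞ M] {ι κ : Type*} [Fintype ι] [DecidableEq ι] [Fintype κ] [DecidableEq κ]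
  [RiemannianBundle (fun x : M => TangentSpace (𝓡 n) x)]

/-- The metric contraction of paired arguments. -/
def contr (T : TField n M ((κ ⊕ κ) ⊕ ι)) : TField n M ι := fun x W =>
  pairSum (fun U : κ ⊕ κ → TangentSpace (𝓡 n) x => T x (Sum.elim U W)) (frame x)

theorem IsMultilin.elim_left {V : Type*} [AddCommGroup V] [Module ℝ V] {F : (κ ⊕ ι → V) → ℝ}
    (hF : IsMultilin F) (W : ι → V) : IsMultilin (fun U => F (Sum.elim U W)) where
  add m i u v := by
    simp only [← Sum.update_elim_inl]
    exact hF.add _ _ _ _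
  smul m i u v := by
    simp only [← Sum.update_elim_inl]
    exact hF.smul _ _ _ _

theorem IsMultilin.elim_right {V : Type*} [AddCommGroup V] [Module ℝ V] {F : (κ ⊕ ι → V) → ℝ}
    (hF : IsMultilin F) (U : κ → V) : IsMultilin (fun W => F (Sum.elim U W)) where
  add m i u v := by
    simp only [← Sum.update_elim_inr]
    exact hF.add _ _ _ _
  smul m i u v := by
    simp only [← Sum.update_elim_inr]
    exact hF.smul _ _ _ _

theorem contr_eq {T : TField n M ((κ ⊕ κ) ⊕ ι)} {x : M} (hT : IsMultilin (T x))
    {ν : Type*} [Fintype ν] (b : OrthonormalBasis ν ℝ (TangentSpace (𝓡 n) x))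
    (W : ι → TangentSpace (𝓡 n) x) :
    contr T x W = ∑ I : κ → ν, T x (Sum.elim (Sum.elim (fun k => b (I k)) (fun k => b (I k))) W) :=
  pairSum_eq (hT.elim_left W) b (frameBasis x)

variable [IsContMDiffRiemannianBundle (𝓡 n) ∞ (EuclideanSpace ℝ (Fin n))
      (fun x : M => TangentSpace (𝓡 n) x)] {x : M}

theorem elim_eval (U : κ → VField n M) (W : ι → VField n M) (y : M) :
    (fun s => Sum.elim U W s y) = Sum.elim (fun k => U k y) (fun i => W i y) := by
  funext s; rcases s with s | s <;> rfl

theorem IsTensor.contr {T : TField n M ((κ ⊕ κ) ⊕ ι)} (hT : IsTensor T) : IsTensor (contr T) where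
  multilin x := by
    have h : ∀ I : κ → _, IsMultilin fun W => T x (Sum.elim
      (Sum.elim (fun k => frame x (I k)) (fun k => frame x (I k)) : κ ⊕ κ → _) W) := fun I =>
      (hT.multilin x).elim_right _
    refine ⟨fun m i u v => ?_, fun m i c u => ?_⟩
    · simp only [DoubleForms.contr, pairSum, (h _).add, Finset.sum_add_distrib]
    · simp only [DoubleForms.contr, pairSum, (h _).smul, Finset.mul_sum]
  smooth x W hW := by
    -- As the contraction does not depend on the orthonormal basis, a smooth local frame may replace
    -- the pointwise choice.
    obtain ⟨E, hE, hb⟩ := exists_orthonormal_frame (n := n) x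
    refine (SmoothFn.sum (s := Finset.univ) fun (I : κ → Fin n) _ =>
      hT.smooth x (Sum.elim (Sum.elim (fun k => E (I k)) (fun k => E (I k))) W) ?_).congr ?_
    · rintro ((k | k) | i)
      exacts [hE _, hE _, hW _]
    · filter_upwards [hb] with y ⟨b, hb⟩
      rw [contr_eq (hT.multilin y) b]
      simp only [elim_eval, hb]

/-- The covariant derivative commutes with metric contractions. -/
theorem covD_contr {T : TField n M ((κ ⊕ κ) ⊕ ι)} (hT : IsTensor T) {ν : Type*} [Fintype ν]
    (b : OrthonormalBasis ν ℝ (TangentSpace (𝓡 n) x)) (v : TangentSpace (𝓡 n) x)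
    (w : ι → TangentSpace (𝓡 n) x) :
    covD (contr T) x v w = ∑ I : κ → ν,
      covD T x v (Sum.elim (Sum.elim (fun k => b (I k)) (fun k => b (I k))) w) := by
  obtain ⟨E, hE, hb⟩ := exists_orthonormal_frame (n := n) x
  obtain ⟨b₀, hb₀⟩ := hb.self_of_nhds
  let W : ι → VField n M := fun i => extendVec (w i)
  have hW : ∀ i, SmoothField (W i) x := fun i => SmoothField.extendVec _ _
  have hWx : (fun i => W i x) = w := funext fun i => extendVec_self _
  let S : (κ → Fin n) → (κ ⊕ κ) ⊕ ι → VField n M := fun I =>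
    Sum.elim (Sum.elim (fun k => E (I k)) (fun k => E (I k))) W
  have hS : ∀ I s, SmoothField (S I s) x := by
    rintro I ((k | k) | i)
    exacts [hE _, hE _, hW _]
  have hSx : ∀ I, (fun s => S I s x) =
      Sum.elim (Sum.elim (fun k => b₀ (I k)) (fun k => b₀ (I k))) w := by
    intro I
    simp only [S, elim_eval, hWx, hb₀]
  -- The right-hand side is itself a contraction of the multilinear `covD T x v`, so `b` may be
  -- replaced by the value at `x` of a smooth frame.
  have h0 := pairSum_eq ((isMultilin_covD hT v).elim_left w) b₀ b
  rw [pairSum, pairSum] at h0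
  rw [h0]
  have h1 : ∀ I, covD T x v (Sum.elim (Sum.elim (fun k => b₀ (I k)) (fun k => b₀ (I k))) w) =
      covDField T x v (S I) := fun I => by rw [← hSx, covD_eq hT v (hS I)]
  -- ⟨E_i, E_j⟩ is constant near `x`, so the matrix of inner products ⟨∇_v E_i, E_j⟩ is skew; the
  -- derivatives of the frame vectors therefore cancel in the contraction.
  have hskew := pairSum_skew ((hT.multilin x).elim_left w) (κ := κ) b₀
    (fun i => leviCivita (E i) x v) (fun i j => by
      have h2 := dfn_inner (hE i) (hE j) v
      have h3 : ∀ᶠ y in 𝓝 x, (inner ℝ (E i y) (E j y) : ℝ) = if i = j then 1 else 0 := by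
        filter_upwards [hb] with y ⟨b, hb⟩
        rw [← hb, ← hb, orthonormal_iff_ite.1 b.orthonormal i j]
      rw [dfn_congr h3, dfn_const, ← hb₀, ← hb₀, real_inner_comm _ (b₀ i)] at h2
      linarith)
  simp only [h1]
  rw [covD, covDField]
  simp only [covDField, Finset.sum_sub_distrib]
  congr 1
  · rw [← dfn_sum fun I _ => hT.smooth x _ (hS I)]
    refine dfn_congr ?_ v
    filter_upwards [hb] with y ⟨b, hb⟩
    rw [contr_eq (hT.multilin y) b]
    simp only [S, elim_eval, hb, W]
  · have h2 : ∀ I, ∑ s, T x (Function.update (fun j => S I j x) s (leviCivita (S I s) x v)) =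
        (∑ s : κ ⊕ κ, T x (Sum.elim (Function.update
          (Sum.elim (fun k => b₀ (I k)) (fun k => b₀ (I k))) s
          (leviCivita (E (Sum.elim I I s)) x v)) w)) +
        ∑ i, T x (Sum.elim (Sum.elim (fun k => b₀ (I k)) (fun k => b₀ (I k)))
          (Function.update w i (leviCivita (W i) x v))) := by
      intro I
      rw [Fintype.sum_sum_type, hSx]
      congr 1
      · refine Finset.sum_congr rfl fun s _ => ?_
        rw [Sum.update_elim_inl]
        rcases s with k | k <;> rfl
      · refine Finset.sum_congr rfl fun i _ => ?_
        rw [Sum.update_elim_inr]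
        rfl
    simp only [h2, Finset.sum_add_distrib]
    rw [hskew, zero_add, Finset.sum_comm]
    refine Finset.sum_congr rfl fun i _ => ?_
    rw [contr_eq (hT.multilin x) b₀]
    simp only [extendVec_self]
    rfl

/-- The tensor product. -/
def tprod (α : TField n M κ) (β : TField n M ι) : TField n M (κ ⊕ ι) :=
  fun x W => α x (fun k => W (Sum.inl k)) * β x (fun i => W (Sum.inr i))

theorem update_inl_inl {V : Type*} (m : κ ⊕ ι → V) (k : κ) (v : V) :
    (fun j => Function.update m (Sum.inl k) v (Sum.inl j)) =
      Function.update (fun j => m (Sum.inl j)) k v := by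
  funext j; simp [Function.update_apply]

theorem update_inl_inr {V : Type*} (m : κ ⊕ ι → V) (k : κ) (v : V) :
    (fun j => Function.update m (Sum.inl k) v (Sum.inr j)) = fun j => m (Sum.inr j) := by
  funext j; simp

theorem update_inr_inr {V : Type*} (m : κ ⊕ ι → V) (k : ι) (v : V) :
    (fun j => Function.update m (Sum.inr k) v (Sum.inr j)) =
      Function.update (fun j => m (Sum.inr j)) k v := by
  funext j; simp [Function.update_apply]

theorem update_inr_inl {V : Type*} (m : κ ⊕ ι → V) (k : ι) (v : V) :
    (fun j => Function.update m (Sum.inr k) v (Sum.inl j)) = fun j => m (Sum.inl j) := by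
  funext j; simp

theorem IsTensor.tprod {α : TField n M κ} {β : TField n M ι} (hα : IsTensor α) (hβ : IsTensor β) :
    IsTensor (tprod α β) where
  multilin x := by
    refine ⟨?_, ?_⟩
    · rintro m (i | i) u v
      · simp only [DoubleForms.tprod, update_inl_inl, update_inl_inr, (hα.multilin x).add, add_mul]
      · simp only [DoubleForms.tprod, update_inr_inl, update_inr_inr, (hβ.multilin x).add, mul_add]
    · rintro m (i | i) c u
      · simp only [DoubleForms.tprod, update_inl_inl, update_inl_inr, (hα.multilin x).smul, mul_assoc]
      · simp only [DoubleForms.tprod, update_inr_inl, update_inr_inr, (hβ.multilin x).smul]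
        ring
  smooth x W hW := (hα.smooth x _ fun k => hW (Sum.inl k)).mul (hβ.smooth x _ fun k => hW (Sum.inr k))

/-- The Leibniz rule. -/
theorem covD_tprod {α : TField n M κ} {β : TField n M ι} (hα : IsTensor α) (hβ : IsTensor β)
    (v : TangentSpace (𝓡 n) x) (W : κ ⊕ ι → TangentSpace (𝓡 n) x) :
    covD (tprod α β) x v W =
      covD α x v (fun k => W (Sum.inl k)) * β x (fun i => W (Sum.inr i)) +
      α x (fun k => W (Sum.inl k)) * covD β x v (fun i => W (Sum.inr i)) := by
  have he : ∀ s, SmoothField (extendVec (W s)) x := fun s => SmoothField.extendVec _ _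
  simp only [covD, covDField, tprod, Fintype.sum_sum_type, update_inl_inl, update_inl_inr,
    update_inr_inl, update_inr_inr]
  rw [dfn_mul (hα.smooth x _ fun k => he (Sum.inl k)) (hβ.smooth x _ fun k => he (Sum.inr k)),
    ← Finset.sum_mul, ← Finset.mul_sum]
  simp only [extendVec_self]
  ring

/-- Relabelling of the arguments. -/
def reindex (σ : ι ≃ κ) (T : TField n M ι) : TField n M κ := fun x W => T x (fun i => W (σ i))

theorem update_comp_equiv {V : Type*} (σ : ι ≃ κ) (m : κ → V) (k : κ) (v : V) :
    (fun i => Function.update m k v (σ i)) = Function.update (fun i => m (σ i)) (σ.symm k) v :=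
  Function.update_comp_equiv m σ k v

theorem IsTensor.reindex {T : TField n M ι} (hT : IsTensor T) (σ : ι ≃ κ) :
    IsTensor (reindex σ T) where
  multilin x := by
    refine ⟨fun m i u v => ?_, fun m i c u => ?_⟩
    · simp only [DoubleForms.reindex, update_comp_equiv, (hT.multilin x).add]
    · simp only [DoubleForms.reindex, update_comp_equiv, (hT.multilin x).smul]
  smooth x W hW := hT.smooth x _ fun i => hW (σ i)

theorem covD_reindex (T : TField n M ι) (σ : ι ≃ κ) (v : TangentSpace (𝓡 n) x)
    (W : κ → TangentSpace (𝓡 n) x) :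
    covD (reindex σ T) x v W = covD T x v (fun i => W (σ i)) := by
  simp only [covD, covDField, reindex, update_comp_equiv]
  rw [← σ.sum_comp]
  simp

theorem IsTensor.const_mul (c : ℝ) {T : TField n M ι} (hT : IsTensor T) :
    IsTensor (fun x W => c * T x W) where
  multilin x := by
    refine ⟨fun m i u v => ?_, fun m i c u => ?_⟩
    · simp only [(hT.multilin x).add]; ring
    · simp only [(hT.multilin x).smul]; ring
  smooth x W hW := (SmoothFn.const c).mul (hT.smooth x W hW)

theorem IsTensor.sum {ν : Type*} (s : Finset ν) {T : ν → TField n M ι} (hT : ∀ a, IsTensor (T a)) :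
    IsTensor (fun x W => ∑ a ∈ s, T a x W) where
  multilin x := by
    refine ⟨fun m i u v => ?_, fun m i c u => ?_⟩
    · simp only [((hT _).multilin x).add, Finset.sum_add_distrib]
    · simp only [((hT _).multilin x).smul, Finset.mul_sum]
  smooth x W hW := SmoothFn.sum fun a _ => (hT a).smooth x W hW

theorem covD_const_mul (c : ℝ) {T : TField n M ι} (hT : IsTensor T) (v : TangentSpace (𝓡 n) x)
    (W : ι → TangentSpace (𝓡 n) x) :
    covD (fun x W => c * T x W) x v W = c * covD T x v W := by
  simp only [covD, covDField]
  rw [dfn_const_mul c (hT.smooth x _ fun i => SmoothField.extendVec _ _), ← Finset.mul_sum]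
  ring

theorem covD_sum {ν : Type*} (s : Finset ν) {T : ν → TField n M ι} (hT : ∀ a, IsTensor (T a))
    (v : TangentSpace (𝓡 n) x) (W : ι → TangentSpace (𝓡 n) x) :
    covD (fun x W => ∑ a ∈ s, T a x W) x v W = ∑ a ∈ s, covD (T a) x v W := by
  simp only [covD, covDField]
  rw [dfn_sum fun a _ => (hT a).smooth x _ fun i => SmoothField.extendVec _ _, Finset.sum_comm,
    Finset.sum_sub_distrib]

end Tensor

/-! ### Symmetries of the curvature tensor -/

section Curvature

variable {n : ℕ} {M : Type*} [TopologicalSpace M] [ChartedSpace (EuclideanSpace ℝ (Fin n)) M]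
  [IsManifold (𝓡 n) ∞ M] [RiemannianBundle (fun x : M => TangentSpace (𝓡 n) x)]
  [IsContMDiffRiemannianBundle (𝓡 n) ∞ (EuclideanSpace ℝ (Fin n))
      (fun x : M => TangentSpace (𝓡 n) x)] {x : M}

/-- The metric as a tensor field. -/
def metricT : TField n M (Fin 2) := fun _ W => inner ℝ (W 0) (W 1)

theorem isTensor_metricT : IsTensor (metricT (n := n) (M := M)) where
  multilin x := by
    refine ⟨fun m i u v => ?_, fun m i c u => ?_⟩ <;> fin_cases i <;>
      simp [metricT, inner_add_left, inner_add_right, real_inner_smul_left, inner_smul_right]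
  smooth x W hW := (hW 0).inner (hW 1)

theorem gradT_metricT : gradT (metricT (n := n) (M := M)) = fun _ _ => 0 := by
  funext x W
  have h := dfn_inner (SmoothField.extendVec x (W (some 0))) (SmoothField.extendVec x (W (some 1)))
    (W none)
  simp only [extendVec_self] at h
  simp [gradT, covD, covDField, metricT, Fin.sum_univ_two, extendVec_self, h]

/-- The metric is parallel, so the left side of the Ricci identity vanishes for it; the right side
is the curvature acting as a derivation on g(w, z). -/
theorem curvature4_swap_right (u v w z : TangentSpace (𝓡 n) x) :
    curvature4 x u v w z = -curvature4 x u v z w := by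
  have h := ricci_identity (isTensor_metricT (n := n) (M := M)) u v ![w, z]
  have h0 : ∀ (u : TangentSpace (𝓡 n) x) (W : Option (Fin 2) → TangentSpace (𝓡 n) x),
      covD (n := n) (M := M) (fun _ _ => 0) x u W = 0 := by
    intro u W
    simp [covD, covDField, dfn_const]
  rw [gradT_metricT, h0, h0] at h
  simp only [metricT, Fin.sum_univ_two] at h
  simp only [curvature4, real_inner_comm w]
  simp at h
  linarith

theorem curvature_swap (u v w : TangentSpace (𝓡 n) x) :
    curvature x u v w = -curvature x v u w := by
  have h := leviCivita_map_smul (SmoothField.extendVec x w) (-1)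
    (VectorField.mlieBracket (𝓡 n) (extendVec v) (extendVec u) x)
  simp only [curvature, bracket_swap (extendVec u) (extendVec v)]
  rw [neg_one_smul, neg_one_smul] at h
  rw [h]
  abel

/-- Absence of torsion gives ∇_C(∇_A B - ∇_B A) = ∇_{[A,B]} C + [C,[A,B]]. Over the cyclic
permutations the ∇ along brackets cancel against those in the curvature, and the double brackets
vanish by Jacobi. -/
theorem curvature_bianchi (u v w : TangentSpace (𝓡 n) x) :
    curvature x u v w + curvature x v w u + curvature x w u v = 0 := by
  have hu := SmoothField.extendVec x u
  have hv := SmoothField.extendVec x v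
  have hw := SmoothField.extendVec x w
  have key : ∀ {A B C : VField n M}, SmoothField A x → SmoothField B x → SmoothField C x →
      leviCivita (fun y => leviCivita B y (A y)) x (C x) -
        leviCivita (fun y => leviCivita A y (B y)) x (C x) =
      leviCivita C x (VectorField.mlieBracket (𝓡 n) A B x) +
        VectorField.mlieBracket (𝓡 n) C (VectorField.mlieBracket (𝓡 n) A B) x := by
    intro A B C hA hB hC
    rw [← leviCivita_sub (hA.leviCivita hB) (hB.leviCivita hA),
      leviCivita_congr (Y := VectorField.mlieBracket (𝓡 n) A B),
      ← leviCivita_sub_swap hC (hA.bracket hB)]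
    · abel
    · filter_upwards [hA.eventually, hB.eventually] with y h1 h2
      exact leviCivita_sub_swap h1 h2
  have h1 := key hu hw hv
  have h2 := key hw hv hu
  have h3 := key hv hu hw
  simp only [extendVec_self] at h1 h2 h3
  have hj := jacobi hv hu hw
  have hs : ∀ {Y : VField n M} (_ : SmoothField Y x) (a : TangentSpace (𝓡 n) x),
      leviCivita Y x (-a) = -leviCivita Y x a := fun hY a => by
    simpa using leviCivita_map_smul hY (-1) a
  have hneg : ∀ {A B C : VField n M}, SmoothField A x → SmoothField B x → SmoothField C x →
      VectorField.mlieBracket (𝓡 n) A (VectorField.mlieBracket (𝓡 n) B C) x =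
      - VectorField.mlieBracket (𝓡 n) A (VectorField.mlieBracket (𝓡 n) C B) x := by
    intro A B C hA hB hC
    have := bracket_smul_right A (SmoothFn.const (-1)) (hC.bracket hB)
    rw [dfn_const, zero_smul, zero_add, neg_one_smul] at this
    rw [← this]
    exact bracket_congr (by simp) (Filter.Eventually.of_forall fun y => by
      rw [bracket_swap B C, neg_one_smul])
  simp only [curvature]
  rw [bracket_swap (extendVec w) (extendVec u), hs hv]
  rw [bracket_swap (extendVec v) (extendVec w), hs hu]
  rw [bracket_swap (extendVec u) (extendVec v), hs hw]
  rw [hneg hu hw hv] at h2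
  rw [bracket_swap (VectorField.mlieBracket (𝓡 n) (extendVec v) (extendVec u)) (extendVec w)] at hj
  linear_combination (norm := module) h1 + h2 + h3 + hj

/-- Linearity of the extension holds only over the domain of the trivialisation at `x`. An equality
near `x` suffices, since brackets and covariant derivatives depend on germs. -/
theorem extendVec_add (u v : TangentSpace (𝓡 n) x) :
    ∀ᶠ y in 𝓝 x, extendVec (u + v) y = extendVec u y + extendVec v y := by
  filter_upwards [(trivializationAt (EuclideanSpace ℝ (Fin n)) (TangentSpace (𝓡 n)) x).open_baseSet.mem_nhds
    (FiberBundle.mem_baseSet_trivializationAt' x)] with y hy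
  simp only [extendVec, FiberBundle.extend, ← Bundle.Trivialization.coe_symmₗ (R := ℝ) _ hy]
  rw [((trivializationAt (EuclideanSpace ℝ (Fin n)) (TangentSpace (𝓡 n)) x).linear ℝ
    (FiberBundle.mem_baseSet_trivializationAt' x)).map_add, map_add]

theorem extendVec_smul (c : ℝ) (u : TangentSpace (𝓡 n) x) :
    ∀ᶠ y in 𝓝 x, extendVec (c • u) y = c • extendVec u y := by
  filter_upwards [(trivializationAt (EuclideanSpace ℝ (Fin n)) (TangentSpace (𝓡 n)) x).open_baseSet.mem_nhds
    (FiberBundle.mem_baseSet_trivializationAt' x)] with y hy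
  simp only [extendVec, FiberBundle.extend, ← Bundle.Trivialization.coe_symmₗ (R := ℝ) _ hy]
  rw [((trivializationAt (EuclideanSpace ℝ (Fin n)) (TangentSpace (𝓡 n)) x).linear ℝ
    (FiberBundle.mem_baseSet_trivializationAt' x)).map_smul, map_smul]

theorem leviCivita_const_smul {Y : VField n M} (c : ℝ) (hY : SmoothField Y x)
    (v : TangentSpace (𝓡 n) x) :
    leviCivita (fun y => c • Y y) x v = c • leviCivita Y x v := by
  simpa [dfn_const] using leviCivita_smul (SmoothFn.const c) hY v

theorem curvature_add_left (u u' v w : TangentSpace (𝓡 n) x) :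
    curvature x (u + u') v w = curvature x u v w + curvature x u' v w := by
  have hu := SmoothField.extendVec x u
  have hu' := SmoothField.extendVec x u'
  have hv := SmoothField.extendVec x v
  have hw := SmoothField.extendVec x w
  have h := extendVec_add u u'
  simp only [curvature]
  rw [leviCivita_congr (Y := fun y => leviCivita (extendVec w) y (extendVec u y) +
      leviCivita (extendVec w) y (extendVec u' y)) (by
        filter_upwards [h, hw.eventually] with y hy hw using by rw [hy, leviCivita_map_add hw]),
    leviCivita_add (hu.leviCivita hw) (hu'.leviCivita hw),
    leviCivita_map_add (hv.leviCivita hw), bracket_congr h (Filter.Eventually.of_forall fun _ => rfl),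
    bracket_add_left _ hu hu', leviCivita_map_add hw]
  abel

theorem curvature_smul_left (c : ℝ) (u v w : TangentSpace (𝓡 n) x) :
    curvature x (c • u) v w = c • curvature x u v w := by
  have hu := SmoothField.extendVec x u
  have hv := SmoothField.extendVec x v
  have hw := SmoothField.extendVec x w
  have h := extendVec_smul c u
  simp only [curvature]
  rw [leviCivita_congr (Y := fun y => c • leviCivita (extendVec w) y (extendVec u y)) (by
        filter_upwards [h, hw.eventually] with y hy hw using by rw [hy, leviCivita_map_smul hw]),
    leviCivita_const_smul c (hu.leviCivita hw), leviCivita_map_smul (hv.leviCivita hw),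
    bracket_congr h (Filter.Eventually.of_forall fun _ => rfl),
    bracket_smul_left _ (SmoothFn.const c) hu, dfn_const, neg_zero, zero_smul, zero_add,
    leviCivita_map_smul hw, smul_add, smul_sub]

theorem curvature4_swap_left (u v w z : TangentSpace (𝓡 n) x) :
    curvature4 x u v w z = -curvature4 x v u w z := by
  rw [curvature4, curvature_swap, inner_neg_left, curvature4]

theorem curvature4_bianchi (u v w z : TangentSpace (𝓡 n) x) :
    curvature4 x u v w z + curvature4 x v w u z + curvature4 x w u v z = 0 := by
  simp only [curvature4, ← inner_add_left, curvature_bianchi, inner_zero_left]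

/-- A combination of the four Bianchi identities obtained by rotating the arguments, in which the
antisymmetries within the pairs leave only the two exchanged terms. -/
theorem curvature4_pair_symm (u v w z : TangentSpace (𝓡 n) x) :
    curvature4 x u v w z = curvature4 x w z u v := by
  have b1 := curvature4_bianchi u v w z
  have b2 := curvature4_bianchi v w z u
  have b3 := curvature4_bianchi w z u v
  have b4 := curvature4_bianchi z u v w
  have l := @curvature4_swap_left n M _ _ _ _ _ x
  have r := @curvature4_swap_right n M _ _ _ _ _ x
  linarith [l u v w z, l v w z u, l w z u v, l z u v w, r u v w z, r v w u z, r w u v z, r v w z u,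
    r w z v u, r z v w u, r w z u v, r z u w v, r u w z v, r z u v w, r u v z w, r v z u w,
    l w u v z, l z v w u, l u w z v, l v z u w]

end Curvature

/-! ### Spectral decomposition of the curvature operator -/

section Eigenbasis

theorem eq_of_eq_fin_two {V : Type*} {m : Fin 2 → V} {i j : Fin 2} (h : m i = m j) (hij : i ≠ j) :
    m 0 = m 1 := by
  fin_cases i <;> fin_cases j <;> simp_all

theorem alternatingMap_sum_apply {V ι ν : Type*} [AddCommGroup V] [Module ℝ V] (s : Finset ν)
    (f : ν → V [⋀^ι]→ₗ[ℝ] ℝ) (m : ι → V) : (∑ a ∈ s, f a) m = ∑ a ∈ s, f a m := by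
  classical
  induction s using Finset.induction_on with
  | empty => simp
  | insert a s ha ih => rw [Finset.sum_insert ha, Finset.sum_insert ha, AlternatingMap.add_apply, ih]

/-- An algebraic curvature tensor has an orthonormal eigenbasis of 2-forms. -/
theorem exists_orthonormal_eigenbasis {V : Type*} [NormedAddCommGroup V] [InnerProductSpace ℝ V]
    [FiniteDimensional ℝ V] (R : V → V → V → V → ℝ)
    (hadd : ∀ u u' v w z, R (u + u') v w z = R u v w z + R u' v w z)
    (hsmul : ∀ (c : ℝ) u v w z, R (c • u) v w z = c * R u v w z)
    (hswap : ∀ u v w z, R u v w z = -R v u w z)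
    (hpair : ∀ u v w z, R u v w z = R w z u v) :
    ∃ (b : Module.Basis (Fin (Module.finrank ℝ (V [⋀^Fin 2]→ₗ[ℝ] ℝ))) ℝ (V [⋀^Fin 2]→ₗ[ℝ] ℝ))
      (l : Fin (Module.finrank ℝ (V [⋀^Fin 2]→ₗ[ℝ] ℝ)) → ℝ),
      (∀ α β, twoFormInner (b α) (b β) = if α = β then 1 else 0) ∧
      ∀ α (u v : V), (1 / 2 : ℝ) * ∑ i, ∑ j, b α ![onb V i, onb V j] * R u v (onb V i) (onb V j) =
        l α * b α ![u, v] := by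
  have hadd2 : ∀ u v v' w z, R u (v + v') w z = R u v w z + R u v' w z := fun u v v' w z => by
    rw [hswap, hadd, hswap v, hswap v']; ring
  have hsmul2 : ∀ (c : ℝ) u v w z, R u (c • v) w z = c * R u v w z := fun c u v w z => by
    rw [hswap, hsmul, hswap v]; ring
  let B := stdOrthonormalBasis ℝ V
  have hdef : ∀ E : V [⋀^Fin 2]→ₗ[ℝ] ℝ, (∀ i j, E ![onb V i, onb V j] = 0) → E = 0 := by
    intro E hE
    refine Module.Basis.ext_alternating B.toBasis fun v _ => ?_
    have : (fun i => B.toBasis (v i)) = ![onb V (v 0), onb V (v 1)] := by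
      funext i; fin_cases i <;> simp [B, onb]
    rw [this, hE]; rfl
  have : FiniteDimensional ℝ (V [⋀^Fin 2]→ₗ[ℝ] ℝ) := by
    let L : (V [⋀^Fin 2]→ₗ[ℝ] ℝ) →ₗ[ℝ] (Fin (Module.finrank ℝ V) → Fin (Module.finrank ℝ V) → ℝ) :=
      { toFun := fun E i j => E ![onb V i, onb V j]
        map_add' := fun _ _ => rfl
        map_smul' := fun _ _ => rfl }
    refine Module.Finite.of_injective L ((injective_iff_map_eq_zero L).2 fun E hE => hdef E ?_)
    exact fun i j => congrFun (congrFun hE i) j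
  -- The space of 2-forms receives `twoFormInner` as its inner product, so that the spectral theorem
  -- for symmetric operators applies. It is definite because a 2-form is determined by its values on
  -- the basis vectors.
  let core : InnerProductSpace.Core ℝ (V [⋀^Fin 2]→ₗ[ℝ] ℝ) :=
    { inner := twoFormInner
      conj_inner_symm := fun E F => by
        simp only [twoFormInner, conj_trivial]
        simp only [mul_comm]
      re_inner_nonneg := fun E => by
        simp only [twoFormInner, RCLike.re_to_real]
        exact mul_nonneg (by norm_num) (Finset.sum_nonneg fun i _ => Finset.sum_nonneg fun j _ =>
          mul_self_nonneg _)
      add_left := fun E F G => by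
        simp only [twoFormInner, AlternatingMap.add_apply, add_mul, Finset.sum_add_distrib, mul_add]
      smul_left := fun E F c => by
        simp only [twoFormInner, AlternatingMap.smul_apply, conj_trivial, smul_eq_mul,
          Finset.mul_sum]
        exact Finset.sum_congr rfl fun i _ => Finset.sum_congr rfl fun j _ => by ring
      definite := fun E hE => by
        have h0 : ∑ i, ∑ j, E ![onb V i, onb V j] * E ![onb V i, onb V j] = 0 := by
          have : (1 / 2 : ℝ) * ∑ i, ∑ j, E ![onb V i, onb V j] * E ![onb V i, onb V j] = 0 := hE
          linarith
        refine hdef E fun i j => ?_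
        rw [Finset.sum_eq_zero_iff_of_nonneg fun i _ => Finset.sum_nonneg fun j _ =>
          mul_self_nonneg _] at h0
        have h1 := h0 i (Finset.mem_univ i)
        rw [Finset.sum_eq_zero_iff_of_nonneg fun j _ => mul_self_nonneg _] at h1
        exact mul_self_eq_zero.1 (h1 j (Finset.mem_univ j)) }
  let K : (V [⋀^Fin 2]→ₗ[ℝ] ℝ) →ₗ[ℝ] (V [⋀^Fin 2]→ₗ[ℝ] ℝ) :=
    { toFun := fun E =>
        { toFun := fun m => (1 / 2 : ℝ) * ∑ i, ∑ j, E ![onb V i, onb V j] *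
            R (m 0) (m 1) (onb V i) (onb V j)
          map_update_add' := fun {inst} m i u v => by
            obtain rfl := Subsingleton.elim inst (instDecidableEqFin 2)
            fin_cases i <;> simp [hadd, hadd2, mul_add, Finset.sum_add_distrib]
          map_update_smul' := fun {inst} m i c u => by
            obtain rfl := Subsingleton.elim inst (instDecidableEqFin 2)
            fin_cases i <;> simp [hsmul, hsmul2] <;>
              simp only [mul_left_comm _ c, ← Finset.mul_sum]
          map_eq_zero_of_eq' := fun m i j h hij => by
            have h01 : m 0 = m 1 := eq_of_eq_fin_two h hij
            have h0 : ∀ w z, R (m 0) (m 1) w z = 0 := fun w z => by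
              have := hswap (m 0) (m 1) w z
              rw [h01] at this ⊢
              linarith
            simp [h0] }
      map_add' := fun E F => by
        ext m
        simp [add_mul, Finset.sum_add_distrib, mul_add]
      map_smul' := fun c E => by
        ext m
        simp only [AlternatingMap.coe_mk, MultilinearMap.coe_mk, AlternatingMap.smul_apply,
          smul_eq_mul, Finset.mul_sum, RingHom.id_apply]
        refine Finset.sum_congr rfl fun i _ => Finset.sum_congr rfl fun j _ => by ring }
  let _ := core.toNormedAddCommGroup
  let _ : InnerProductSpace ℝ (V [⋀^Fin 2]→ₗ[ℝ] ℝ) := InnerProductSpace.ofCore core.toCore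
  -- Symmetry of the operator is pair symmetry of `R`, after exchanging the two index pairs in the
  -- fourfold sum.
  have hK : K.IsSymmetric := by
    intro E F
    change twoFormInner (K E) F = twoFormInner E (K F)
    have hKapp : ∀ (E : V [⋀^Fin 2]→ₗ[ℝ] ℝ) (u v : V), K E ![u, v] =
        (1 / 2 : ℝ) * ∑ i, ∑ j, E ![onb V i, onb V j] * R u v (onb V i) (onb V j) :=
      fun _ _ _ => rfl
    simp only [twoFormInner, hKapp, Finset.mul_sum, Finset.sum_mul]
    have hcomm : ∀ f : Fin (Module.finrank ℝ V) → Fin (Module.finrank ℝ V) →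
        Fin (Module.finrank ℝ V) → Fin (Module.finrank ℝ V) → ℝ,
        ∑ i, ∑ j, ∑ k, ∑ l, f i j k l = ∑ i, ∑ j, ∑ k, ∑ l, f k l i j := fun f => by
      have := Finset.sum_comm (s := Finset.univ) (t := Finset.univ)
        (f := fun p q : Fin (Module.finrank ℝ V) × Fin (Module.finrank ℝ V) => f p.1 p.2 q.1 q.2)
      simpa only [Fintype.sum_prod_type] using this
    rw [hcomm]
    refine Finset.sum_congr rfl fun i _ => Finset.sum_congr rfl fun j _ =>
      Finset.sum_congr rfl fun k _ => Finset.sum_congr rfl fun l _ => ?_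
    rw [hpair]
    ring
  let b := hK.eigenvectorBasis rfl
  refine ⟨b.toBasis, hK.eigenvalues rfl, fun α β => ?_, fun α u v => ?_⟩
  · have := orthonormal_iff_ite.1 b.orthonormal α β
    simpa using! this
  · have h := hK.apply_eigenvectorBasis rfl α
    have h' := congrArg (fun E : V [⋀^Fin 2]→ₗ[ℝ] ℝ => E ![u, v]) h
    exact h'

/-- For fixed u, v the function R(·,·,u,v) is a 2-form. By orthonormality its coefficient at E_α is
its inner product with E_α, and by pair symmetry this is the eigenvalue expression at (u, v). -/
theorem eq_sum_of_eigenbasis {V : Type*} [NormedAddCommGroup V] [InnerProductSpace ℝ V]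
    [FiniteDimensional ℝ V] {ν : Type*} [Fintype ν] [DecidableEq ν] (R : V → V → V → V → ℝ)
    (hadd : ∀ u u' v w z, R (u + u') v w z = R u v w z + R u' v w z)
    (hsmul : ∀ (c : ℝ) u v w z, R (c • u) v w z = c * R u v w z)
    (hswap : ∀ u v w z, R u v w z = -R v u w z)
    (hpair : ∀ u v w z, R u v w z = R w z u v)
    (b : Module.Basis ν ℝ (V [⋀^Fin 2]→ₗ[ℝ] ℝ)) (l : ν → ℝ)
    (hb : ∀ α β, twoFormInner (b α) (b β) = if α = β then 1 else 0)
    (hl : ∀ α (u v : V), (1 / 2 : ℝ) * ∑ i, ∑ j, b α ![onb V i, onb V j] *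
      R u v (onb V i) (onb V j) = l α * b α ![u, v]) (u v w z : V) :
    R u v w z = ∑ α, l α * b α ![u, v] * b α ![w, z] := by
  have hadd2 : ∀ u v v' w z, R u (v + v') w z = R u v w z + R u v' w z := fun u v v' w z => by
    rw [hswap, hadd, hswap v, hswap v']; ring
  have hsmul2 : ∀ (c : ℝ) u v w z, R u (c • v) w z = c * R u v w z := fun c u v w z => by
    rw [hswap, hsmul, hswap v]; ring
  let F : V [⋀^Fin 2]→ₗ[ℝ] ℝ :=
    { toFun := fun m => R (m 0) (m 1) u v
      map_update_add' := fun {inst} m i u v => by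
        obtain rfl := Subsingleton.elim inst (instDecidableEqFin 2)
        fin_cases i <;> simp [hadd, hadd2]
      map_update_smul' := fun {inst} m i c u => by
        obtain rfl := Subsingleton.elim inst (instDecidableEqFin 2)
        fin_cases i <;> simp [hsmul, hsmul2]
      map_eq_zero_of_eq' := fun m i j h hij => by
        have h01 : m 0 = m 1 := eq_of_eq_fin_two h hij
        have := hswap (m 0) (m 1) u v
        rw [h01] at this ⊢
        linarith }
  have hF : ∀ w z, F ![w, z] = R u v w z := fun w z => (hpair u v w z).symm
  have hrepr := b.sum_repr F
  have hc : ∀ α, b.repr F α = l α * b α ![u, v] := fun α => by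
    rw [← hl α u v]
    have h1 : (1 / 2 : ℝ) * ∑ i, ∑ j, b α ![onb V i, onb V j] * R u v (onb V i) (onb V j) =
        twoFormInner (∑ β, b.repr F β • b β) (b α) := by
      rw [hrepr, twoFormInner]
      simp only [hF, mul_comm]
    have h2 : ∀ c : ν → ℝ, twoFormInner (∑ β, c β • b β) (b α) =
        ∑ β, c β * twoFormInner (b β) (b α) := fun c => by
      simp only [twoFormInner, alternatingMap_sum_apply, AlternatingMap.smul_apply, smul_eq_mul,
        Finset.sum_mul, Finset.mul_sum]
      rw [Finset.sum_congr rfl fun i _ => Finset.sum_comm, Finset.sum_comm]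
      refine Finset.sum_congr rfl fun β _ => Finset.sum_congr rfl fun i _ =>
        Finset.sum_congr rfl fun j _ => by ring
    rw [h1, h2]
    simp [hb]
  rw [← hF, ← hrepr]
  simp only [alternatingMap_sum_apply, AlternatingMap.smul_apply, smul_eq_mul, hc]

theorem inner_rho {V : Type*} [NormedAddCommGroup V] [InnerProductSpace ℝ V]
    [FiniteDimensional ℝ V] (E : V [⋀^Fin 2]→ₗ[ℝ] ℝ) (v w : V) :
    (inner ℝ (rho E v) w : ℝ) = E ![v, w] := by
  have h : ∀ a, E ![v, a] = E.curryLeft v ![a] := fun a => rfl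
  have hu : ∀ a, (![a] : Fin 1 → V) = Function.update ![0] 0 a := fun a => by
    funext i; fin_cases i; simp
  conv_rhs => rw [← orthonormalBasis_sum_inner (stdOrthonormalBasis ℝ V) w, h, hu,
    AlternatingMap.map_update_sum]
  rw [rho, sum_inner]
  refine Finset.sum_congr rfl fun k _ => ?_
  rw [AlternatingMap.map_update_smul, ← hu, ← h, real_inner_smul_left, smul_eq_mul, mul_comm,
    real_inner_comm]
  rfl

variable {n : ℕ} {M : Type*} [TopologicalSpace M] [ChartedSpace (EuclideanSpace ℝ (Fin n)) M]
  [IsManifold (𝓡 n) ∞ M] [RiemannianBundle (fun x : M => TangentSpace (𝓡 n) x)]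
  [IsContMDiffRiemannianBundle (𝓡 n) ∞ (EuclideanSpace ℝ (Fin n))
      (fun x : M => TangentSpace (𝓡 n) x)] {x : M}

theorem curvature4_add (u u' v w z : TangentSpace (𝓡 n) x) :
    curvature4 x (u + u') v w z = curvature4 x u v w z + curvature4 x u' v w z := by
  rw [curvature4, curvature_add_left, inner_add_left]; rfl

theorem curvature4_smul (c : ℝ) (u v w z : TangentSpace (𝓡 n) x) :
    curvature4 x (c • u) v w z = c * curvature4 x u v w z := by
  rw [curvature4, curvature_smul_left, real_inner_smul_left]; rfl

theorem nonempty_curvatureEigenbasis (x : M) : Nonempty (CurvatureEigenbasis n x) := by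
  obtain ⟨b, l, hb, hl⟩ := exists_orthonormal_eigenbasis (V := TangentSpace (𝓡 n) x) (curvature4 x)
    (fun u u' v w z => curvature4_add u u' v w z) (fun c u v w z => curvature4_smul c u v w z)
    (fun u v w z => curvature4_swap_left u v w z) (fun u v w z => curvature4_pair_symm u v w z)
  exact ⟨⟨b, l, hb, hl⟩⟩

/-- Pairing with an arbitrary vector reduces the claim to the spectral decomposition of the
curvature tensor. In this form the action of the curvature by derivations becomes a combination of
the actions of the ρ(E_α). -/
theorem curvature_eq_sum_rho (B : CurvatureEigenbasis n x) (u v w : TangentSpace (𝓡 n) x) :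
    curvature x u v w =
      ∑ α, (B.eigenvalue α * B.basis α ![u, v]) • rho (B.basis α) w := by
  refine ext_inner_right ℝ fun z => ?_
  have h := eq_sum_of_eigenbasis (V := TangentSpace (𝓡 n) x) (curvature4 x)
    (fun u u' v w z => curvature4_add u u' v w z) (fun c u v w z => curvature4_smul c u v w z)
    (fun u v w z => curvature4_swap_left u v w z) (fun u v w z => curvature4_pair_symm u v w z)
    B.basis B.eigenvalue B.orthonormal
    B.eigen u v w z
  rw [curvature4] at h
  rw [h, sum_inner]
  simp only [real_inner_smul_left, inner_rho]

end Eigenbasis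

/-! ### Derivations and alternating functions -/

section Derivation

variable {V : Type*} [AddCommGroup V] [Module ℝ V] {ι : Type*} [DecidableEq ι] [Fintype ι]

/-- The action of `A` on `F` by derivations. -/
def derivation (A : V → V) (F : (ι → V) → ℝ) (W : ι → V) : ℝ :=
  ∑ s, F (Function.update W s (A (W s)))

theorem derivation_update (A : V → V) (F : (ι → V) → ℝ) (W : ι → V) (i : ι) (u : V) :
    derivation A F (Function.update W i u) = F (Function.update W i (A u)) +
      ∑ s ∈ Finset.univ.erase i, F (Function.update (Function.update W s (A (W s))) i u) := by
  rw [derivation, ← Finset.add_sum_erase _ _ (Finset.mem_univ i)]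
  congr 1
  · simp
  · refine Finset.sum_congr rfl fun s hs => ?_
    have hs : s ≠ i := Finset.ne_of_mem_erase hs
    rw [Function.update_of_ne hs, Function.update_comm hs]

theorem IsMultilin.derivation {F : (ι → V) → ℝ} (hF : IsMultilin F) (A : V →ₗ[ℝ] V) :
    IsMultilin (derivation A F) where
  add m i u v := by
    simp only [derivation_update, map_add, hF.add, Finset.sum_add_distrib]
    ring
  smul m i c u := by
    simp only [derivation_update, map_smul, hF.smul, Finset.mul_sum, mul_add]

/-- The alternating map given by a multilinear function which changes sign under transpositions. -/
def IsMultilin.toAlternatingMap {F : (ι → V) → ℝ} (hF : IsMultilin F)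
    (hs : ∀ (m : ι → V) (i j : ι), i ≠ j → F (m ∘ Equiv.swap i j) = -F m) : V [⋀^ι]→ₗ[ℝ] ℝ :=
  { hF.toMultilinearMap with
    map_eq_zero_of_eq' := fun m i j h hij => by
      have h1 := hs m i j hij
      have h2 : m ∘ Equiv.swap i j = m := by
        funext k
        by_cases hi : k = i
        · subst hi; simp [h]
        · by_cases hj : k = j
          · subst hj; simp [h]
          · simp [Equiv.swap_apply_of_ne_of_ne hi hj]
      rw [h2] at h1
      change F m = 0
      linarith }

theorem IsMultilin.toAlternatingMap_apply {F : (ι → V) → ℝ} (hF : IsMultilin F)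
    (hs : ∀ (m : ι → V) (i j : ι), i ≠ j → F (m ∘ Equiv.swap i j) = -F m) (m : ι → V) :
    hF.toAlternatingMap hs m = F m := rfl

/-- Moving an argument to the front. -/
theorem IsMultilin.neg_one_pow_mul_cons {p : ℕ} {F : (Fin (p + 1) → V) → ℝ} (hF : IsMultilin F)
    (hs : ∀ (m : Fin (p + 1) → V) (i j : Fin (p + 1)), i ≠ j → F (m ∘ Equiv.swap i j) = -F m)
    (i : Fin (p + 1)) (u : V) (m : Fin (p + 1) → V) :
    (-1 : ℝ) ^ (i : ℕ) * F (Fin.cons u (i.removeNth m)) = F (Function.update m i u) := by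
  have h := (hF.toAlternatingMap hs).neg_one_pow_smul_map_insertNth i u (i.removeNth m)
  rw [Fin.insertNth_removeNth] at h
  have h1 : hF.toAlternatingMap hs (Fin.cons u (i.removeNth m)) =
      (-1) ^ (i : ℕ) * hF.toAlternatingMap hs (Function.update m i u) := by
    simpa using! h.symm
  simp only [IsMultilin.toAlternatingMap_apply] at h1
  rw [h1, ← mul_assoc, ← mul_pow]
  simp

end Derivation

/-! ### Double forms: ∇, D and δ as tensor operations -/

section Forms

variable {n : ℕ} {M : Type*} [TopologicalSpace M] [ChartedSpace (EuclideanSpace ℝ (Fin n)) M]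
  [IsManifold (𝓡 n) ∞ M] [RiemannianBundle (fun x : M => TangentSpace (𝓡 n) x)]
  [IsContMDiffRiemannianBundle (𝓡 n) ∞ (EuclideanSpace ℝ (Fin n))
      (fun x : M => TangentSpace (𝓡 n) x)] {p q : ℕ} {x : M}

/-- A double form as a function of all its arguments. -/
def flat (φ : TensorField n M p q) : TField n M (Fin p ⊕ Fin q) :=
  fun x W => φ x (fun i => W (Sum.inl i)) (fun j => W (Sum.inr j))

/-- `φ` is a smooth double form. -/
structure IsForm (φ : TensorField n M p q) : Prop where
  tensor : IsTensor (flat φ)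
  swap_left : ∀ (x : M) (Y : Fin p → TangentSpace (𝓡 n) x) (Z : Fin q → TangentSpace (𝓡 n) x)
    (i j : Fin p), i ≠ j → φ x (Y ∘ Equiv.swap i j) Z = -φ x Y Z
  swap_right : ∀ (x : M) (Y : Fin p → TangentSpace (𝓡 n) x) (Z : Fin q → TangentSpace (𝓡 n) x)
    (i j : Fin q), i ≠ j → φ x Y (Z ∘ Equiv.swap i j) = -φ x Y Z

theorem DoubleForm.isForm (φ : DoubleForm n M p q) : IsForm φ.toField where
  tensor :=
    { multilin := fun x => by
        refine ⟨?_, ?_⟩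
        · rintro m (i | i) u v
          · simp only [flat, DoubleForm.toField, update_inl_inl, update_inl_inr,
              AlternatingMap.map_update_add, AlternatingMap.add_apply]
          · simp only [flat, DoubleForm.toField, update_inr_inl, update_inr_inr,
              AlternatingMap.map_update_add]
        · rintro m (i | i) c u
          · simp only [flat, DoubleForm.toField, update_inl_inl, update_inl_inr,
              AlternatingMap.map_update_smul, AlternatingMap.smul_apply, smul_eq_mul]
          · simp only [flat, DoubleForm.toField, update_inr_inl, update_inr_inr,
              AlternatingMap.map_update_smul, smul_eq_mul]
      smooth := fun x W hW => by
        have h : ∀ s, ∀ᶠ y in 𝓝 x, SmoothField (W s) y := fun s => (hW s).eventually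
        filter_upwards [Filter.eventually_all.2 h] with y hy
        exact φ.smooth y _ _ (fun i => (hy (Sum.inl i)).contMDiffAt)
          (fun j => (hy (Sum.inr j)).contMDiffAt) }
  swap_left x Y Z i j h := by
    simp only [DoubleForm.toField]
    rw [AlternatingMap.map_swap _ _ h, AlternatingMap.neg_apply]
  swap_right x Y Z i j h := by
    simp only [DoubleForm.toField]
    rw [AlternatingMap.map_swap _ _ h]

theorem flat_elim (φ : TensorField n M p q) (x : M) (Y : Fin p → TangentSpace (𝓡 n) x)
    (Z : Fin q → TangentSpace (𝓡 n) x) : flat φ x (Sum.elim Y Z) = φ x Y Z := rfl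

theorem flat_transpose (φ : TensorField n M p q) :
    flat (transpose φ) = reindex (Equiv.sumComm _ _) (flat φ) := rfl

theorem IsForm.transpose {φ : TensorField n M p q} (hφ : IsForm φ) : IsForm (transpose φ) where
  tensor := by
    rw [flat_transpose]
    exact hφ.tensor.reindex _
  swap_left x Y Z i j h := hφ.swap_right x Z Y i j h
  swap_right x Y Z i j h := hφ.swap_left x Z Y i j h

theorem elim_update_left {V : Type*} (Y : Fin p → V) (Z : Fin q → V) (i : Fin p) (v : V) :
    Sum.elim (Function.update Y i v) Z = Function.update (Sum.elim Y Z) (Sum.inl i) v :=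
  (Sum.update_elim_inl).symm

theorem nabla_eq (φ : TensorField n M p q) (v : TangentSpace (𝓡 n) x)
    (Y : Fin p → TangentSpace (𝓡 n) x) (Z : Fin q → TangentSpace (𝓡 n) x) :
    nabla φ x v Y Z = covD (flat φ) x v (Sum.elim Y Z) := by
  simp only [nabla, covD, covDField, Fintype.sum_sum_type, flat, update_inl_inl, update_inl_inr,
    update_inr_inl, update_inr_inr, Sum.elim_inl, Sum.elim_inr, extendVec_self, dfn]
  ring

theorem flat_nabla (φ : TensorField n M p q) (v : TangentSpace (𝓡 n) x)
    (W : Fin p ⊕ Fin q → TangentSpace (𝓡 n) x) :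
    nabla φ x v (fun i => W (Sum.inl i)) (fun j => W (Sum.inr j)) = covD (flat φ) x v W := by
  rw [nabla_eq]
  congr 1
  funext s
  rcases s with s | s <;> rfl

/-- The slot `none` of ∇T carries the extension of `v`, and its correction term is the derivative
along ∇_u V. What remains differentiates y ↦ ∇_V T, as in the definition of `nabla2`. -/
theorem covD_gradT {ι : Type*} [Fintype ι] [DecidableEq ι] (T : TField n M ι)
    (u v : TangentSpace (𝓡 n) x) (w : ι → TangentSpace (𝓡 n) x) :
    covD (gradT T) x u (optCons v w) = covD (fun y W => covD T y (extendVec v y) W) x u w -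
      covD T x (leviCivita (extendVec v) x u) w := by
  rw [covD, covDField, Fintype.sum_option, ← sub_sub, sub_right_comm]
  congr 1
  · simp only [gradT, update_some_comp_some, Function.update_of_ne (Option.some_ne_none _).symm,
      optCons, Option.elim, extendVec_self]
    conv_rhs => rw [covD, covDField]
    simp only [extendVec_self]
  · simp only [gradT, update_none_comp_some, Function.update_self, optCons, Option.elim,
      extendVec_self]

theorem nabla2_eq (φ : TensorField n M p q) (u v : TangentSpace (𝓡 n) x)
    (Y : Fin p → TangentSpace (𝓡 n) x) (Z : Fin q → TangentSpace (𝓡 n) x) :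
    nabla2 φ x u v Y Z = covD (gradT (flat φ)) x u (optCons v (Sum.elim Y Z)) := by
  rw [nabla2, nabla_eq, nabla_eq, covD_gradT]
  congr 2
  funext y W
  exact flat_nabla _ _ _

theorem nabla_transpose (φ : TensorField n M p q) (v : TangentSpace (𝓡 n) x)
    (Y : Fin p → TangentSpace (𝓡 n) x) (Z : Fin q → TangentSpace (𝓡 n) x) :
    nabla (transpose φ) x v Z Y = nabla φ x v Y Z := by
  simp only [nabla, transpose]
  ring

theorem nabla2_transpose (φ : TensorField n M p q) (u v : TangentSpace (𝓡 n) x)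
    (Y : Fin p → TangentSpace (𝓡 n) x) (Z : Fin q → TangentSpace (𝓡 n) x) :
    nabla2 (transpose φ) x u v Z Y = nabla2 φ x u v Y Z := by
  rw [nabla2, nabla2, nabla_transpose]
  congr 1
  rw [← nabla_transpose]
  congr 1
  funext y Z Y
  exact nabla_transpose _ _ _ _

/-- Covariant differentiation commutes with relabelling, so a tensor that changes sign under a
relabelling has a derivative that does so too. -/
theorem covD_swap {ι : Type*} [Fintype ι] [DecidableEq ι] {T : TField n M ι} (hT : IsTensor T)
    (σ : ι ≃ ι) (h : ∀ x W, T x (fun i => W (σ i)) = -T x W) (v : TangentSpace (𝓡 n) x)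
    (W : ι → TangentSpace (𝓡 n) x) : covD T x v (fun i => W (σ i)) = -covD T x v W := by
  rw [← covD_reindex]
  have h1 : reindex σ T = fun x W => (-1) * T x W := by
    funext x W
    rw [reindex, h]; ring
  rw [h1, covD_const_mul _ hT]
  ring

theorem covD_gradT_swap {ι : Type*} [Fintype ι] [DecidableEq ι] {T : TField n M ι}
    (hT : IsTensor T) (σ : ι ≃ ι) (h : ∀ x W, T x (fun i => W (σ i)) = -T x W)
    (u v : TangentSpace (𝓡 n) x) (W : ι → TangentSpace (𝓡 n) x) :
    covD (gradT T) x u (optCons v (fun i => W (σ i))) = -covD (gradT T) x u (optCons v W) := by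
  have h1 : ∀ x W, gradT T x (fun o => W (Equiv.optionCongr σ o)) = -gradT T x W := fun x W => by
    change covD T x (W none) (fun i => W (some (σ i))) = -covD T x (W none) (fun i => W (some i))
    exact covD_swap hT σ h (W none) (fun i => W (some i))
  rw [← covD_swap hT.gradT (Equiv.optionCongr σ) h1]
  congr 1
  funext o
  cases o <;> rfl

theorem IsForm.flat_swap_left {φ : TensorField n M p q} (hφ : IsForm φ) {i j : Fin p} (h : i ≠ j)
    (x : M) (W : Fin p ⊕ Fin q → TangentSpace (𝓡 n) x) :
    flat φ x (fun s => W ((Equiv.swap i j).sumCongr (Equiv.refl _) s)) = -flat φ x W :=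
  hφ.swap_left x (fun i => W (Sum.inl i)) _ i j h

theorem elim_comp_left {V : Type*} (Y : Fin p → V) (Z : Fin q → V) (σ : Fin p ≃ Fin p) :
    Sum.elim (Y ∘ σ) Z = fun s => Sum.elim Y Z (σ.sumCongr (Equiv.refl _) s) := by
  funext s; rcases s with s | s <;> rfl

theorem IsForm.nabla_swap_left {φ : TensorField n M p q} (hφ : IsForm φ)
    (v : TangentSpace (𝓡 n) x) (Y : Fin p → TangentSpace (𝓡 n) x)
    (Z : Fin q → TangentSpace (𝓡 n) x) {i j : Fin p} (h : i ≠ j) :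
    nabla φ x v (Y ∘ Equiv.swap i j) Z = -nabla φ x v Y Z := by
  rw [nabla_eq, nabla_eq, elim_comp_left, covD_swap hφ.tensor _ (hφ.flat_swap_left h)]

theorem IsForm.nabla_swap_right {φ : TensorField n M p q} (hφ : IsForm φ)
    (v : TangentSpace (𝓡 n) x) (Y : Fin p → TangentSpace (𝓡 n) x)
    (Z : Fin q → TangentSpace (𝓡 n) x) {i j : Fin q} (h : i ≠ j) :
    nabla φ x v Y (Z ∘ Equiv.swap i j) = -nabla φ x v Y Z := by
  rw [← nabla_transpose, ← nabla_transpose φ, hφ.transpose.nabla_swap_left _ _ _ h]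

theorem IsForm.nabla2_swap_left {φ : TensorField n M p q} (hφ : IsForm φ)
    (u v : TangentSpace (𝓡 n) x) (Y : Fin p → TangentSpace (𝓡 n) x)
    (Z : Fin q → TangentSpace (𝓡 n) x) {i j : Fin p} (h : i ≠ j) :
    nabla2 φ x u v (Y ∘ Equiv.swap i j) Z = -nabla2 φ x u v Y Z := by
  rw [nabla2_eq, nabla2_eq, elim_comp_left, covD_gradT_swap hφ.tensor _ (hφ.flat_swap_left h)]

theorem IsForm.isMultilin_nabla {φ : TensorField n M p q} (hφ : IsForm φ)
    (v : TangentSpace (𝓡 n) x) (Z : Fin q → TangentSpace (𝓡 n) x) :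
    IsMultilin fun Y => nabla φ x v Y Z := by
  have h := isMultilin_covD hφ.tensor v
  simp only [nabla_eq]
  refine ⟨fun m i u w => ?_, fun m i c u => ?_⟩
  · simp only [← Sum.update_elim_inl, h.add]
  · simp only [← Sum.update_elim_inl, h.smul]

theorem IsForm.isMultilin_nabla2 {φ : TensorField n M p q} (hφ : IsForm φ)
    (u v : TangentSpace (𝓡 n) x) (Z : Fin q → TangentSpace (𝓡 n) x) :
    IsMultilin fun Y => nabla2 φ x u v Y Z := by
  have h := isMultilin_covD hφ.tensor.gradT u
  have ho : ∀ (W : Fin p ⊕ Fin q → TangentSpace (𝓡 n) x) s w, optCons v (Function.update W s w) =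
      Function.update (optCons v W) (some s) w := by
    intro W s w
    funext o
    cases o with
    | none => simp [optCons]
    | some t => simp [optCons, Function.update_apply]
  simp only [nabla2_eq]
  refine ⟨fun m i u w => ?_, fun m i c u => ?_⟩
  · simp only [← Sum.update_elim_inl, ho, h.add]
  · simp only [← Sum.update_elim_inl, ho, h.smul]

theorem nabla_map_add {φ : TensorField n M p q} (hφ : IsForm φ) (u v : TangentSpace (𝓡 n) x)
    (Y : Fin p → TangentSpace (𝓡 n) x) (Z : Fin q → TangentSpace (𝓡 n) x) :
    nabla φ x (u + v) Y Z = nabla φ x u Y Z + nabla φ x v Y Z := by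
  simp only [nabla_eq, covD_map_add hφ.tensor]

theorem nabla_map_smul {φ : TensorField n M p q} (hφ : IsForm φ) (c : ℝ) (v : TangentSpace (𝓡 n) x)
    (Y : Fin p → TangentSpace (𝓡 n) x) (Z : Fin q → TangentSpace (𝓡 n) x) :
    nabla φ x (c • v) Y Z = c * nabla φ x v Y Z := by
  simp only [nabla_eq, covD_map_smul hφ.tensor]

/-- The relabelling of the arguments of `∇φ` in the `i`-th term of `Dφ`. -/
def extDEquiv (p q : ℕ) (i : Fin (p + 1)) : Option (Fin p ⊕ Fin q) ≃ Fin (p + 1) ⊕ Fin q where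
  toFun o := o.elim (Sum.inl i) (Sum.map i.succAbove id)
  invFun := Sum.elim (fun j => (finSuccEquiv' i j).map Sum.inl) (fun k => some (Sum.inr k))
  left_inv o := by
    rcases o with _ | (j | k) <;> simp
  right_inv s := by
    rcases s with j | k
    · cases h : finSuccEquiv' i j with
      | none => simp_all
      | some l => simp_all
    · simp

/-- Exhibits Dφ as a constant combination of relabelled copies of ∇φ, so that its smoothness and its
covariant derivative come from the general tensor calculus. -/
theorem flat_extD (φ : TensorField n M p q) : flat (extD φ) = fun x W =>
    ∑ i : Fin (p + 1), (-1 : ℝ) ^ (i : ℕ) * reindex (extDEquiv p q i) (gradT (flat φ)) x W := by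
  funext x W
  simp only [flat, extD, nabla_eq, reindex, gradT]
  refine Finset.sum_congr rfl fun i _ => ?_
  congr 2
  funext s
  rcases s with s | s <;> rfl

theorem IsForm.extD {φ : TensorField n M p q} (hφ : IsForm φ) : IsForm (extD φ) where
  tensor := by
    rw [flat_extD]
    exact IsTensor.sum _ fun i => (hφ.tensor.gradT.reindex _).const_mul _
  swap_left x Y Z i j h := by
    -- For fixed `Z`, Dφ is the alternatisation of the linear map v ↦ ∇_v φ(·; Z) into alternating
    -- maps, which gives the sign under transpositions.
    let f : TangentSpace (𝓡 n) x →ₗ[ℝ] (TangentSpace (𝓡 n) x) [⋀^Fin p]→ₗ[ℝ] ℝ :=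
      { toFun := fun v => (hφ.isMultilin_nabla v Z).toAlternatingMap fun m i j h =>
          hφ.nabla_swap_left v m Z h
        map_add' := fun u v => by
          ext m
          exact nabla_map_add hφ u v m Z
        map_smul' := fun c v => by
          ext m
          exact nabla_map_smul hφ c v m Z }
    have h1 : ∀ Y, DoubleForms.extD φ x Y Z = AlternatingMap.alternatizeUncurryFin f Y := fun Y => by
      rw [AlternatingMap.alternatizeUncurryFin_apply, DoubleForms.extD]
      refine Finset.sum_congr rfl fun i _ => ?_
      have h2 : ∀ a : ℝ, (-1 : ℤ) ^ (i : ℕ) • a = (-1 : ℝ) ^ (i : ℕ) * a := fun a => by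
        rw [zsmul_eq_mul]; push_cast; rfl
      rw [h2]
      rfl
    rw [h1, h1, AlternatingMap.map_swap _ _ h]
  swap_right x Y Z i j h := by
    simp only [DoubleForms.extD, hφ.nabla_swap_right _ _ _ h, mul_neg, Finset.sum_neg_distrib]

theorem nabla_extD {φ : TensorField n M p q} (hφ : IsForm φ) (u : TangentSpace (𝓡 n) x)
    (Y : Fin (p + 1) → TangentSpace (𝓡 n) x) (Z : Fin q → TangentSpace (𝓡 n) x) :
    nabla (extD φ) x u Y Z =
      ∑ i : Fin (p + 1), (-1 : ℝ) ^ (i : ℕ) * nabla2 φ x u (Y i) (i.removeNth Y) Z := by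
  rw [nabla_eq, flat_extD,
    covD_sum _ fun i => (hφ.tensor.gradT.reindex (extDEquiv p q i)).const_mul _]
  refine Finset.sum_congr rfl fun i _ => ?_
  rw [covD_const_mul _ (hφ.tensor.gradT.reindex _), covD_reindex, nabla2_eq]
  congr 2
  funext s
  rcases s with _ | (s | s) <;> rfl

/-- The relabelling of the arguments of `∇φ` in `δφ`. -/
def codiffEquiv (p q : ℕ) : Option (Fin (p + 1) ⊕ Fin q) ≃ (Unit ⊕ Unit) ⊕ (Fin p ⊕ Fin q) where
  toFun o := o.elim (Sum.inl (Sum.inl ())) (Sum.elim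
    (Fin.cons (α := fun _ => (Unit ⊕ Unit) ⊕ (Fin p ⊕ Fin q)) (Sum.inl (Sum.inr ()))
      fun j => Sum.inr (Sum.inl j)) fun k => Sum.inr (Sum.inr k))
  invFun := Sum.elim (Sum.elim (fun _ => none) fun _ => some (Sum.inl 0))
    (Sum.elim (fun j => some (Sum.inl j.succ)) fun k => some (Sum.inr k))
  left_inv o := by
    rcases o with _ | (j | k)
    · rfl
    · refine Fin.cases ?_ (fun j => ?_) j <;> simp
    · simp
  right_inv s := by
    rcases s with (_ | _) | (j | k) <;> simp

theorem elim_codiffEquiv {V : Type*} (u v : V) (W : Fin p ⊕ Fin q → V) :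
    (fun o => Sum.elim (Sum.elim (fun _ => u) (fun _ => v)) W (codiffEquiv p q o)) =
      optCons u (Sum.elim (Fin.cons (α := fun _ => V) v fun i => W (Sum.inl i))
        fun j => W (Sum.inr j)) := by
  funext o
  rcases o with _ | (j | k)
  · rfl
  · refine Fin.cases ?_ (fun j => ?_) j <;> simp [codiffEquiv, optCons]
  · rfl

theorem flat_codiff (φ : TensorField n M (p + 1) q) : flat (codiff φ) = fun x W =>
    (-1 : ℝ) * contr (reindex (codiffEquiv p q) (gradT (flat φ))) x W := by
  funext x W
  -- One pair is contracted, so the multi-indices are functions on `Unit`, that is, single indices.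
  rw [contr, pairSum, ← (Equiv.funUnique Unit _).symm.sum_comp, neg_one_mul]
  simp only [flat, codiff, nabla_eq]
  refine congrArg Neg.neg (Finset.sum_congr rfl fun k _ => ?_)
  simp only [reindex]
  have h := elim_codiffEquiv (frame x k) (frame x k) W
  refine Eq.trans ?_ (congrArg (gradT (flat φ) x) h.symm)
  rfl

theorem codiff_zero (φ : TensorField n M 0 q) : codiff φ = 0 := rfl

/-- The frame in the definition of δ is not differentiated: δφ is a contraction of ∇φ, and ∇
commutes with contractions. -/
theorem nabla_codiff {φ : TensorField n M (p + 1) q} (hφ : IsForm φ) (u : TangentSpace (𝓡 n) x)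
    (Y : Fin p → TangentSpace (𝓡 n) x) (Z : Fin q → TangentSpace (𝓡 n) x) :
    nabla (p := p) (codiff φ) x u Y Z = -∑ k, nabla2 φ x u (frame x k)
        (Fin.cons (α := fun _ => TangentSpace (𝓡 n) x) (frame x k) Y) Z := by
  have h := hφ.tensor.gradT.reindex (codiffEquiv p q)
  rw [nabla_eq (p := p), flat_codiff, covD_const_mul _ h.contr, covD_contr h (frameBasis x),
    ← (Equiv.funUnique Unit _).symm.sum_comp, neg_one_mul]
  refine congrArg Neg.neg (Finset.sum_congr rfl fun k _ => ?_)
  rw [covD_reindex, nabla2_eq]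
  exact congrArg (covD (gradT (flat φ)) x u) (elim_codiffEquiv (frame x k) (frame x k) _)

theorem IsForm.codiff {φ : TensorField n M (p + 1) q} (hφ : IsForm φ) :
    IsForm (p := p) (codiff φ) where
  tensor := by
    rw [flat_codiff]
    exact (hφ.tensor.gradT.reindex _).contr.const_mul _
  swap_left x Y Z i j h := by
    have h1 : ∀ v : TangentSpace (𝓡 n) x,
        (Fin.cons v (Y ∘ Equiv.swap i j) : Fin (p + 1) → TangentSpace (𝓡 n) x) =
        Fin.cons (α := fun _ => TangentSpace (𝓡 n) x) v Y ∘ Equiv.swap i.succ j.succ := by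
      intro v
      funext k
      refine Fin.cases ?_ (fun k => ?_) k
      · simp [Equiv.swap_apply_of_ne_of_ne (Fin.succ_ne_zero i).symm (Fin.succ_ne_zero j).symm]
      · simp only [Fin.cons_succ, Function.comp_apply, Equiv.swap_apply_def, Fin.succ_inj]
        split_ifs <;> simp
    simp only [DoubleForms.codiff, h1]
    simp only [hφ.nabla_swap_left _ _ _ (fun h' => h (Fin.succ_injective _ h')),
      Finset.sum_neg_distrib]
  swap_right x Y Z i j h := by
    simp only [DoubleForms.codiff, hφ.nabla_swap_right _ _ _ h, Finset.sum_neg_distrib]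

end Forms

/-! ### The curvature term as an algebraic expression in ρ(E) -/

section Algebra

variable {V : Type*} [NormedAddCommGroup V] [InnerProductSpace ℝ V] [FiniteDimensional ℝ V]

/-- `ρ(E)` as a linear map. -/
def rhoLin (E : V [⋀^Fin 2]→ₗ[ℝ] ℝ) : V →ₗ[ℝ] V where
  toFun := rho E
  map_add' u v := ext_inner_right ℝ fun w => by
    rw [inner_add_left, inner_rho, inner_rho, inner_rho]
    exact AlternatingMap.map_vecCons_add E _ _ _
  map_smul' c v := ext_inner_right ℝ fun w => by
    rw [RingHom.id_apply, real_inner_smul_left, inner_rho, inner_rho]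
    exact AlternatingMap.map_vecCons_smul E _ _ _

theorem neg_rho_eq_sum (E : V [⋀^Fin 2]→ₗ[ℝ] ℝ) (v : V) :
    ∑ k, E ![onb V k, v] • onb V k = -rho E v := by
  rw [rho, ← Finset.sum_neg_distrib]
  refine Finset.sum_congr rfl fun k _ => ?_
  have h := E.map_swap ![v, onb V k] (i := 0) (j := 1) (by simp)
  have h2 : (![v, onb V k] ∘ Equiv.swap (0 : Fin 2) 1) = ![onb V k, v] := by
    funext i; fin_cases i <;> simp
  rw [h2] at h
  rw [h, neg_smul]

theorem rhoD_eq {p q : ℕ} (E : V [⋀^Fin 2]→ₗ[ℝ] ℝ) (φ : (Fin p → V) → (Fin q → V) → ℝ)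
    (Y : Fin p → V) (Z : Fin q → V) :
    rhoD E φ Y Z = derivation (fun v => -rho E v)
      (fun W : Fin p ⊕ Fin q → V => φ (fun i => W (Sum.inl i)) fun j => W (Sum.inr j))
      (Sum.elim Y Z) := by
  simp only [rhoD, derivation, Fintype.sum_sum_type, update_inl_inl, update_inl_inr,
    update_inr_inl, update_inr_inr, Sum.elim_inl, Sum.elim_inr]

theorem derivation_neg {ι : Type*} [DecidableEq ι] [Fintype ι] {F : (ι → V) → ℝ}
    (hF : IsMultilin F) (A : V → V) (W : ι → V) :
    derivation (fun v => -A v) F W = -derivation A F W := by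
  simp only [derivation, hF.neg, Finset.sum_neg_distrib]

/-- Contraction of a derivation by an algebraic curvature tensor. -/
theorem sum_derivation_eq {ι ν : Type*} [DecidableEq ι] [Fintype ι] [Fintype ν] {F : (ι → V) → ℝ}
    (hF : IsMultilin F) (R : V → V → V → V) (E : ν → V [⋀^Fin 2]→ₗ[ℝ] ℝ) (l : ν → ℝ)
    (hR : ∀ u v w, R u v w = ∑ α, (l α * E α ![u, v]) • rho (E α) w) (W : ι → V) (i : ι) :
    ∑ k, derivation (R (onb V k) (W i)) F (Function.update W i (onb V k)) =
      -∑ α, l α * derivation (fun v => -rho (E α) v) F (Function.update W i (-rho (E α) (W i))) := by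
  have h1 : ∀ (u v : V) (U : ι → V), derivation (R u v) F U =
      ∑ α, l α * (E α ![u, v] * derivation (rho (E α)) F U) := by
    intro u v U
    simp only [derivation, hR, hF.sum, hF.smul, Finset.mul_sum]
    rw [Finset.sum_comm]
    refine Finset.sum_congr rfl fun α _ => Finset.sum_congr rfl fun s _ => ?_
    ring
  simp only [h1]
  rw [Finset.sum_comm, ← Finset.sum_neg_distrib]
  refine Finset.sum_congr rfl fun α _ => ?_
  -- By linearity in slot `i` the sum over `k` is moved inside, where ∑ E(e_k, v) e_k = -ρ(E)v
  -- appears. The other sign comes from the convention that ρ(E)_d acts through -ρ(E).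
  rw [← Finset.mul_sum, derivation_neg hF, mul_neg, neg_neg, ← neg_rho_eq_sum]
  have h2 := hF.derivation (rhoLin (E α))
  change IsMultilin (derivation (rho (E α)) F) at h2
  rw [h2.sum]
  simp only [h2.smul]

end Algebra

/-! ### The Weitzenböck formula -/

section Weitzenbock

variable {n : ℕ} {M : Type*} [TopologicalSpace M] [ChartedSpace (EuclideanSpace ℝ (Fin n)) M]
  [IsManifold (𝓡 n) ∞ M] [RiemannianBundle (fun x : M => TangentSpace (𝓡 n) x)]
  [IsContMDiffRiemannianBundle (𝓡 n) ∞ (EuclideanSpace ℝ (Fin n))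
      (fun x : M => TangentSpace (𝓡 n) x)] {p q : ℕ} {x : M}

theorem rhoD_field (E : TwoForm n x) (φ : TensorField n M p q)
    (Y : Fin p → TangentSpace (𝓡 n) x) (Z : Fin q → TangentSpace (𝓡 n) x) :
    rhoD E (φ x) Y Z = derivation (fun v => -rho E v) (flat φ x) (Sum.elim Y Z) :=
  rhoD_eq E (φ x) Y Z

theorem nabla2_sub_swap {φ : TensorField n M p q} (hφ : IsForm φ) (u v : TangentSpace (𝓡 n) x)
    (Y : Fin p → TangentSpace (𝓡 n) x) (Z : Fin q → TangentSpace (𝓡 n) x) :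
    nabla2 φ x u v Y Z - nabla2 φ x v u Y Z =
      derivation (curvature x u v) (flat φ x) (Sum.elim Y Z) := by
  rw [nabla2_eq, nabla2_eq, ricci_identity hφ.tensor]
  rfl

/-- In δD the term that differentiates along the contracted vector e_k is ∇*∇. Every other term has
a partner in Dδ with the two derivatives in the opposite order, and the Ricci identity turns the
pair into curvature. -/
theorem hodgeLaplacian_succ_eq {φ : TensorField n M (p + 1) q} (hφ : IsForm φ)
    (Y : Fin (p + 1) → TangentSpace (𝓡 n) x) (Z : Fin q → TangentSpace (𝓡 n) x) :
    hodgeLaplacian φ x Y Z = connectionLaplacian φ x Y Z + ∑ i, ∑ k,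
      derivation (curvature x (frame x k) (Y i)) (flat φ x)
        (Function.update (Sum.elim Y Z) (Sum.inl i) (frame x k)) := by
  have h1 : codiff (extD φ) x Y Z = connectionLaplacian φ x Y Z +
      ∑ i : Fin (p + 1), ∑ k, (-1 : ℝ) ^ (i : ℕ) * nabla2 φ x (frame x k) (Y i)
        (Fin.cons (α := fun _ => TangentSpace (𝓡 n) x) (frame x k) (i.removeNth Y)) Z := by
    rw [codiff, connectionLaplacian, Finset.sum_comm, ← sub_eq_iff_eq_add', neg_sub_neg,
      ← Finset.sum_sub_distrib]
    refine Finset.sum_congr rfl fun k _ => ?_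
    -- The summand with index 0 is ∇²_{e_k,e_k}; the index shift of the others accounts for the
    -- change of sign.
    rw [nabla_extD hφ, Fin.sum_univ_succ]
    simp only [Fin.val_zero, pow_zero, one_mul, Fin.cons_zero, Fin.cons_succ, Fin.val_succ]
    rw [← sub_sub]
    have h0 : (0 : Fin (p + 2)).removeNth
        (Fin.cons (α := fun _ => TangentSpace (𝓡 n) x) (frame x k) Y) = Y := by
      funext j; simp [Fin.removeNth]
    rw [h0, sub_self, zero_sub, ← Finset.sum_neg_distrib]
    refine Finset.sum_congr rfl fun i _ => ?_
    have h2 : i.succ.removeNth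
        (Fin.cons (α := fun _ => TangentSpace (𝓡 n) x) (frame x k) Y) =
        Fin.cons (α := fun _ => TangentSpace (𝓡 n) x) (frame x k) (i.removeNth Y) := by
      funext j
      refine Fin.cases ?_ (fun j => ?_) j <;> simp [Fin.removeNth]
    rw [h2]
    ring
  have h2 : extD (p := p) (codiff φ) x Y Z = -∑ i : Fin (p + 1), ∑ k, (-1 : ℝ) ^ (i : ℕ) *
      nabla2 φ x (Y i) (frame x k)
        (Fin.cons (α := fun _ => TangentSpace (𝓡 n) x) (frame x k) (i.removeNth Y)) Z := by
    rw [extD, ← Finset.sum_neg_distrib]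
    refine Finset.sum_congr rfl fun i _ => ?_
    rw [nabla_codiff hφ, mul_neg, Finset.mul_sum]
  change extD (p := p) (codiff φ) x Y Z + codiff (extD φ) x Y Z = _
  rw [h1, h2, add_comm, add_assoc, ← sub_eq_add_neg, ← Finset.sum_sub_distrib]
  congr 1
  refine Finset.sum_congr rfl fun i _ => ?_
  rw [← Finset.sum_sub_distrib]
  refine Finset.sum_congr rfl fun k _ => ?_
  -- The sign (-1)^i is exactly what moves e_k from the front into the vacated slot `i`.
  rw [(hφ.isMultilin_nabla2 _ _ Z).neg_one_pow_mul_cons fun m i j h => hφ.nabla2_swap_left _ _ m Z h,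
    (hφ.isMultilin_nabla2 _ _ Z).neg_one_pow_mul_cons fun m i j h => hφ.nabla2_swap_left _ _ m Z h,
    nabla2_sub_swap hφ, elim_update_left]

/-- Only the first `p` slots are contracted with e_k, but the curvature acts on all p + q slots. So
one application of ρ(E_α) runs over the first factor and the other over both. -/
theorem hodgeLaplacian_eq {φ : TensorField n M p q} (hφ : IsForm φ) (B : CurvatureEigenbasis n x)
    (Y : Fin p → TangentSpace (𝓡 n) x) (Z : Fin q → TangentSpace (𝓡 n) x) :
    hodgeLaplacian φ x Y Z = connectionLaplacian φ x Y Z - ∑ i, ∑ α, B.eigenvalue α *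
      derivation (fun v => -rho (B.basis α) v) (flat φ x)
        (Function.update (Sum.elim Y Z) (Sum.inl i) (-rho (B.basis α) (Y i))) := by
  cases p with
  | zero =>
    simp only [Finset.univ_eq_empty, Finset.sum_empty, sub_zero]
    change codiff (extD φ) x Y Z = _
    rw [codiff, connectionLaplacian]
    refine congrArg Neg.neg (Finset.sum_congr rfl fun k _ => ?_)
    rw [nabla_extD hφ, Fin.sum_univ_one]
    simp only [Fin.val_zero, pow_zero, one_mul, Fin.cons_zero]
    congr 1
  | succ p =>
    rw [hodgeLaplacian_succ_eq hφ, sub_eq_add_neg, ← Finset.sum_neg_distrib]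
    congr 1
    refine Finset.sum_congr rfl fun i _ => ?_
    exact sum_derivation_eq (hφ.tensor.multilin x) (curvature x) B.basis B.eigenvalue
      (curvature_eq_sum_rho B) (Sum.elim Y Z) (Sum.inl i)

theorem hodgeLaplacianTilde_eq_transpose (φ : TensorField n M p q) :
    hodgeLaplacianTilde φ = transpose (hodgeLaplacian (transpose φ)) := by
  cases q <;> rfl

theorem connectionLaplacian_transpose (φ : TensorField n M p q)
    (Y : Fin p → TangentSpace (𝓡 n) x) (Z : Fin q → TangentSpace (𝓡 n) x) :
    connectionLaplacian (transpose φ) x Z Y = connectionLaplacian φ x Y Z := by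
  simp only [connectionLaplacian, nabla2_transpose]

theorem hodgeLaplacianTilde_eq {φ : TensorField n M p q} (hφ : IsForm φ)
    (B : CurvatureEigenbasis n x)
    (Y : Fin p → TangentSpace (𝓡 n) x) (Z : Fin q → TangentSpace (𝓡 n) x) :
    hodgeLaplacianTilde φ x Y Z = connectionLaplacian φ x Y Z - ∑ j, ∑ α, B.eigenvalue α *
      derivation (fun v => -rho (B.basis α) v) (flat φ x)
        (Function.update (Sum.elim Y Z) (Sum.inr j) (-rho (B.basis α) (Z j))) := by
  rw [hodgeLaplacianTilde_eq_transpose]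
  change hodgeLaplacian (transpose φ) x Z Y = _
  rw [hodgeLaplacian_eq hφ.transpose B, connectionLaplacian_transpose]
  congr 1
  refine Finset.sum_congr rfl fun j _ => Finset.sum_congr rfl fun α _ => ?_
  congr 1
  rw [← elim_update_left, Sum.update_elim_inr, ← rhoD_field, ← rhoD_field]
  simp only [rhoD, transpose]
  ring

/-- The Weitzenböck formula. -/
theorem lichnerowiczLaplacian_eq (B : ∀ x : M, CurvatureEigenbasis n x) {φ : TensorField n M p q}
    (hφ : IsForm φ) : lichnerowiczLaplacian B φ =
      (1 / 2 : ℝ) • (hodgeLaplacian φ + hodgeLaplacianTilde φ) := by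
  funext x Y Z
  change connectionLaplacian φ x Y Z + (1 / 2 : ℝ) * ricL B φ x Y Z =
    (1 / 2 : ℝ) * (hodgeLaplacian φ x Y Z + hodgeLaplacianTilde φ x Y Z)
  rw [hodgeLaplacian_eq hφ (B x), hodgeLaplacianTilde_eq hφ (B x), ricL, Finset.sum_comm,
    Finset.sum_comm (s := Finset.univ (α := Fin q))]
  -- The outer derivation splits into the slots of the two factors; the two parts are the curvature
  -- terms of Δ and Δ̃, while ∇*∇ occurs in each.
  have h : ∀ α, rhoD ((B x).basis α) (rhoD ((B x).basis α) (φ x)) Y Z =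
      (∑ i, derivation (fun v => -rho ((B x).basis α) v) (flat φ x)
        (Function.update (Sum.elim Y Z) (Sum.inl i) (-rho ((B x).basis α) (Y i)))) +
      ∑ j, derivation (fun v => -rho ((B x).basis α) v) (flat φ x)
        (Function.update (Sum.elim Y Z) (Sum.inr j) (-rho ((B x).basis α) (Z j))) := by
    intro α
    rw [rhoD]
    simp only [rhoD_eq, ← Sum.update_elim_inl, ← Sum.update_elim_inr]
    rfl
  simp only [h, ← Finset.mul_sum, mul_add, Finset.sum_add_distrib]
  ring

end Weitzenbock

/-! ### Coordinate fields and the volume density -/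

section Charts

variable {n : ℕ} {M : Type*} [TopologicalSpace M] [ChartedSpace (EuclideanSpace ℝ (Fin n)) M]
  [IsManifold (𝓡 n) ∞ M] {x₀ y : M}

/-- The vector field with constant components `a` in the chart at `x₀`. -/
def coordField (x₀ : M) (a : EuclideanSpace ℝ (Fin n)) : VField n M := fun y =>
  (trivializationAt (EuclideanSpace ℝ (Fin n)) (TangentSpace (𝓡 n)) x₀).symmL ℝ y a

/-- The components of a tangent vector in the chart at `x₀`. -/
def coordOf (x₀ y : M) : TangentSpace (𝓡 n) y →L[ℝ] EuclideanSpace ℝ (Fin n) :=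
  (trivializationAt (EuclideanSpace ℝ (Fin n)) (TangentSpace (𝓡 n)) x₀).continuousLinearMapAt ℝ y

theorem mem_baseSet (hy : y ∈ (extChartAt (𝓡 n) x₀).source) :
    y ∈ (trivializationAt (EuclideanSpace ℝ (Fin n)) (TangentSpace (𝓡 n)) x₀).baseSet := by
  rw [TangentBundle.trivializationAt_baseSet]
  rwa [extChartAt_source] at hy

theorem coordField_coordOf (hy : y ∈ (extChartAt (𝓡 n) x₀).source) (v : TangentSpace (𝓡 n) y) :
    coordField x₀ (coordOf x₀ y v) y = v :=
  Bundle.Trivialization.symmL_continuousLinearMapAt _ (mem_baseSet hy) v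

theorem coordOf_coordField (hy : y ∈ (extChartAt (𝓡 n) x₀).source)
    (a : EuclideanSpace ℝ (Fin n)) : coordOf x₀ y (coordField x₀ a y) = a :=
  Bundle.Trivialization.continuousLinearMapAt_symmL _ (mem_baseSet hy) a

theorem SmoothField.of_eventually_mem {s : Set M} (hs : IsOpen s) {Y : VField n M}
    (h : ∀ y ∈ s, ContMDiffAt (𝓡 n) (𝓡 n).tangent ∞
      (fun z => (⟨z, Y z⟩ : TangentBundle (𝓡 n) M)) y) (hy : y ∈ s) : SmoothField Y y := by
  filter_upwards [hs.mem_nhds hy] with z hz using h z hz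

theorem smoothField_coordField (hy : y ∈ (extChartAt (𝓡 n) x₀).source)
    (a : EuclideanSpace ℝ (Fin n)) : SmoothField (coordField x₀ a) y := by
  refine SmoothField.of_eventually_mem (isOpen_extChartAt_source x₀) (fun z hz => ?_) hy
  rw [Bundle.Trivialization.contMDiffAt_section_iff
    (trivializationAt (EuclideanSpace ℝ (Fin n)) (TangentSpace (𝓡 n)) x₀) (mem_baseSet hz)]
  refine (contMDiffAt_const (c := a)).congr_of_eventuallyEq ?_
  filter_upwards [(isOpen_extChartAt_source x₀).mem_nhds hz] with w hw
  have h := coordOf_coordField hw a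
  rwa [coordOf, Bundle.Trivialization.continuousLinearMapAt_apply_of_mem _ _ (mem_baseSet hw)] at h

theorem contMDiffAt_coordOf {X : VField n M} (hy : y ∈ (extChartAt (𝓡 n) x₀).source)
    (hX : SmoothField X y) : ContMDiffAt (𝓡 n) 𝓘(ℝ, EuclideanSpace ℝ (Fin n)) ∞
      (fun z => coordOf x₀ z (X z)) y := by
  have h := hX.contMDiffAt
  rw [Bundle.Trivialization.contMDiffAt_section_iff
    (trivializationAt (EuclideanSpace ℝ (Fin n)) (TangentSpace (𝓡 n)) x₀) (mem_baseSet hy)] at h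
  refine h.congr_of_eventuallyEq ?_
  filter_upwards [(isOpen_extChartAt_source x₀).mem_nhds hy] with w hw
  rw [coordOf, Bundle.Trivialization.continuousLinearMapAt_apply_of_mem _ _ (mem_baseSet hw)]

theorem smoothFn_coordOf {X : VField n M} (hy : y ∈ (extChartAt (𝓡 n) x₀).source)
    (hX : SmoothField X y) (j : Fin n) : SmoothFn n (fun z => coordOf x₀ z (X z) j) y := by
  filter_upwards [hX.eventually, (isOpen_extChartAt_source x₀).mem_nhds hy] with z h1 h2
  exact ((EuclideanSpace.proj (𝕜 := ℝ) j).contDiff.contMDiff.contMDiffAt).comp z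
    (contMDiffAt_coordOf h2 h1)

theorem coordField_symm {u : EuclideanSpace ℝ (Fin n)} (hu : u ∈ (extChartAt (𝓡 n) x₀).target)
    (a : EuclideanSpace ℝ (Fin n)) : coordField x₀ a ((extChartAt (𝓡 n) x₀).symm u) =
      mfderiv (𝓡 n) (𝓡 n) (extChartAt (𝓡 n) x₀).symm u a := by
  have hs : (extChartAt (𝓡 n) x₀).symm u ∈ (chartAt (EuclideanSpace ℝ (Fin n)) x₀).source := by
    rw [← extChartAt_source (𝓡 n)]
    exact (extChartAt (𝓡 n) x₀).map_target hu
  have h := TangentBundle.symmL_trivializationAt (I := 𝓡 n) (𝕜 := ℝ) hs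
  -- The base point appears as chart(chart⁻¹(u)), on which the type of the derivative depends, so
  -- the replacement by `u` is made for a variable point.
  have h1 : ∀ u', u' = u → ((mfderivWithin (𝓡 n) (𝓡 n) (extChartAt (𝓡 n) x₀).symm
      (Set.range (𝓡 n)) u' a : EuclideanSpace ℝ (Fin n)) =
      mfderiv (𝓡 n) (𝓡 n) (extChartAt (𝓡 n) x₀).symm u a) := by
    rintro _ rfl
    simp [mfderivWithin_univ]
  have h2 := congrArg (fun L : EuclideanSpace ℝ (Fin n) →L[ℝ] EuclideanSpace ℝ (Fin n) => L a) h
  exact h2.trans (h1 _ ((extChartAt (𝓡 n) x₀).right_inv hu))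

theorem mdifferentiableAt_symm {u : EuclideanSpace ℝ (Fin n)}
    (hu : u ∈ (extChartAt (𝓡 n) x₀).target) :
    MDifferentiableAt (𝓡 n) (𝓡 n) (extChartAt (𝓡 n) x₀).symm u := by
  have := mdifferentiableWithinAt_extChartAt_symm (I := 𝓡 n) hu
  simpa [mdifferentiableWithinAt_univ] using this

theorem contMDiffAt_symm {u : EuclideanSpace ℝ (Fin n)}
    (hu : u ∈ (extChartAt (𝓡 n) x₀).target) :
    ContMDiffAt (𝓡 n) (𝓡 n) ∞ (extChartAt (𝓡 n) x₀).symm u :=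
  (contMDiffOn_extChartAt_symm x₀).contMDiffAt
    ((isOpen_extChartAt_target x₀).mem_nhds hu)

theorem dfn_coordField {u : EuclideanSpace ℝ (Fin n)} (hu : u ∈ (extChartAt (𝓡 n) x₀).target)
    (a : EuclideanSpace ℝ (Fin n)) {g : M → ℝ}
    (hg : MDifferentiableAt (𝓡 n) 𝓘(ℝ, ℝ) g ((extChartAt (𝓡 n) x₀).symm u)) :
    dfn n g ((extChartAt (𝓡 n) x₀).symm u) (coordField x₀ a ((extChartAt (𝓡 n) x₀).symm u)) =
      fderiv ℝ (g ∘ (extChartAt (𝓡 n) x₀).symm) u a := by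
  rw [coordField_symm hu, ← mfderiv_eq_fderiv,
    mfderiv_comp u hg (mdifferentiableAt_symm hu)]
  rfl

theorem smoothFn_chart (hy : y ∈ (extChartAt (𝓡 n) x₀).source) (j : Fin n) :
    SmoothFn n (fun z => extChartAt (𝓡 n) x₀ z j) y := by
  filter_upwards [(isOpen_extChartAt_source x₀).mem_nhds hy] with z hz
  exact ((EuclideanSpace.proj (𝕜 := ℝ) j).contDiff.contMDiff.contMDiffAt).comp z
    (contMDiffAt_extChartAt' (by rwa [← extChartAt_source (𝓡 n)]))

theorem dfn_chart (hy : y ∈ (extChartAt (𝓡 n) x₀).source) (j : Fin n)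
    (v : TangentSpace (𝓡 n) y) :
    dfn n (fun z => extChartAt (𝓡 n) x₀ z j) y v = coordOf x₀ y v j := by
  obtain ⟨u, hu, rfl⟩ : ∃ u ∈ (extChartAt (𝓡 n) x₀).target, (extChartAt (𝓡 n) x₀).symm u = y :=
    ⟨_, (extChartAt (𝓡 n) x₀).map_source hy, (extChartAt (𝓡 n) x₀).left_inv hy⟩
  conv_lhs => rw [← coordField_coordOf hy v]
  rw [dfn_coordField hu _ (smoothFn_chart hy j).mdiff]
  have h : (fun z => extChartAt (𝓡 n) x₀ z j) ∘ (extChartAt (𝓡 n) x₀).symm =ᶠ[𝓝 u]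
      EuclideanSpace.proj (𝕜 := ℝ) j := by
    filter_upwards [(isOpen_extChartAt_target x₀).mem_nhds hu] with w hw
    change extChartAt (𝓡 n) x₀ ((extChartAt (𝓡 n) x₀).symm w) j = w j
    rw [(extChartAt (𝓡 n) x₀).right_inv hw]
  rw [h.fderiv_eq, ContinuousLinearMap.fderiv]
  rfl

/-- The components of a vector are its derivatives of the coordinate functions. The bracket acts as
a commutator, and the derivatives of coordinate functions along coordinate fields are constant. -/
theorem bracket_coordField (hy : y ∈ (extChartAt (𝓡 n) x₀).source)
    (a b : EuclideanSpace ℝ (Fin n)) :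
    VectorField.mlieBracket (𝓡 n) (coordField x₀ a) (coordField x₀ b) y = 0 := by
  have h0 : coordOf x₀ y
      (VectorField.mlieBracket (𝓡 n) (coordField x₀ a) (coordField x₀ b) y) = 0 := by
    ext j
    have hc : ∀ c : EuclideanSpace ℝ (Fin n), ∀ᶠ z in 𝓝 y,
        dfn n (fun z => extChartAt (𝓡 n) x₀ z j) z (coordField x₀ c z) = c j := by
      intro c
      filter_upwards [(isOpen_extChartAt_source x₀).mem_nhds hy] with z hz
      rw [dfn_chart hz, coordOf_coordField hz]
    rw [← dfn_chart hy, dfn_bracket (smoothField_coordField hy a) (smoothField_coordField hy b)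
      (smoothFn_chart hy j), dfn_congr (hc b), dfn_congr (hc a), dfn_const, dfn_const]
    simp
  rw [← coordField_coordOf hy (VectorField.mlieBracket _ _ _ y), h0, coordField, map_zero]

variable [RiemannianBundle (fun x : M => TangentSpace (𝓡 n) x)]

/-- The Gram matrix of the coordinate fields of the chart at `x₀`. -/
def gram (n : ℕ) {M : Type*} [TopologicalSpace M] [ChartedSpace (EuclideanSpace ℝ (Fin n)) M]
    [IsManifold (𝓡 n) ∞ M] [RiemannianBundle (fun x : M => TangentSpace (𝓡 n) x)] (x₀ y : M) : Matrix (Fin n) (Fin n) ℝ := Matrix.of fun i j =>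
  inner ℝ (coordField x₀ (EuclideanSpace.single i (1 : ℝ)) y)
    (coordField x₀ (EuclideanSpace.single j (1 : ℝ)) y)

/-- The volume density of the chart at `x₀`, as a function on the manifold. -/
def density (n : ℕ) {M : Type*} [TopologicalSpace M] [ChartedSpace (EuclideanSpace ℝ (Fin n)) M]
    [IsManifold (𝓡 n) ∞ M] [RiemannianBundle (fun x : M => TangentSpace (𝓡 n) x)] (x₀ y : M) : ℝ := √(gram n x₀ y).det

theorem chartDensity_eq {u : EuclideanSpace ℝ (Fin n)} (hu : u ∈ (extChartAt (𝓡 n) x₀).target) :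
    chartDensity x₀ u = density n x₀ ((extChartAt (𝓡 n) x₀).symm u) := by
  rw [chartDensity, density, gram]
  simp only [coordField_symm hu]

theorem coordField_eq_sum (a : EuclideanSpace ℝ (Fin n)) (y : M) :
    coordField x₀ a y = ∑ i, a i • coordField x₀ (EuclideanSpace.single i (1 : ℝ)) y := by
  have h : a = ∑ i, a i • EuclideanSpace.single i (1 : ℝ) := by
    ext j; simp [Finset.sum_apply, Pi.single_apply]
  conv_lhs => rw [h]
  simp only [coordField, map_sum, map_smul]

/-- The coefficients of the coordinate fields with respect to an orthonormal basis. -/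
def coeffMatrix (x₀ y : M) (b : Fin n → TangentSpace (𝓡 n) y) : Matrix (Fin n) (Fin n) ℝ :=
  Matrix.of fun i k => inner ℝ (coordField x₀ (EuclideanSpace.single i (1 : ℝ)) y) (b k)

/-- The Gram matrix is A Aᵀ, with A the coefficients in an orthonormal basis. The determinant of A
is easier to differentiate and to transform than the square root. -/
theorem density_eq_abs_det (b : OrthonormalBasis (Fin n) ℝ (TangentSpace (𝓡 n) y)) :
    density n x₀ y = |(coeffMatrix x₀ y b).det| := by
  have h : gram n x₀ y = coeffMatrix x₀ y b * (coeffMatrix x₀ y b).transpose := by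
    ext i j
    rw [Matrix.mul_apply, gram, Matrix.of_apply, ← b.sum_inner_mul_inner]
    refine Finset.sum_congr rfl fun k _ => ?_
    rw [Matrix.transpose_apply, coeffMatrix, Matrix.of_apply, Matrix.of_apply,
      real_inner_comm _ (b k)]
  rw [density, h, Matrix.det_mul, Matrix.det_transpose, Real.sqrt_mul_self_eq_abs]

theorem det_coeffMatrix_ne_zero (hy : y ∈ (extChartAt (𝓡 n) x₀).source)
    (b : OrthonormalBasis (Fin n) ℝ (TangentSpace (𝓡 n) y)) : (coeffMatrix x₀ y b).det ≠ 0 := by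
  intro h
  obtain ⟨a, ha, h0⟩ := Matrix.exists_vecMul_eq_zero_iff.2 h
  refine ha ?_
  have h1 : coordField x₀ (WithLp.toLp 2 a) y = 0 := by
    rw [← orthonormalBasis_sum_inner b (coordField _ _ y)]
    refine Finset.sum_eq_zero fun k _ => ?_
    rw [coordField_eq_sum, sum_inner]
    convert zero_smul ℝ (b k)
    have := congrFun h0 k
    rw [Matrix.vecMul, dotProduct] at this
    simpa [real_inner_smul_left, coeffMatrix] using this
  have h2 := coordOf_coordField hy (WithLp.toLp 2 a)
  rw [h1, map_zero] at h2
  funext i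
  exact (congrArg (fun v : EuclideanSpace ℝ (Fin n) => v i) h2).symm

theorem orthonormalBasis_fin (y : M) :
    Nonempty (OrthonormalBasis (Fin n) ℝ (TangentSpace (𝓡 n) y)) :=
  ⟨(stdOrthonormalBasis ℝ (TangentSpace (𝓡 n) y)).reindex (finCongr (finrank_tangent y))⟩

theorem density_pos (hy : y ∈ (extChartAt (𝓡 n) x₀).source) : 0 < density n x₀ y := by
  obtain ⟨b⟩ := orthonormalBasis_fin (n := n) y
  rw [density_eq_abs_det b]
  exact abs_pos.2 (det_coeffMatrix_ne_zero hy b)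

end Charts

/-! ### Derivatives of products and determinants -/

section Determinant

variable {n : ℕ} {M : Type*} [TopologicalSpace M] [ChartedSpace (EuclideanSpace ℝ (Fin n)) M]
  {x : M} {κ : Type*} [DecidableEq κ]

theorem SmoothFn.prod {s : Finset κ} {f : κ → M → ℝ} (h : ∀ i, SmoothFn n (f i) x) :
    SmoothFn n (fun y => ∏ i ∈ s, f i y) x := by
  induction s using Finset.induction_on with
  | empty => simpa using SmoothFn.const 1
  | insert a s ha ih =>
    simp only [Finset.prod_insert ha]
    exact (h a).mul ih

theorem dfn_prod (s : Finset κ) {f : κ → M → ℝ} (h : ∀ i, SmoothFn n (f i) x)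
    (v : TangentSpace (𝓡 n) x) : dfn n (fun y => ∏ i ∈ s, f i y) x v =
      ∑ i ∈ s, dfn n (f i) x v * ∏ j ∈ s.erase i, f j x := by
  induction s using Finset.induction_on with
  | empty => simpa using dfn_const 1 v
  | insert a s ha ih =>
    simp only [Finset.prod_insert ha]
    have h1 : ∀ i ∈ s, dfn n (f i) x v * ∏ j ∈ (insert a s).erase i, f j x =
        f a x * (dfn n (f i) x v * ∏ j ∈ s.erase i, f j x) := fun i hi => by
      have hia : a ≠ i := fun h => ha (h ▸ hi)
      rw [Finset.erase_insert_of_ne hia, Finset.prod_insert fun h => ha (Finset.mem_of_mem_erase h)]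
      ring
    rw [dfn_mul (h a) (SmoothFn.prod h), ih, Finset.sum_insert ha, Finset.erase_insert ha,
      Finset.sum_congr rfl h1, ← Finset.mul_sum]

variable [Fintype κ]

theorem SmoothFn.det {F : κ → κ → M → ℝ} (h : ∀ i j, SmoothFn n (F i j) x) :
    SmoothFn n (fun y => (Matrix.of fun i j => F i j y).det) x := by
  simp only [Matrix.det_apply']
  exact SmoothFn.sum fun σ _ => (SmoothFn.const _).mul (SmoothFn.prod fun i => h (σ i) i)

/-- The Leibniz rule for each product in the determinant expansion, regrouped by columns. Columns
suit the application, where they correspond to the frame vectors. -/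
theorem dfn_det {F : κ → κ → M → ℝ} (h : ∀ i j, SmoothFn n (F i j) x)
    (v : TangentSpace (𝓡 n) x) : dfn n (fun y => (Matrix.of fun i j => F i j y).det) x v =
      ∑ k, ((Matrix.of fun i j => F i j x).updateCol k fun i => dfn n (F i k) x v).det := by
  simp only [Matrix.det_apply']
  rw [dfn_sum fun σ _ => (SmoothFn.const _).mul (SmoothFn.prod fun i => h (σ i) i), Finset.sum_comm]
  refine Finset.sum_congr rfl fun σ _ => ?_
  simp only [Matrix.of_apply]
  rw [dfn_const_mul _ (SmoothFn.prod fun i => h (σ i) i), dfn_prod _ fun i => h (σ i) i, Finset.mul_sum]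
  refine Finset.sum_congr rfl fun k _ => ?_
  rw [← Finset.mul_prod_erase _ _ (Finset.mem_univ k)]
  simp only [Matrix.updateCol_apply, if_true]
  congr 2
  refine Finset.prod_congr rfl fun j hj => ?_
  rw [if_neg (Finset.ne_of_mem_erase hj)]
  rfl

end Determinant

/-! ### Divergence and the logarithmic derivative of the density -/

section Density

variable {n : ℕ} {M : Type*} [TopologicalSpace M] [ChartedSpace (EuclideanSpace ℝ (Fin n)) M]
  [IsManifold (𝓡 n) ∞ M] [RiemannianBundle (fun x : M => TangentSpace (𝓡 n) x)]
  [IsContMDiffRiemannianBundle (𝓡 n) ∞ (EuclideanSpace ℝ (Fin n))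
      (fun x : M => TangentSpace (𝓡 n) x)] {x₀ x : M}

/-- The divergence of a vector field. -/
def divergence (X : VField n M) (x : M) : ℝ :=
  ∑ k, inner ℝ (leviCivita X x (frame x k)) (frame x k)

theorem divergence_eq {X : VField n M} (hX : SmoothField X x) {ν : Type*} [Fintype ν]
    (b : OrthonormalBasis ν ℝ (TangentSpace (𝓡 n) x)) :
    divergence X x = ∑ k, inner ℝ (leviCivita X x (b k)) (b k) := by
  have h1 := (LinearMap.trace_eq_sum_inner (leviCivitaHom hX) (frameBasis x)).symm.trans
    (LinearMap.trace_eq_sum_inner (leviCivitaHom hX) b)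
  have h2 : ∀ w : TangentSpace (𝓡 n) x, leviCivita X x w = leviCivitaHom hX w := fun _ => rfl
  simp only [divergence, h2, real_inner_comm]
  exact h1

theorem divergence_smul {f : M → ℝ} {X : VField n M} (hf : SmoothFn n f x) (hX : SmoothField X x) :
    divergence (fun y => f y • X y) x = dfn n f x (X x) + f x * divergence X x := by
  simp only [divergence, leviCivita_smul hf hX, inner_add_left, real_inner_smul_left,
    Finset.sum_add_distrib, Finset.mul_sum]
  congr 1
  conv_rhs => rw [← orthonormalBasis_sum_inner (frameBasis x) (X x), dfn, map_sum]
  refine Finset.sum_congr rfl fun k _ => ?_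
  rw [map_smul, smul_eq_mul, mul_comm, frameBasis_apply]
  rfl

theorem divergence_sum {κ : Type*} (s : Finset κ) {X : κ → VField n M}
    (hX : ∀ i, SmoothField (X i) x) :
    divergence (fun y => ∑ i ∈ s, X i y) x = ∑ i ∈ s, divergence (X i) x := by
  simp only [divergence, leviCivita_sum s hX, sum_inner]
  rw [Finset.sum_comm]

theorem divergence_congr {X Y : VField n M} (h : ∀ᶠ y in 𝓝 x, X y = Y y) :
    divergence X x = divergence Y x := by
  simp only [divergence, leviCivita_congr h]

/-- Let A be the matrix of the coordinate fields in an orthonormal frame. Coordinate fields commute,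
so ∇_{∂_a} ∂_i = ∇_{∂_i} ∂_a, and A has derivative A·B along ∂_a, where tr B = div ∂_a. Hence det A
has logarithmic derivative div ∂_a. -/
theorem smoothFn_density (hx : x ∈ (extChartAt (𝓡 n) x₀).source) :
    SmoothFn n (density n x₀) x ∧ ∀ a, dfn n (density n x₀) x (coordField x₀ a x) =
      density n x₀ x * divergence (coordField x₀ a) x := by
  obtain ⟨E, hE, hb⟩ := exists_orthonormal_frame (n := n) x
  obtain ⟨b, hbx⟩ := hb.self_of_nhds
  let c : Fin n → VField n M := fun i => coordField x₀ (EuclideanSpace.single i (1 : ℝ))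
  have hc : ∀ i, SmoothField (c i) x := fun i => smoothField_coordField hx _
  let F : Fin n → Fin n → M → ℝ := fun i k y => inner ℝ (c i y) (E k y)
  have hF : ∀ i k, SmoothFn n (F i k) x := fun i k => (hc i).inner (hE k)
  let D : M → ℝ := fun y => (Matrix.of fun i k => F i k y).det
  have hD : SmoothFn n D x := SmoothFn.det hF
  have hdens : ∀ᶠ y in 𝓝 x, density n x₀ y = |D y| := by
    filter_upwards [hb] with y ⟨b, hb⟩
    rw [density_eq_abs_det b]
    simp only [D, F, coeffMatrix, hb, c]
  have hD0 : D x ≠ 0 := by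
    have := det_coeffMatrix_ne_zero hx b
    simpa only [coeffMatrix, hbx] using this
  -- The determinant is continuous and nonzero at `x`, so its absolute value is locally a fixed sign
  -- times it; this removes the only nonsmooth operation.
  obtain ⟨s, hs⟩ : ∃ s : ℝ, ∀ᶠ y in 𝓝 x, density n x₀ y = s * D y := by
    have hcont := hD.contMDiffAt.continuousAt
    rcases lt_or_gt_of_ne hD0 with h | h
    · refine ⟨-1, ?_⟩
      filter_upwards [hdens, hcont.eventually (gt_mem_nhds h)] with y h1 h2
      rw [h1, abs_of_neg h2]; ring
    · refine ⟨1, ?_⟩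
      filter_upwards [hdens, hcont.eventually (lt_mem_nhds h)] with y h1 h2
      rw [h1, abs_of_pos h2]; ring
  refine ⟨((SmoothFn.const s).mul hD).congr hs, fun a => ?_⟩
  rw [dfn_congr hs, dfn_const_mul _ hD, hs.self_of_nhds, mul_assoc]
  congr 1
  have ha := smoothField_coordField hx a
  set v := coordField x₀ a x with hv
  have hdF : ∀ i k, dfn n (F i k) x v = ∑ l, (inner ℝ (leviCivita (E k) x v) (E l x) +
      inner ℝ (E k x) (leviCivita (coordField x₀ a) x (E l x))) * F i l x := by
    intro i k
    have h1 : leviCivita (c i) x v = leviCivita (coordField x₀ a) x (c i x) := by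
      have := leviCivita_sub_swap ha (hc i)
      rw [bracket_coordField hx] at this
      exact sub_eq_zero.1 this
    have h2 : c i x = ∑ l, F i l x • E l x := by
      have := orthonormalBasis_sum_inner b (c i x)
      simp only [hbx] at this
      exact this.symm
    have h3 : leviCivita (coordField x₀ a) x (c i x) =
        ∑ l, F i l x • leviCivita (coordField x₀ a) x (E l x) := by
      have h4 := map_sum (leviCivitaHom ha) (fun l => F i l x • E l x) Finset.univ
      rw [← h2] at h4
      simp only [map_smul] at h4
      exact h4
    have h5 : (inner ℝ (c i x) (leviCivita (E k) x v) : ℝ) =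
        ∑ l, F i l x * inner ℝ (leviCivita (E k) x v) (E l x) := by
      rw [h2, sum_inner]
      refine Finset.sum_congr rfl fun l _ => ?_
      rw [real_inner_smul_left, real_inner_comm]
    rw [dfn_inner (hc i) (hE k) v, h1, h3, h5, sum_inner, ← Finset.sum_add_distrib]
    refine Finset.sum_congr rfl fun l _ => ?_
    rw [real_inner_smul_left, real_inner_comm (E k x)]
    ring
  rw [dfn_det hF, divergence_eq ha b, mul_comm, Finset.sum_mul]
  refine Finset.sum_congr rfl fun k _ => ?_
  -- The derivative of column `k` is a combination of the columns, and replacing column `k` by it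
  -- multiplies the determinant by the k-th coefficient.
  have h6 := Matrix.det_updateCol_sum (Matrix.of fun i k => F i k x) k fun l =>
    inner ℝ (leviCivita (E k) x v) (E l x) +
      inner ℝ (E k x) (leviCivita (coordField x₀ a) x (E l x))
  -- |E_k|² is constant, so the motion of the frame contributes nothing to the diagonal
  -- coefficients.
  have h7 : (inner ℝ (leviCivita (E k) x v) (E k x) : ℝ) = 0 := by
    have h8 := dfn_inner (hE k) (hE k) v
    have h9 : ∀ᶠ y in 𝓝 x, (inner ℝ (E k y) (E k y) : ℝ) = 1 := by
      filter_upwards [hb] with y ⟨b, hb⟩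
      rw [← hb, orthonormal_iff_ite.1 b.orthonormal k k, if_pos rfl]
    rw [dfn_congr h9, dfn_const, real_inner_comm (leviCivita (E k) x v)] at h8
    linarith
  simp only [smul_eq_mul, Matrix.of_apply] at h6
  simp only [hdF]
  rw [h6, h7, zero_add, hbx, real_inner_comm]

end Density

/-! ### The Riemannian measure and its restriction to charts -/

section Volume

open MeasureTheory

variable {n : ℕ} {M : Type*} [TopologicalSpace M] [ChartedSpace (EuclideanSpace ℝ (Fin n)) M]
  [IsManifold (𝓡 n) ∞ M] [RiemannianBundle (fun x : M => TangentSpace (𝓡 n) x)]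
  {x₀ x y : M}

theorem coordField_change {u : EuclideanSpace ℝ (Fin n)}
    (hu : u ∈ (extChartAt (𝓡 n) x).target)
    (hy : (extChartAt (𝓡 n) x).symm u ∈ (extChartAt (𝓡 n) y).source)
    {L : EuclideanSpace ℝ (Fin n) →L[ℝ] EuclideanSpace ℝ (Fin n)}
    (hL : HasFDerivAt (extChartAt (𝓡 n) y ∘ (extChartAt (𝓡 n) x).symm) L u)
    (a : EuclideanSpace ℝ (Fin n)) :
    coordField x a ((extChartAt (𝓡 n) x).symm u) =
      coordField y (L a) ((extChartAt (𝓡 n) x).symm u) := by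
  rw [← coordField_coordOf hy (coordField x a _)]
  congr 1
  ext j
  rw [← dfn_chart hy, dfn_coordField hu _ (smoothFn_chart hy j).mdiff]
  have h := ((EuclideanSpace.proj (𝕜 := ℝ) j).hasFDerivAt).comp u hL
  exact congrArg (fun L : EuclideanSpace ℝ (Fin n) →L[ℝ] ℝ => L a) h.fderiv

/-- By the chain rule the coefficient matrices of the two charts differ by the transposed Jacobian,
so their determinants differ by its determinant. -/
theorem density_change {u : EuclideanSpace ℝ (Fin n)}
    (hu : u ∈ (extChartAt (𝓡 n) x).target)
    (hy : (extChartAt (𝓡 n) x).symm u ∈ (extChartAt (𝓡 n) y).source)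
    {L : EuclideanSpace ℝ (Fin n) →L[ℝ] EuclideanSpace ℝ (Fin n)}
    (hL : HasFDerivAt (extChartAt (𝓡 n) y ∘ (extChartAt (𝓡 n) x).symm) L u) :
    density n x ((extChartAt (𝓡 n) x).symm u) =
      |L.det| * density n y ((extChartAt (𝓡 n) x).symm u) := by
  obtain ⟨b⟩ := orthonormalBasis_fin (n := n) ((extChartAt (𝓡 n) x).symm u)
  let e := (EuclideanSpace.basisFun (Fin n) ℝ).toBasis
  have hdet : L.det = (LinearMap.toMatrix e e L.toLinearMap).transpose.det := by
    rw [Matrix.det_transpose, LinearMap.det_toMatrix]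
  have h : coeffMatrix x _ b =
      (LinearMap.toMatrix e e L.toLinearMap).transpose * coeffMatrix y _ b := by
    ext i k
    rw [Matrix.mul_apply, coeffMatrix, Matrix.of_apply, coordField_change hu hy hL,
      coordField_eq_sum, sum_inner]
    refine Finset.sum_congr rfl fun l _ => ?_
    rw [real_inner_smul_left, coeffMatrix, Matrix.of_apply, Matrix.transpose_apply,
      LinearMap.toMatrix_apply]
    simp [e]
  rw [density_eq_abs_det b, density_eq_abs_det b, h, Matrix.det_mul, abs_mul, hdet]

variable [MeasurableSpace M] [BorelSpace M]

theorem measurableSet_target_inter {A : Set M} (hA : MeasurableSet A) :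
    MeasurableSet ((extChartAt (𝓡 n) x).target ∩ (extChartAt (𝓡 n) x).symm ⁻¹' A) := by
  have hT := (isOpen_extChartAt_target (I := 𝓡 n) x).measurableSet
  have h := ((continuousOn_extChartAt_symm (I := 𝓡 n) x).domRestrict.measurable hA)
  have := hT.subtype_image h
  convert this
  ext u
  simp [and_comm]

theorem chartVolume_apply {A : Set M} (hA : MeasurableSet A) :
    chartVolume (n := n) x A =
      ∫⁻ u in (extChartAt (𝓡 n) x).target ∩ (extChartAt (𝓡 n) x).symm ⁻¹' A,
        ENNReal.ofReal (density n x ((extChartAt (𝓡 n) x).symm u)) := by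
  have hT := (isOpen_extChartAt_target (I := 𝓡 n) x).measurableSet
  have hm : AEMeasurable (extChartAt (𝓡 n) x).symm
      (volume.restrict (extChartAt (𝓡 n) x).target) :=
    (continuousOn_extChartAt_symm x).aemeasurable hT
  rw [chartVolume, Measure.map_apply_of_aemeasurable
    (hm.mono_ac (withDensity_absolutelyContinuous _ _)) hA, withDensity_apply',
    Measure.restrict_restrict' hT, Set.inter_comm]
  refine setLIntegral_congr_fun (measurableSet_target_inter hA) fun u hu => ?_
  simp only [chartDensity_eq hu.1]

theorem chartVolume_compl_source {A : Set M} (hA : MeasurableSet A)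
    (h : Disjoint A (extChartAt (𝓡 n) x).source) : chartVolume (n := n) x A = 0 := by
  rw [chartVolume_apply hA]
  have : (extChartAt (𝓡 n) x).target ∩ (extChartAt (𝓡 n) x).symm ⁻¹' A = ∅ := by
    ext u
    simp only [Set.mem_inter_iff, Set.mem_preimage, Set.mem_empty_iff_false, iff_false]
    rintro ⟨h1, h2⟩
    exact Set.disjoint_left.1 h h2 ((extChartAt (𝓡 n) x).map_target h1)
  rw [this]
  simp

/-- The volumes of two charts agree on the intersection of their domains. -/
theorem chartVolume_agree {A : Set M} (hA : MeasurableSet A)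
    (hx : A ⊆ (extChartAt (𝓡 n) x).source) (hy : A ⊆ (extChartAt (𝓡 n) y).source) :
    chartVolume (n := n) x A = chartVolume (n := n) y A := by
  rw [chartVolume_apply hA, chartVolume_apply hA]
  set s := (extChartAt (𝓡 n) x).target ∩ (extChartAt (𝓡 n) x).symm ⁻¹' A with hs
  set ψ := extChartAt (𝓡 n) y ∘ (extChartAt (𝓡 n) x).symm with hψ
  have himage : ψ '' s = (extChartAt (𝓡 n) y).target ∩ (extChartAt (𝓡 n) y).symm ⁻¹' A := by
    ext w
    constructor
    · rintro ⟨u, ⟨h1, h2⟩, rfl⟩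
      refine ⟨(extChartAt (𝓡 n) y).map_source (hy h2), ?_⟩
      simp only [hψ, Set.mem_preimage, Function.comp_apply]
      rwa [(extChartAt (𝓡 n) y).left_inv (hy h2)]
    · rintro ⟨h1, h2⟩
      refine ⟨extChartAt (𝓡 n) x ((extChartAt (𝓡 n) y).symm w),
        ⟨(extChartAt (𝓡 n) x).map_source (hx h2), ?_⟩, ?_⟩
      · simp only [Set.mem_preimage]
        rwa [(extChartAt (𝓡 n) x).left_inv (hx h2)]
      · simp only [hψ, Function.comp_apply]
        rw [(extChartAt (𝓡 n) x).left_inv (hx h2), (extChartAt (𝓡 n) y).right_inv h1]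
  have hderiv : ∀ u ∈ s, HasFDerivAt ψ (fderiv ℝ ψ u) u := by
    intro u hu
    have h1 : ContMDiffAt (𝓡 n) (𝓡 n) ∞ ψ u :=
      (contMDiffAt_extChartAt' (by
        have := hy hu.2
        rwa [extChartAt_source] at this)).comp u (contMDiffAt_symm hu.1)
    exact (h1.contDiffAt.differentiableAt (by simp)).hasFDerivAt
  have hinj : Set.InjOn ψ s := by
    intro u hu w hw h
    have h1 := (extChartAt (𝓡 n) y).injOn (hy hu.2) (hy hw.2) h
    exact (extChartAt (𝓡 n) x).symm.injOn hu.1 hw.1 h1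
  -- The Jacobian factor of this change of variables is the quotient of the two densities in
  -- `density_change`.
  rw [← himage, lintegral_image_eq_lintegral_abs_det_fderiv_mul volume
    (measurableSet_target_inter hA) (fun u hu => (hderiv u hu).hasFDerivWithinAt) hinj]
  refine setLIntegral_congr_fun (measurableSet_target_inter hA) fun u hu => ?_
  simp only [hψ, Function.comp_apply]
  rw [density_change hu.1 (hy hu.2) (hderiv u hu), ENNReal.ofReal_mul (abs_nonneg _),
    (extChartAt (𝓡 n) y).left_inv (hy hu.2)]

theorem chartVolume_le (x : M) : chartVolume (n := n) x ≤ riemannianVolume n M :=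
  le_iSup (fun x => chartVolume (n := n) x) x

theorem riemannianVolume_apply {A : Set M} (hA : MeasurableSet A)
    (h : A ⊆ (extChartAt (𝓡 n) x).source) : riemannianVolume n M A = chartVolume (n := n) x A := by
  refine le_antisymm ?_ (chartVolume_le x A)
  have hS := (isOpen_extChartAt_source (I := 𝓡 n) x).measurableSet
  -- A supremum of measures is controlled through measures that dominate the whole family. This one
  -- does: inside the chart at `x` any other chart measure agrees with that of `x` where both are
  -- defined, and outside nothing is claimed.
  have hle : riemannianVolume n M ≤ chartVolume (n := n) x +
      (riemannianVolume n M).restrict (extChartAt (𝓡 n) x).sourceᶜ := by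
    refine iSup_le fun y => Measure.le_iff.2 fun B hB => ?_
    have hSy := (isOpen_extChartAt_source (I := 𝓡 n) y).measurableSet
    rw [Measure.add_apply, Measure.restrict_apply hB, ← measure_inter_add_sdiff B hS]
    refine add_le_add ?_ (chartVolume_le y _)
    rw [← measure_inter_add_sdiff (B ∩ (extChartAt (𝓡 n) x).source) hSy,
      chartVolume_compl_source ((hB.inter hS).diff hSy) Set.disjoint_sdiff_left, add_zero,
      ← chartVolume_agree (x := x) ((hB.inter hS).inter hSy)
        (fun z hz => hz.1.2) Set.inter_subset_right]
    exact measure_mono fun z hz => hz.1.1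
  refine (hle A).trans ?_
  rw [Measure.add_apply, Measure.restrict_apply hA]
  have : A ∩ (extChartAt (𝓡 n) x).sourceᶜ = ∅ := by
    rw [← Set.sdiff_eq, Set.sdiff_eq_empty.2 h]
  rw [this, measure_empty, add_zero]

theorem restrict_riemannianVolume (x : M) :
    (riemannianVolume n M).restrict (extChartAt (𝓡 n) x).source = chartVolume (n := n) x := by
  ext A hA
  have hS := (isOpen_extChartAt_source (I := 𝓡 n) x).measurableSet
  rw [Measure.restrict_apply hA, riemannianVolume_apply (hA.inter hS) Set.inter_subset_right,
    ← measure_inter_add_sdiff A hS, chartVolume_compl_source (hA.diff hS) Set.disjoint_sdiff_left,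
    add_zero]

end Volume

/-! ### Positivity, local finiteness and the divergence theorem -/

section Volume

open MeasureTheory

variable {n : ℕ} {M : Type*} [TopologicalSpace M] [ChartedSpace (EuclideanSpace ℝ (Fin n)) M]
  [IsManifold (𝓡 n) ∞ M] [RiemannianBundle (fun x : M => TangentSpace (𝓡 n) x)]
  [IsContMDiffRiemannianBundle (𝓡 n) ∞ (EuclideanSpace ℝ (Fin n))
      (fun x : M => TangentSpace (𝓡 n) x)] {x : M}

theorem SmoothFn.contDiffAt_comp_symm {f : M → ℝ} {u : EuclideanSpace ℝ (Fin n)}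
    (hu : u ∈ (extChartAt (𝓡 n) x).target) (hf : SmoothFn n f ((extChartAt (𝓡 n) x).symm u)) :
    ContDiffAt ℝ ∞ (f ∘ (extChartAt (𝓡 n) x).symm) u :=
  (hf.contMDiffAt.comp u (contMDiffAt_symm hu)).contDiffAt

theorem continuousOn_density (x : M) :
    ContinuousOn (fun u => density n x ((extChartAt (𝓡 n) x).symm u))
      (extChartAt (𝓡 n) x).target := fun _ hu =>
  (((smoothFn_density ((extChartAt (𝓡 n) x).map_target hu)).1.contDiffAt_comp_symm
    hu).continuousAt).continuousWithinAt

variable [MeasurableSpace M] [BorelSpace M]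

/-- The density is positive on the chart target and Lebesgue measure charges nonempty open sets.
This is what lets a vanishing L² norm force pointwise vanishing. -/
instance isOpenPosMeasure_riemannianVolume :
    (riemannianVolume n M).IsOpenPosMeasure where
  open_pos U hU hne h0 := by
    obtain ⟨x, hx⟩ := hne
    have hS := isOpen_extChartAt_source (I := 𝓡 n) x
    have h1 : chartVolume (n := n) x U = 0 := le_antisymm
      ((chartVolume_le x U).trans h0.le) zero_le
    rw [chartVolume_apply hU.measurableSet] at h1
    set V := (extChartAt (𝓡 n) x).target ∩ (extChartAt (𝓡 n) x).symm ⁻¹' U with hV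
    have hVo : IsOpen V := (continuousOn_extChartAt_symm x).isOpen_inter_preimage
      (isOpen_extChartAt_target x) hU
    rw [lintegral_eq_zero_iff'] at h1
    · rw [Filter.EventuallyEq, ae_restrict_iff' hVo.measurableSet] at h1
      have h2 : volume V = 0 := by
        refine measure_mono_null ?_ h1
        intro u hu h3
        have h4 := h3 hu
        simp only [Pi.zero_apply, ENNReal.ofReal_eq_zero] at h4
        exact absurd (density_pos ((extChartAt (𝓡 n) x).map_target hu.1)) (not_lt.2 h4)
      refine (hVo.measure_pos volume ⟨extChartAt (𝓡 n) x x, ?_⟩).ne' h2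
      exact ⟨mem_extChartAt_target x, by simpa using hx⟩
    · exact (((continuousOn_density x).mono Set.inter_subset_left).aemeasurable
        hVo.measurableSet).ennreal_ofReal

/-- The density is continuous, hence integrable on a compact ball in the chart. On compact `M` all
continuous functions become integrable. -/
instance isLocallyFiniteMeasure_riemannianVolume :
    IsLocallyFiniteMeasure (riemannianVolume n M) where
  finiteAtNhds x := by
    obtain ⟨r, hr, hball⟩ := Metric.nhds_basis_closedBall.mem_iff.1
      ((isOpen_extChartAt_target (I := 𝓡 n) x).mem_nhds (mem_extChartAt_target x))
    set U := (extChartAt (𝓡 n) x).source ∩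
      extChartAt (𝓡 n) x ⁻¹' Metric.ball (extChartAt (𝓡 n) x x) r with hU
    have hUo : IsOpen U := (continuousOn_extChartAt x).isOpen_inter_preimage
      (isOpen_extChartAt_source x) Metric.isOpen_ball
    refine ⟨U, hUo.mem_nhds ⟨mem_extChartAt_source x, by simpa using hr⟩, ?_⟩
    rw [riemannianVolume_apply hUo.measurableSet Set.inter_subset_left,
      chartVolume_apply hUo.measurableSet]
    have hsub : (extChartAt (𝓡 n) x).target ∩ (extChartAt (𝓡 n) x).symm ⁻¹' U ⊆
        Metric.closedBall (extChartAt (𝓡 n) x x) r := by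
      rintro u ⟨h1, h2⟩
      have h3 := h2.2
      simp only [Set.mem_preimage] at h3
      rw [(extChartAt (𝓡 n) x).right_inv h1] at h3
      exact Metric.ball_subset_closedBall h3
    refine (lintegral_mono_set hsub).trans_lt ?_
    exact (((continuousOn_density x).mono hball).integrableOn_compact
      (isCompact_closedBall _ _)).lintegral_lt_top

theorem integral_riemannianVolume_eq {f : M → ℝ} (hf : Continuous f)
    (h0 : ∀ y ∉ (extChartAt (𝓡 n) x).source, f y = 0) :
    ∫ y, f y ∂(riemannianVolume n M) = ∫ u in (extChartAt (𝓡 n) x).target,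
      density n x ((extChartAt (𝓡 n) x).symm u) * f ((extChartAt (𝓡 n) x).symm u) := by
  have hT := (isOpen_extChartAt_target (I := 𝓡 n) x).measurableSet
  have hm : AEMeasurable (extChartAt (𝓡 n) x).symm
      (volume.restrict (extChartAt (𝓡 n) x).target) :=
    (continuousOn_extChartAt_symm x).aemeasurable hT
  have hd : AEMeasurable (chartDensity (n := n) x) (volume.restrict (extChartAt (𝓡 n) x).target) :=
    ((continuousOn_density x).congr fun u hu => chartDensity_eq hu).aemeasurable hT
  rw [← setIntegral_eq_integral_of_forall_compl_eq_zero h0, restrict_riemannianVolume, chartVolume,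
    integral_map (hm.mono_ac (withDensity_absolutelyContinuous _ _)) hf.aestronglyMeasurable,
    integral_withDensity_eq_integral_toReal_smul₀ hd.ennreal_ofReal
      (Filter.Eventually.of_forall fun _ => ENNReal.ofReal_lt_top)]
  refine setIntegral_congr_fun hT fun u hu => ?_
  simp only [chartDensity_eq hu, smul_eq_mul]
  rw [ENNReal.toReal_ofReal (density_pos ((extChartAt (𝓡 n) x).map_target hu)).le]

theorem smoothFn_divergence {X : VField n M} (hX : SmoothField X x) :
    SmoothFn n (divergence X) x := by
  obtain ⟨E, hE, hb⟩ := exists_orthonormal_frame (n := n) x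
  refine (SmoothFn.sum (s := Finset.univ) fun (k : Fin n) _ =>
    ((hE k).leviCivita hX).inner (hE k)).congr ?_
  filter_upwards [hb, hX.eventually] with y ⟨b, hb⟩ hy
  rw [divergence_eq hy b]
  simp only [hb]

theorem continuous_of_smoothFn {f : M → ℝ} (hf : ∀ x, SmoothFn n f x) : Continuous f :=
  continuous_iff_continuousAt.2 fun x => (hf x).contMDiffAt.continuousAt

/-- Integration by parts against the constant function 1. -/
theorem integral_fderiv_eq_zero_of_compactSupport {H : EuclideanSpace ℝ (Fin n) → ℝ}
    (hH : ContDiff ℝ 1 H) (hc : HasCompactSupport H) (a : EuclideanSpace ℝ (Fin n)) :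
    ∫ u, fderiv ℝ H u a = 0 ∧ Integrable fun u => fderiv ℝ H u a := by
  have hi : Integrable fun u => fderiv ℝ H u a :=
    ((hH.continuous_fderiv (by simp)).clm_apply continuous_const).integrable_of_hasCompactSupport
      (hc.fderiv_apply ℝ a)
  refine ⟨?_, hi⟩
  have h := integral_mul_fderiv_eq_neg_fderiv_mul_of_integrable (μ := volume)
    (f := fun _ : EuclideanSpace ℝ (Fin n) => (1 : ℝ)) (g := H) (v := a) (by simp)
    (by simpa using hi) (by simpa using hH.continuous.integrable_of_hasCompactSupport hc)
    (fun _ _ => differentiableAt_const _) (fun u _ => (hH.differentiable (by simp)) u)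
  simpa using h

/-- The divergence theorem for a field supported in the domain of a chart. -/
theorem integral_divergence_eq_zero_of_subset [T2Space M] {X : VField n M}
    (hX : ∀ y, SmoothField X y) {K : Set M} (hK : IsCompact K)
    (hKS : K ⊆ (extChartAt (𝓡 n) x).source) (h0 : ∀ y ∉ K, X y = 0) :
    ∫ y, divergence X y ∂(riemannianVolume n M) = 0 := by
  have hdiv0 : ∀ y ∉ K, divergence X y = 0 := by
    intro y hy
    -- Near such a point the field is an empty sum, and the divergence of an empty sum is the empty
    -- sum.
    have h1 : ∀ᶠ z in 𝓝 y, X z = ∑ i ∈ (∅ : Finset (Fin 0)), (fun _ => X z) i := by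
      filter_upwards [hK.isClosed.isOpen_compl.mem_nhds hy] with z hz
      simpa using h0 z hz
    rw [divergence_congr h1, divergence_sum (X := fun _ => X) ∅ fun _ => hX y]
    simp
  rw [integral_riemannianVolume_eq (continuous_of_smoothFn fun y => smoothFn_divergence (hX y))
    fun y hy => hdiv0 y fun h => hy (hKS h)]
  set φ := extChartAt (𝓡 n) x with hφ
  let c : Fin n → M → ℝ := fun j y => coordOf x y (X y) j
  have hc : ∀ j, ∀ y ∈ φ.source, SmoothFn n (c j) y := fun j y hy => smoothFn_coordOf hy (hX y) j
  have hρ : ∀ y ∈ φ.source, SmoothFn n (density n x) y := fun y hy => (smoothFn_density hy).1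
  let h : Fin n → M → ℝ := fun j y => density n x y * c j y
  have hh : ∀ j, ∀ y ∈ φ.source, SmoothFn n (h j) y := fun j y hy => (hρ y hy).mul (hc j y hy)
  -- The components of ρX in the chart, extended by zero. They vanish off the compact image of `K`,
  -- so the extension is C¹ on the whole space.
  let H : Fin n → EuclideanSpace ℝ (Fin n) → ℝ := fun j => φ.target.indicator (h j ∘ φ.symm)
  have hTo : IsOpen φ.target := isOpen_extChartAt_target x
  have hK' : IsCompact (φ '' K) := hK.image_of_continuousOn ((continuousOn_extChartAt x).mono hKS)
  have hH0 : ∀ j, ∀ u ∉ φ '' K, H j u = 0 := by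
    intro j u hu
    by_cases hT : u ∈ φ.target
    · have : φ.symm u ∉ K := fun hk => hu ⟨_, hk, φ.right_inv hT⟩
      simp [H, hT, h, c, h0 _ this]
    · simp [H, hT]
  have hHd : ∀ j, ContDiff ℝ 1 (H j) := by
    intro j
    refine contDiff_iff_contDiffAt.2 fun u => ?_
    by_cases hu : u ∈ φ '' K
    · have hT : u ∈ φ.target := by
        obtain ⟨y, hy, rfl⟩ := hu
        exact φ.map_source (hKS hy)
      refine (((hh j _ (φ.map_target hT)).contDiffAt_comp_symm hT).of_le (by simp)).congr_of_eventuallyEq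
        ?_
      filter_upwards [hTo.mem_nhds hT] with w hw
      exact Set.indicator_of_mem hw _
    · refine (contDiffAt_const (c := (0 : ℝ))).congr_of_eventuallyEq ?_
      filter_upwards [hK'.isClosed.isOpen_compl.mem_nhds hu] with w hw using hH0 j w hw
  have hHc : ∀ j, HasCompactSupport (H j) := fun j =>
    HasCompactSupport.intro hK' fun u hu => hH0 j u hu
  let e : Fin n → EuclideanSpace ℝ (Fin n) := fun j => EuclideanSpace.single j 1
  -- The product rule together with ∂_j ρ = ρ div ∂_j shows that ∂_j(ρ X^j) = ρ div(X^j ∂_j); the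
  -- fields X^j ∂_j add up to X.
  have key : ∀ u ∈ φ.target, density n x (φ.symm u) * divergence X (φ.symm u) =
      ∑ j, fderiv ℝ (H j) u (e j) := by
    intro u hu
    have hs := φ.map_target hu
    have h1 : ∀ j, fderiv ℝ (H j) u (e j) = density n x (φ.symm u) *
        divergence (fun y => c j y • coordField x (e j) y) (φ.symm u) := by
      intro j
      have h2 : H j =ᶠ[𝓝 u] h j ∘ φ.symm := by
        filter_upwards [hTo.mem_nhds hu] with w hw
        simp [H, hw]
      rw [h2.fderiv_eq, ← dfn_coordField hu _ (hh j _ hs).mdiff,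
        divergence_smul (hc j _ hs) (smoothField_coordField hs _),
        dfn_mul (hρ _ hs) (hc j _ hs), (smoothFn_density hs).2]
      ring
    simp only [h1]
    rw [← Finset.mul_sum, ← divergence_sum Finset.univ fun j =>
      (smoothField_coordField hs (e j)).smul (hc j _ hs)]
    congr 1
    refine divergence_congr ?_
    filter_upwards [(isOpen_extChartAt_source x).mem_nhds hs] with z hz
    rw [← coordField_eq_sum, coordField_coordOf hz]
  rw [setIntegral_congr_fun hTo.measurableSet key,
    setIntegral_eq_integral_of_forall_compl_eq_zero, integral_finsetSum]
  · exact Finset.sum_eq_zero fun j _ =>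
      (integral_fderiv_eq_zero_of_compactSupport (hHd j) (hHc j) _).1
  · exact fun j _ => (integral_fderiv_eq_zero_of_compactSupport (hHd j) (hHc j) _).2
  · intro u hu
    refine Finset.sum_eq_zero fun j _ => ?_
    have h1 : H j =ᶠ[𝓝 u] fun _ => 0 := by
      have h2 : u ∉ φ '' K := by
        rintro ⟨y, hy, rfl⟩
        exact hu (φ.map_source (hKS hy))
      filter_upwards [hK'.isClosed.isOpen_compl.mem_nhds h2] with w hw using hH0 j w hw
    rw [h1.fderiv_eq]
    simp

theorem integrable_of_smoothFn [CompactSpace M] {f : M → ℝ} (hf : ∀ x, SmoothFn n f x) :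
    Integrable f (riemannianVolume n M) :=
  (continuous_of_smoothFn hf).integrable_of_hasCompactSupport
    (HasCompactSupport.of_compactSpace f)

/-- The divergence theorem on a compact manifold. -/
theorem integral_divergence_eq_zero [T2Space M] [CompactSpace M] {X : VField n M}
    (hX : ∀ y, SmoothField X y) : ∫ y, divergence X y ∂(riemannianVolume n M) = 0 := by
  obtain ⟨ρ, hρ⟩ := SmoothPartitionOfUnity.exists_isSubordinate_chartAt_source (𝓡 n) M
  -- Compactness leaves finitely many nonzero cut-off functions, so divergence and integral commute
  -- with the decomposition of `X`.
  have hfin := ρ.locallyFinite.finite_nonempty_of_compact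
  have hsm : ∀ i y, SmoothFn n (ρ i) y := fun i y =>
    Filter.Eventually.of_forall fun z => (ρ i).contMDiff.contMDiffAt
  have hsum : ∀ y, ∑ i ∈ hfin.toFinset, ρ i y = 1 := by
    intro y
    rw [← ρ.sum_eq_one (Set.mem_univ y), finsum_eq_sum_of_support_subset]
    intro i hi
    simp only [Set.Finite.coe_toFinset, Set.mem_ofPred_eq]
    exact ⟨y, hi⟩
  have hXs : ∀ y, divergence X y = ∑ i ∈ hfin.toFinset, divergence (fun z => ρ i z • X z) y := by
    intro y
    rw [← divergence_sum _ fun i => (hX y).smul (hsm i y)]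
    refine divergence_congr (Filter.Eventually.of_forall fun z => ?_)
    rw [← Finset.sum_smul, hsum, one_smul]
  simp only [hXs]
  rw [integral_finsetSum]
  · refine Finset.sum_eq_zero fun i _ => ?_
    refine integral_divergence_eq_zero_of_subset (x := i) (fun y => (hX y).smul (hsm i y))
      (K := tsupport (ρ i)) (isClosed_tsupport _).isCompact ?_ ?_
    · rw [extChartAt_source]
      exact hρ i
    · intro y hy
      rw [image_eq_zero_of_notMem_tsupport hy, zero_smul]
  · exact fun i _ => integrable_of_smoothFn fun y => smoothFn_divergence ((hX y).smul (hsm i y))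

end Volume

/-! ### D and δ are formally adjoint -/

section Adjoint

open MeasureTheory

variable {n : ℕ} {M : Type*} [TopologicalSpace M] [ChartedSpace (EuclideanSpace ℝ (Fin n)) M]
  [IsManifold (𝓡 n) ∞ M] [RiemannianBundle (fun x : M => TangentSpace (𝓡 n) x)]
  [IsContMDiffRiemannianBundle (𝓡 n) ∞ (EuclideanSpace ℝ (Fin n))
      (fun x : M => TangentSpace (𝓡 n) x)] {x : M} {p q : ℕ}

/-- The trace of the covariant derivative of a 1-form is a divergence. -/
theorem exists_divergence_eq {ξ : TField n M Unit} (hξ : IsTensor ξ) :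
    ∃ X : VField n M, (∀ x, SmoothField X x) ∧
      ∀ x, divergence X x = ∑ k, covD ξ x (frame x k) (fun _ => frame x k) := by
  -- The metric dual of ξ. It does not depend on the orthonormal basis, and smoothness is therefore
  -- checked in a smooth local frame.
  let X : VField n M := fun y => ∑ k, ξ y (fun _ => frame y k) • frame y k
  have hsum : ∀ {y : M} {ν : Type} [Fintype ν] (b : OrthonormalBasis ν ℝ (TangentSpace (𝓡 n) y))
      (w : TangentSpace (𝓡 n) y), inner ℝ (∑ k, ξ y (fun _ => b k) • b k) w = ξ y (fun _ => w) := by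
    intro y ν _ b w
    have hv : ∀ v : TangentSpace (𝓡 n) y,
        (fun _ : Unit => v) = Function.update (fun _ : Unit => (0 : TangentSpace (𝓡 n) y)) () v :=
      fun v => funext fun u => by
        rw [Subsingleton.elim u (), Function.update_self]
    conv_rhs => rw [← orthonormalBasis_sum_inner b w, hv, (hξ.multilin y).sum]
    rw [sum_inner]
    refine Finset.sum_congr rfl fun k _ => ?_
    rw [(hξ.multilin y).smul, ← hv, real_inner_smul_left, real_inner_comm, mul_comm]
  have hX : ∀ {y : M} (w : TangentSpace (𝓡 n) y), inner ℝ (X y) w = ξ y (fun _ => w) := fun w =>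
    hsum (frameBasis _) w
  have hXs : ∀ x, SmoothField X x := by
    intro x
    obtain ⟨E, hE, hb⟩ := exists_orthonormal_frame (n := n) x
    refine (SmoothField.sum (s := Finset.univ) fun (k : Fin n) _ =>
      (hE k).smul (hξ.smooth x (fun _ => E k) fun _ => hE k)).congr ?_
    filter_upwards [hb] with y ⟨b, hb⟩
    refine ext_inner_right ℝ fun w => ?_
    rw [hX, ← hsum b]
    simp only [hb]
  refine ⟨X, hXs, fun x => Finset.sum_congr rfl fun k _ => ?_⟩
  have h := dfn_inner (hXs x) (SmoothField.extendVec x (frame x k)) (frame x k)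
  rw [extendVec_self, dfn_congr (g := fun y => ξ y (fun _ => extendVec (frame x k) y))
    (Filter.Eventually.of_forall fun y => hX _), hX] at h
  rw [covD, covDField, Fintype.sum_unique]
  simp only [extendVec_self]
  rw [h]
  have h2 : Function.update (fun _ : Unit => frame x k) default
      (leviCivita (extendVec (frame x k)) x (frame x k)) =
      fun _ => leviCivita (extendVec (frame x k)) x (frame x k) := by
    funext u
    simp
  rw [h2]
  ring

theorem pointInner_eq (φ η : TensorField n M p q) (x : M) :
    pointInner φ η x = ((p.factorial : ℝ) * (q.factorial : ℝ))⁻¹ *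
      ∑ S : Fin p ⊕ Fin q → _, flat φ x (fun s => frame x (S s)) *
        flat η x (fun s => frame x (S s)) := by
  rw [pointInner, formInner, ← (Equiv.sumArrowEquivProdArrow _ _ _).symm.sum_comp,
    Fintype.sum_prod_type]
  rfl

theorem smoothFn_pointInner {φ η : TensorField n M p q} (hφ : IsForm φ) (hη : IsForm η) (x : M) :
    SmoothFn n (pointInner φ η) x := by
  -- The inner product is the complete contraction of φ ⊗ η; no argument is left free, whence the
  -- index type `Empty`.
  have hT := (((hφ.tensor.tprod hη.tensor).reindex
    (Equiv.sumEmpty ((Fin p ⊕ Fin q) ⊕ (Fin p ⊕ Fin q)) Empty).symm).contr.const_mul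
      (((p.factorial : ℝ) * (q.factorial : ℝ))⁻¹)).smooth x (fun i => i.elim) (fun i => i.elim)
  refine hT.congr (Filter.Eventually.of_forall fun y => ?_)
  rw [pointInner_eq]
  rfl

/-- The relabelling of the arguments of `α ⊗ β` in the 1-form `v ↦ ⟨α, β(v, ·)⟩`. -/
def interiorEquiv (p q : ℕ) : (Fin p ⊕ Fin q) ⊕ (Fin (p + 1) ⊕ Fin q) ≃
    ((Fin p ⊕ Fin q) ⊕ (Fin p ⊕ Fin q)) ⊕ Unit where
  toFun := Sum.elim (fun s => Sum.inl (Sum.inl s)) (Sum.elim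
    (Fin.cons (α := fun _ => ((Fin p ⊕ Fin q) ⊕ (Fin p ⊕ Fin q)) ⊕ Unit) (Sum.inr ())
      fun j => Sum.inl (Sum.inr (Sum.inl j))) fun k => Sum.inl (Sum.inr (Sum.inr k)))
  invFun := Sum.elim (Sum.elim (fun s => Sum.inl s)
    (Sum.elim (fun j => Sum.inr (Sum.inl j.succ)) fun k => Sum.inr (Sum.inr k)))
    fun _ => Sum.inr (Sum.inl 0)
  left_inv o := by
    rcases o with s | (j | k)
    · rfl
    · refine Fin.cases ?_ (fun j => ?_) j <;> simp
    · simp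
  right_inv s := by
    rcases s with (s | (j | k)) | _ <;> simp

/-- By antisymmetry of β each of the p + 1 terms of Dα contributes the same sum over all
multi-indices: removing index `i` and moving it to the front is a bijection. The factor p + 1 turns
1/(p + 1)! into 1/p!. -/
theorem pointInner_extD {α : TensorField n M p q} {β : TensorField n M (p + 1) q}
    (hβ : IsForm β) (x : M) :
    pointInner (extD α) β x = ((p.factorial : ℝ) * (q.factorial : ℝ))⁻¹ *
      ∑ k, ∑ I : Fin p → _, ∑ J : Fin q → _,
        nabla α x (frame x k) (fun a => frame x (I a)) (fun b => frame x (J b)) *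
        β x (Fin.cons (α := fun _ => TangentSpace (𝓡 n) x) (frame x k) fun a => frame x (I a))
          (fun b => frame x (J b)) := by
  set G := fun (k : Fin (Module.finrank ℝ (TangentSpace (𝓡 n) x))) (I : Fin p → _) (J : Fin q → _) =>
    nabla α x (frame x k) (fun a => frame x (I a)) (fun b => frame x (J b)) *
    β x (Fin.cons (α := fun _ => TangentSpace (𝓡 n) x) (frame x k) fun a => frame x (I a))
      (fun b => frame x (J b)) with hG
  have hmult : ∀ Z, IsMultilin fun Y => β x Y Z := fun Z =>
    (hβ.tensor.multilin x).elim_left Z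
  have h1 : ∀ (I : Fin (p + 1) → Fin (Module.finrank ℝ (TangentSpace (𝓡 n) x))) (J : Fin q → _),
      extD α x (fun a => frame x (I a)) (fun b => frame x (J b)) *
        β x (fun a => frame x (I a)) (fun b => frame x (J b)) =
      ∑ i : Fin (p + 1), G (I i) (i.removeNth I) J := by
    intro I J
    rw [extD, Finset.sum_mul]
    refine Finset.sum_congr rfl fun i _ => ?_
    -- Moving argument `i` of β to the front costs (-1)^i, which cancels the sign in D.
    have h2 := (hmult fun b => frame x (J b)).neg_one_pow_mul_cons
      (fun m i j h => hβ.swap_left x m _ i j h) i (frame x (I i)) (fun a => frame x (I a))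
    have h3 : Function.update (fun a => frame x (I a)) i (frame x (I i)) =
        fun a => frame x (I a) := Function.update_eq_self i fun a => frame x (I a)
    rw [h3] at h2
    rw [← h2]
    have h4 : (-1 : ℝ) ^ (i : ℕ) * (-1 : ℝ) ^ (i : ℕ) = 1 := by rw [← mul_pow]; simp
    simp only [hG]
    have h5 : i.removeNth (fun a => frame x (I a)) = fun a => frame x (i.removeNth I a) := rfl
    rw [h5]
    linear_combination (nabla α x (frame x (I i)) (fun a => frame x (i.removeNth I a))
      (fun b => frame x (J b)) * β x (Fin.cons (α := fun _ => TangentSpace (𝓡 n) x)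
        (frame x (I i)) fun a => frame x (i.removeNth I a)) (fun b => frame x (J b))) * h4
  have h2 : ∀ i : Fin (p + 1),
      ∑ I : Fin (p + 1) → Fin (Module.finrank ℝ (TangentSpace (𝓡 n) x)), ∑ J : Fin q → _,
        G (I i) (i.removeNth I) J = ∑ k, ∑ I : Fin p → _, ∑ J : Fin q → _, G k I J := by
    intro i
    rw [← (Fin.insertNthEquiv (fun _ => Fin (Module.finrank ℝ (TangentSpace (𝓡 n) x))) i).sum_comp,
      Fintype.sum_prod_type]
    refine Finset.sum_congr rfl fun k _ => Finset.sum_congr rfl fun I _ =>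
      Finset.sum_congr rfl fun J _ => ?_
    have h3 : i.removeNth (Fin.insertNth (α := fun _ =>
      Fin (Module.finrank ℝ (TangentSpace (𝓡 n) x))) i k I) = I :=
      funext fun j => Fin.insertNth_apply_succAbove (α := fun _ =>
        Fin (Module.finrank ℝ (TangentSpace (𝓡 n) x))) i k I j
    have h4 : Fin.insertNth (α := fun _ =>
      Fin (Module.finrank ℝ (TangentSpace (𝓡 n) x))) i k I i = k :=
      Fin.insertNth_apply_same (α := fun _ =>
        Fin (Module.finrank ℝ (TangentSpace (𝓡 n) x))) i k I
    exact congrArg₂ (fun a b => G a b J) h4 h3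
  change ((((p + 1).factorial : ℕ) : ℝ) * _)⁻¹ * (∑ I : Fin (p + 1) → _, ∑ J : Fin q → _,
    extD α x (fun a => frame x (I a)) (fun b => frame x (J b)) *
        β x (fun a => frame x (I a)) (fun b => frame x (J b))) = _
  simp only [h1]
  rw [Finset.sum_congr rfl fun I _ => Finset.sum_comm, Finset.sum_comm, Finset.sum_congr rfl
    fun i _ => h2 i, Finset.sum_const, Finset.card_univ, Fintype.card_fin, nsmul_eq_mul,
    Nat.factorial_succ]
  push_cast
  have hp : ((p : ℝ) + 1) ≠ 0 := by positivity
  have hp' : (p.factorial : ℝ) ≠ 0 := by positivity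
  have hq' : (q.factorial : ℝ) ≠ 0 := by positivity
  field_simp
  rfl

/-- `δ` is the formal adjoint of `D`. -/
theorem exists_divergence_adjoint {α : TensorField n M p q} {β : TensorField n M (p + 1) q}
    (hα : IsForm α) (hβ : IsForm β) : ∃ X : VField n M, (∀ x, SmoothField X x) ∧
      ∀ x, pointInner (extD α) β x = pointInner (p := p) α (codiff β) x + divergence X x := by
  -- The 1-form is v ↦ ⟨α, β(v,·)⟩, a contraction of α ⊗ β with one argument of β left free. By the
  -- Leibniz rule the trace of its derivative is ⟨Dα, β⟩ - ⟨α, δβ⟩.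
  have hT := (hα.tensor.tprod hβ.tensor).reindex (interiorEquiv p q)
  obtain ⟨X, hX, hdiv⟩ := exists_divergence_eq
    (hT.contr.const_mul (((p.factorial : ℝ) * (q.factorial : ℝ))⁻¹))
  refine ⟨X, hX, fun x => ?_⟩
  rw [pointInner_extD hβ, hdiv]
  have h1 : ∀ k, covD (contr (reindex (interiorEquiv p q) (tprod (flat α) (flat β)))) x (frame x k)
      (fun _ => frame x k) = ∑ I : Fin p → _, ∑ J : Fin q → _,
      (nabla α x (frame x k) (fun a => frame x (I a)) (fun b => frame x (J b)) *
        β x (Fin.cons (α := fun _ => TangentSpace (𝓡 n) x) (frame x k) fun a => frame x (I a))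
          (fun b => frame x (J b)) +
      α x (fun a => frame x (I a)) (fun b => frame x (J b)) *
        nabla β x (frame x k) (Fin.cons (α := fun _ => TangentSpace (𝓡 n) x) (frame x k)
          fun a => frame x (I a)) (fun b => frame x (J b))) := by
    intro k
    rw [covD_contr hT (frameBasis x), ← (Equiv.sumArrowEquivProdArrow _ _ _).symm.sum_comp,
      Fintype.sum_prod_type]
    refine Finset.sum_congr rfl fun I _ => Finset.sum_congr rfl fun J _ => ?_
    rw [covD_reindex, covD_tprod hα.tensor hβ.tensor]
    have h2 : (fun i => Sum.elim (Sum.elim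
        (fun s => frameBasis x ((Equiv.sumArrowEquivProdArrow (Fin p) (Fin q) _).symm (I, J) s))
        (fun s => frameBasis x ((Equiv.sumArrowEquivProdArrow (Fin p) (Fin q) _).symm (I, J) s)))
        (fun _ : Unit => frame x k) (interiorEquiv p q (Sum.inr i))) =
        Sum.elim (Fin.cons (α := fun _ => TangentSpace (𝓡 n) x) (frame x k)
          fun a => frame x (I a)) (fun b => frame x (J b)) := by
      funext s
      rcases s with j | j
      · refine Fin.cases ?_ (fun j => ?_) j <;> rfl
      · rfl
    have h3 : (fun i => Sum.elim (Sum.elim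
        (fun s => frameBasis x ((Equiv.sumArrowEquivProdArrow (Fin p) (Fin q) _).symm (I, J) s))
        (fun s => frameBasis x ((Equiv.sumArrowEquivProdArrow (Fin p) (Fin q) _).symm (I, J) s)))
        (fun _ : Unit => frame x k) (interiorEquiv p q (Sum.inl i))) =
        Sum.elim (fun a => frame x (I a)) (fun b => frame x (J b)) := by
      funext s
      rcases s with j | j <;> rfl
    rw [h2, h3, ← nabla_eq, ← nabla_eq]
    rfl
  simp only [covD_const_mul _ hT.contr, h1]
  rw [pointInner, formInner, ← Finset.mul_sum, ← mul_add]
  congr 1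
  have h4 : ∀ (I : Fin p → _) (J : Fin q → _), α x (fun a => onb _ (I a)) (fun b => onb _ (J b)) *
      codiff β x (fun a => onb _ (I a)) (fun b => onb _ (J b)) =
      -∑ k, α x (fun a => frame x (I a)) (fun b => frame x (J b)) *
        nabla β x (frame x k) (Fin.cons (α := fun _ => TangentSpace (𝓡 n) x) (frame x k)
          fun a => frame x (I a)) (fun b => frame x (J b)) := by
    intro I J
    rw [← Finset.mul_sum, ← mul_neg]
    rfl
  have h5 : ∀ F : Fin (Module.finrank ℝ (TangentSpace (𝓡 n) x)) →
      (Fin p → Fin (Module.finrank ℝ (TangentSpace (𝓡 n) x))) →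
      (Fin q → Fin (Module.finrank ℝ (TangentSpace (𝓡 n) x))) → ℝ,
      ∑ I, ∑ J, ∑ k, F k I J = ∑ k, ∑ I, ∑ J, F k I J := by
    intro F
    rw [Finset.sum_congr rfl fun I _ => Finset.sum_comm, Finset.sum_comm]
  have h6 := Finset.sum_congr (s₁ := Finset.univ) rfl fun I _ =>
    Finset.sum_congr (s₁ := Finset.univ) rfl fun J _ => h4 I J
  rw [Finset.sum_congr rfl fun I _ => Finset.sum_neg_distrib _, Finset.sum_neg_distrib, h5] at h6
  refine Eq.trans ?_ (congrArg₂ (· + ·) h6.symm rfl)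
  simp only [Finset.sum_add_distrib]
  ring

end Adjoint

/-! ### L² products of double forms on compact manifolds -/

section Integration

open MeasureTheory

variable {n : ℕ} {M : Type*} [TopologicalSpace M] [ChartedSpace (EuclideanSpace ℝ (Fin n)) M]
  [IsManifold (𝓡 n) ∞ M] [RiemannianBundle (fun x : M => TangentSpace (𝓡 n) x)]
  [IsContMDiffRiemannianBundle (𝓡 n) ∞ (EuclideanSpace ℝ (Fin n))
      (fun x : M => TangentSpace (𝓡 n) x)] {p q : ℕ}

theorem pointInner_comm (φ η : TensorField n M p q) : pointInner φ η = pointInner η φ := by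
  funext x
  simp only [pointInner, formInner, mul_comm]

theorem pointInner_add (φ ψ η : TensorField n M p q) :
    pointInner (φ + ψ) η = pointInner φ η + pointInner ψ η := by
  funext x
  simp only [pointInner, formInner, Pi.add_apply, add_mul, Finset.sum_add_distrib, mul_add]

theorem pointInner_smul (c : ℝ) (φ η : TensorField n M p q) :
    pointInner (c • φ) η = c • pointInner φ η := by
  funext x
  simp only [pointInner, formInner, Pi.smul_apply, smul_eq_mul, mul_assoc, ← Finset.mul_sum]
  ring

theorem pointInner_transpose (φ η : TensorField n M p q) :
    pointInner (transpose φ) (transpose η) = pointInner φ η := by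
  funext x
  rw [pointInner, pointInner, formInner, formInner, Finset.sum_comm,
    mul_comm (q.factorial : ℝ)]
  rfl

theorem pointInner_zero (η : TensorField n M p q) : pointInner 0 η = 0 := by
  funext x
  simp [pointInner, formInner]

theorem pointInner_self_nonneg (φ : TensorField n M p q) (x : M) : 0 ≤ pointInner φ φ x := by
  rw [pointInner_eq]
  exact mul_nonneg (by positivity) (Finset.sum_nonneg fun S _ => mul_self_nonneg _)

theorem IsForm.eq_zero_of_pointInner {φ : TensorField n M p q} (hφ : IsForm φ)
    (h : pointInner φ φ = 0) : φ = 0 := by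
  have h1 : ∀ x (S : Fin p ⊕ Fin q → Fin (Module.finrank ℝ (TangentSpace (𝓡 n) x))),
      flat φ x (fun s => frame x (S s)) = 0 := by
    intro x S
    have h2 := congrFun h x
    have hc : ((p.factorial : ℝ) * (q.factorial : ℝ))⁻¹ ≠ 0 := by positivity
    rw [pointInner_eq, Pi.zero_apply, mul_eq_zero, or_iff_right hc,
      Finset.sum_eq_zero_iff_of_nonneg fun S _ => mul_self_nonneg _] at h2
    exact mul_self_eq_zero.1 (h2 S (Finset.mem_univ S))
  funext x Y Z
  rw [← flat_elim φ, show Sum.elim Y Z = fun s => ∑ k, (inner ℝ (Sum.elim Y Z s) (frame x k) : ℝ) •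
    frame x k from funext fun s => (orthonormalBasis_sum_inner (frameBasis x) _).symm,
    (hφ.tensor.multilin x).map_basis_sum]
  simp only [h1, mul_zero, Finset.sum_const_zero]
  rfl

variable [MeasurableSpace M] [BorelSpace M] [CompactSpace M]

theorem l2Defined {φ η : TensorField n M p q} (hφ : IsForm φ) (hη : IsForm η) : L2Defined φ η :=
  integrable_of_smoothFn (smoothFn_pointInner hφ hη)

/-- A nonnegative continuous function with integral zero vanishes almost everywhere, hence
everywhere, because the measure charges open sets. -/
theorem IsForm.eq_zero_of_l2Inner {φ : TensorField n M p q} (hφ : IsForm φ)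
    (h : l2Inner φ φ = 0) : φ = 0 := by
  refine hφ.eq_zero_of_pointInner ?_
  rw [l2Inner, integral_eq_zero_iff_of_nonneg (fun x => pointInner_self_nonneg φ x)
    (l2Defined hφ hφ)] at h
  exact (continuous_of_smoothFn (smoothFn_pointInner hφ hφ)).ae_eq_iff_eq _ continuous_zero |>.1 h

theorem l2Inner_self_nonneg (φ : TensorField n M p q) : 0 ≤ l2Inner φ φ :=
  integral_nonneg fun x => pointInner_self_nonneg φ x

theorem l2Inner_comm (φ η : TensorField n M p q) : l2Inner φ η = l2Inner η φ := by
  rw [l2Inner, l2Inner, pointInner_comm]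

variable [T2Space M]

/-- `δ` is the adjoint of `D`. -/
theorem l2Inner_extD {α : TensorField n M p q} {β : TensorField n M (p + 1) q}
    (hα : IsForm α) (hβ : IsForm β) :
    l2Inner (extD α) β = l2Inner (p := p) α (codiff β) := by
  obtain ⟨X, hX, h⟩ := exists_divergence_adjoint hα hβ
  have h1 := integral_divergence_eq_zero hX
  have h2 : divergence X = fun x => pointInner (extD α) β x - pointInner (p := p) α (codiff β) x := by
    funext x
    rw [h]
    ring
  rw [h2, integral_sub (l2Defined hα.extD hβ) (l2Defined hα hβ.codiff)] at h1
  exact sub_eq_zero.1 h1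

theorem l2Defined_hodgeLaplacian {φ : TensorField n M p q} (hφ : IsForm φ) :
    L2Defined (hodgeLaplacian φ) φ := by
  cases p with
  | zero => exact l2Defined hφ.extD.codiff hφ
  | succ m =>
    have h := (l2Defined hφ.codiff.extD hφ).add (l2Defined hφ.extD.codiff hφ)
    rw [← pointInner_add] at h
    exact h

/-- Adjointness is used twice, for the pair (φ, Dφ) and for the pair (δφ, φ). -/
theorem l2Inner_hodgeLaplacian {φ : TensorField n M p q} (hφ : IsForm φ) :
    l2Inner (hodgeLaplacian φ) φ =
      l2Inner (extD φ) (extD φ) + l2Inner (codiff φ) (codiff φ) := by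
  have h1 : l2Inner (p := p) (codiff (extD φ)) φ = l2Inner (extD φ) (extD φ) := by
    rw [l2Inner_comm, l2Inner_extD hφ hφ.extD]
  cases p with
  | zero =>
    -- Here `0 - 1 = 0`, so δφ nominally has degree 0; it is zero by convention and contributes
    -- nothing.
    have h2 : l2Inner (codiff φ) (codiff φ) = 0 := by
      change l2Inner (0 : TensorField n M 0 q) 0 = 0
      rw [l2Inner, pointInner_zero]
      simp
    rw [h2, add_zero, ← h1]
    rfl
  | succ m =>
    have h2 : l2Inner (extD (p := m) (codiff φ)) φ = l2Inner (p := m) (codiff φ) (codiff φ) :=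
      l2Inner_extD hφ.codiff hφ
    refine Eq.trans ?_ ((add_comm _ _).trans (congrArg₂ (· + ·) h1 h2))
    rw [l2Inner, l2Inner, l2Inner, ← integral_add (l2Defined hφ.codiff.extD hφ)
      (l2Defined hφ.extD.codiff hφ)]
    refine integral_congr_ae (Filter.Eventually.of_forall fun x => ?_)
    exact congrFun (pointInner_add _ _ _) x

end Integration

/-! ### The Lichnerowicz Laplacian and its kernel -/

section Main

variable {n : ℕ} {M : Type*} [TopologicalSpace M] [ChartedSpace (EuclideanSpace ℝ (Fin n)) M]
  [IsManifold (𝓡 n) ∞ M] [RiemannianBundle (fun x : M => TangentSpace (𝓡 n) x)]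
  [IsContMDiffRiemannianBundle (𝓡 n) ∞ (EuclideanSpace ℝ (Fin n))
      (fun x : M => TangentSpace (𝓡 n) x)] {p q : ℕ}

theorem l2Inner_transpose [MeasurableSpace M] (φ η : TensorField n M p q) :
    l2Inner (transpose φ) (transpose η) = l2Inner φ η := by
  rw [l2Inner, l2Inner, pointInner_transpose]

theorem nabla_zero (x : M) (v : TangentSpace (𝓡 n) x) :
    nabla (0 : TensorField n M p q) x v = 0 := by
  funext Y Z
  simp [nabla]
  exact dfn_const 0 v

theorem extD_zero : extD (0 : TensorField n M p q) = 0 := by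
  funext x Y Z
  simp [extD, nabla_zero]

theorem codiff_eq_zero : codiff (0 : TensorField n M p q) = 0 := by
  cases p with
  | zero => rfl
  | succ m =>
    funext x Y Z
    simp [codiff, nabla_zero]

theorem hodgeLaplacian_eq_zero {φ : TensorField n M p q} (hD : extD φ = 0) (hd : codiff φ = 0) :
    hodgeLaplacian φ = 0 := by
  have h1 : codiff (extD φ) = 0 := by rw [hD, codiff_eq_zero]
  cases p with
  | zero => exact h1
  | succ m =>
    have h2 : extD (p := m) (codiff φ) = 0 := by
      rw [show (codiff φ : TensorField n M m q) = 0 from hd, extD_zero]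
    have h3 : ∀ ψ₁ ψ₂ : TensorField n M (m + 1) q, ψ₁ = 0 → ψ₂ = 0 → ψ₁ + ψ₂ = 0 := by
      rintro _ _ rfl rfl
      exact add_zero _
    exact h3 _ _ h2 h1

theorem transpose_eq_zero {φ : TensorField n M p q} : transpose φ = 0 ↔ φ = 0 :=
  ⟨fun h => congrArg transpose h, fun h => congrArg transpose h⟩

variable [T2Space M] [MeasurableSpace M] [BorelSpace M] [CompactSpace M]
  (B : ∀ x : M, CurvatureEigenbasis n x)

theorem l2Defined_codiff {φ : TensorField n M p q} (hφ : IsForm φ) :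
    L2Defined (codiff φ) (codiff φ) := by
  cases p with
  | zero =>
    rw [L2Defined, codiff_zero, pointInner_zero]
    exact MeasureTheory.integrable_zero _ _ _
  | succ m => exact l2Defined hφ.codiff hφ.codiff

theorem codiff_eq_zero_of_l2Inner {φ : TensorField n M p q} (hφ : IsForm φ)
    (h : l2Inner (codiff φ) (codiff φ) = 0) : codiff φ = 0 := by
  cases p with
  | zero => rfl
  | succ m => exact IsForm.eq_zero_of_l2Inner (p := m) hφ.codiff h

theorem L2Defined.transpose {φ η : TensorField n M p q} (h : L2Defined φ η) :
    L2Defined (transpose φ) (transpose η) := by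
  rw [L2Defined, pointInner_transpose]
  exact h

/-- Transposition preserves the pointwise inner product, so the term with Δ̃ is the term with Δ for
the transposed form, and every statement about D and δ is reused for D̃ and δ̃. -/
theorem pointInner_lichnerowiczLaplacian {φ : TensorField n M p q} (hφ : IsForm φ) :
    pointInner (lichnerowiczLaplacian B φ) φ = (1 / 2 : ℝ) • (pointInner (hodgeLaplacian φ) φ +
      pointInner (hodgeLaplacian (transpose φ)) (transpose φ)) := by
  rw [lichnerowiczLaplacian_eq B hφ, pointInner_smul, pointInner_add,
    hodgeLaplacianTilde_eq_transpose,
    ← pointInner_transpose (hodgeLaplacian (transpose φ)) (transpose φ)]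
  rfl

theorem l2Defined_lichnerowiczLaplacian {φ : TensorField n M p q} (hφ : IsForm φ) :
    L2Defined (lichnerowiczLaplacian B φ) φ := by
  rw [L2Defined, pointInner_lichnerowiczLaplacian B hφ]
  exact ((l2Defined_hodgeLaplacian hφ).add (l2Defined_hodgeLaplacian hφ.transpose)).smul _

theorem l2Inner_lichnerowiczLaplacian {φ : TensorField n M p q} (hφ : IsForm φ) :
    l2Inner (lichnerowiczLaplacian B φ) φ = (1 / 2 : ℝ) *
      (l2Inner (extD φ) (extD φ) + l2Inner (codiff φ) (codiff φ) +
        l2Inner (extDTilde φ) (extDTilde φ) + l2Inner (codiffTilde φ) (codiffTilde φ)) := by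
  have h : l2Inner (lichnerowiczLaplacian B φ) φ = (1 / 2 : ℝ) *
      (l2Inner (hodgeLaplacian φ) φ +
        l2Inner (hodgeLaplacian (transpose φ)) (transpose φ)) := by
    rw [l2Inner, pointInner_lichnerowiczLaplacian B hφ, l2Inner, l2Inner,
      ← MeasureTheory.integral_add (l2Defined_hodgeLaplacian hφ)
      (l2Defined_hodgeLaplacian hφ.transpose), ← MeasureTheory.integral_const_mul]
    rfl
  rw [h, l2Inner_hodgeLaplacian hφ, l2Inner_hodgeLaplacian hφ.transpose, extDTilde, codiffTilde,
    l2Inner_transpose, l2Inner_transpose]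
  ring

theorem lichnerowiczLaplacian_eq_zero_iff {φ : TensorField n M p q} (hφ : IsForm φ) :
    lichnerowiczLaplacian B φ = 0 ↔
      extD φ = 0 ∧ codiff φ = 0 ∧ extDTilde φ = 0 ∧ codiffTilde φ = 0 := by
  constructor
  · intro h
    have h1 := l2Inner_lichnerowiczLaplacian B hφ
    have h0 : l2Inner (0 : TensorField n M p q) φ = 0 := by
      rw [l2Inner, pointInner_zero]
      simp
    rw [h, h0, extDTilde, codiffTilde, l2Inner_transpose, l2Inner_transpose] at h1
    -- Four nonnegative numbers with sum zero are all zero.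
    have hD := l2Inner_self_nonneg (extD φ)
    have hd := l2Inner_self_nonneg (codiff φ)
    have hD' := l2Inner_self_nonneg (extD (transpose φ))
    have hd' := l2Inner_self_nonneg (codiff (transpose φ))
    exact ⟨hφ.extD.eq_zero_of_l2Inner (by linarith),
      codiff_eq_zero_of_l2Inner hφ (by linarith),
      transpose_eq_zero.2 (hφ.transpose.extD.eq_zero_of_l2Inner (by linarith)),
      transpose_eq_zero.2 (codiff_eq_zero_of_l2Inner hφ.transpose (by linarith))⟩
  · rintro ⟨hD, hd, hD', hd'⟩
    rw [lichnerowiczLaplacian_eq B hφ, hodgeLaplacianTilde_eq_transpose,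
      hodgeLaplacian_eq_zero hD hd, hodgeLaplacian_eq_zero (transpose_eq_zero.1 hD')
        (transpose_eq_zero.1 hd'), transpose_eq_zero.2 rfl, add_zero, smul_zero]

end Main

end DoubleForms
end

/-! ### The theorem -/

theorem mainTheorem8 (n : ℕ) (M : Type*) [TopologicalSpace M] [T2Space M]
    [ChartedSpace (EuclideanSpace ℝ (Fin n)) M] [IsManifold (𝓡 n) ∞ M]
    [RiemannianBundle (fun x : M => TangentSpace (𝓡 n) x)]
    [IsContMDiffRiemannianBundle (𝓡 n) ∞ (EuclideanSpace ℝ (Fin n))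
      (fun x : M => TangentSpace (𝓡 n) x)]
    [MeasurableSpace M] [BorelSpace M] (p q : ℕ) :
    (∀ x : M, Nonempty (DoubleForms.CurvatureEigenbasis n x)) ∧
    ∀ B : ∀ x : M, DoubleForms.CurvatureEigenbasis n x,
      ∀ φ : DoubleForms.DoubleForm n M p q,
        DoubleForms.lichnerowiczLaplacian B φ.toField =
            (1 / 2 : ℝ) • (DoubleForms.hodgeLaplacian φ.toField +
              DoubleForms.hodgeLaplacianTilde φ.toField) ∧
        (CompactSpace M →
          (DoubleForms.L2Defined (DoubleForms.lichnerowiczLaplacian B φ.toField) φ.toField ∧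
            DoubleForms.L2Defined (DoubleForms.extD φ.toField) (DoubleForms.extD φ.toField) ∧
            DoubleForms.L2Defined (DoubleForms.codiff φ.toField) (DoubleForms.codiff φ.toField) ∧
            DoubleForms.L2Defined (DoubleForms.extDTilde φ.toField)
              (DoubleForms.extDTilde φ.toField) ∧
            DoubleForms.L2Defined (DoubleForms.codiffTilde φ.toField)
              (DoubleForms.codiffTilde φ.toField)) ∧
          DoubleForms.l2Inner (DoubleForms.lichnerowiczLaplacian B φ.toField) φ.toField =
            (1 / 2 : ℝ) *
              (DoubleForms.l2Inner (DoubleForms.extD φ.toField) (DoubleForms.extD φ.toField) +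
                DoubleForms.l2Inner (DoubleForms.codiff φ.toField)
                  (DoubleForms.codiff φ.toField) +
                DoubleForms.l2Inner (DoubleForms.extDTilde φ.toField)
                  (DoubleForms.extDTilde φ.toField) +
                DoubleForms.l2Inner (DoubleForms.codiffTilde φ.toField)
                  (DoubleForms.codiffTilde φ.toField)) ∧
          (DoubleForms.lichnerowiczLaplacian B φ.toField = 0 ↔
            DoubleForms.extD φ.toField = 0 ∧ DoubleForms.codiff φ.toField = 0 ∧
              DoubleForms.extDTilde φ.toField = 0 ∧
              DoubleForms.codiffTilde φ.toField = 0)) := by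
  refine ⟨DoubleForms.nonempty_curvatureEigenbasis, fun B φ =>
    ⟨DoubleForms.lichnerowiczLaplacian_eq B φ.isForm, fun _ => ⟨⟨?_, ?_, ?_, ?_, ?_⟩,
      DoubleForms.l2Inner_lichnerowiczLaplacian B φ.isForm,
      DoubleForms.lichnerowiczLaplacian_eq_zero_iff B φ.isForm⟩⟩⟩
  · exact DoubleForms.l2Defined_lichnerowiczLaplacian B φ.isForm
  · exact DoubleForms.l2Defined φ.isForm.extD φ.isForm.extD
  · exact DoubleForms.l2Defined_codiff φ.isForm
  · exact (DoubleForms.l2Defined φ.isForm.transpose.extD φ.isForm.transpose.extD).transpose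
  · exact (DoubleForms.l2Defined_codiff φ.isForm.transpose).transpose
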